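/- Let $t_0>0$, $\alpha>0$, $K>0$, and let $p,q\in C^3([t_0,\infty))$ be real functions with $p(t)\neq0$ and $q'(t)\neq0$ for all $t\ge t_0$. Suppose that, as $t\to\infty$, $$p(t)\sim t^{-\alpha},\quad p'(t)\sim-\alpha t^{-\alpha-1},\quad p''(t)\sim\alpha(\alpha+1)t^{-\alpha-2},\quad p'''(t)=O(t^{-\alpha-3}),$$ $$q(t)\sim Kt,\quad q'(t)\sim K,\quad q''(t)=o(t^{-3}),\quad q'''(t)=o(t^{-2}),$$ where $f\sim g$ means $f(t)/g(t)\to1$. Put $$a=\frac{2p'}{p}+\frac{q''}{q'},\qquad b=q'^2+\frac{2p'^2}{p^2}-\frac{p''}{p}+\frac{p'q''}{pq'},$$ and consider the equation $$\ddot x-a(t)\,\dot x+b(t)\,x=0,\qquad t\in[t_0,\infty),\tag{1}$$ and, for $\gamma>0$, $\delta=(\gamma+1)/\gamma$ and $z_0=(\gamma/t_0)^{\gamma}$, the system $$\dot x=y,\qquad \dot y=-b(\gamma z^{-1/\gamma})\,x+a(\gamma z^{-1/\gamma})\,y,\qquad \dot z=-z^{\delta},\qquad z\in(0,z_0].\tag{2}$$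 A trajectory of (2) is a set $\Gamma=\{(x(s),y(s),z(s)):s\ge s_0\}\subset\mathbb R^3$, where $s_0\in\mathbb R$ and $(x,y,z)$ solves (2) on $[s_0,\infty)$; it is called nontrivial if $(x,y)$ is not identically $(0,0)$. A spiral is a set given in polar coordinates by $r=f(\varphi)$, $\varphi\ge\varphi_1>0$, where $f>0$, $f(\varphi)\to0$ as $\varphi\to\infty$, and $k\mapsto f(\varphi+2k\pi)$, $k\in\mathbb N$, is decreasing for each $\varphi\ge\varphi_1$, or the mirror image of such a set in the $x$-axis. For bounded $A\subset\mathbb R^N$ with open $\varepsilon$-neighbourhood $A_\varepsilon$, the lower and upper box dimensions are the infima of those $s\ge0$ for which the lower, respectively upper, limit of $|A_\varepsilon|/\varepsilon^{N-s}$ as $\varepsilon\to0^+$ is $0$; $\dim_BA$ is their common value. Then: (i) For every solution $x\not\equiv0$ of (1) the phase portrait $\{(x(t),\dot x(t)):t\ge t_0\}$ is a spiral near the origin, that is, $\{(x(t),\dot x(t)):t\ge t_1\}$ is a spiral for some $t_1\ge t_0$. If $\alpha\in(0,1)$, the phase dimension of $x$ is $\dim_B\{(x(t),\dot x(t)):t\ge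 t_0\}=\frac{2}{1+\alpha}$. (ii) If $\alpha\in(0,1)$ and $\gamma\ge\alpha$, every nontrivial trajectory $\Gamma$ of (2) has $\dim_B\Gamma=\frac{2}{1+\alpha}$. (iii) If $\alpha\in(0,1)$ and $0<\gamma<\alpha$, every nontrivial trajectory $\Gamma$ of (2) has $\dim_B\Gamma=2-\frac{\alpha+\gamma}{1+\gamma}$. (iv) If $\alpha>1$ and $\gamma>0$, every trajectory $\Gamma$ of (2) is rectifiable (has finite length), and $\dim_B\Gamma=1$. In (ii)–(iv) the box dimension exists, i.e. the lower and upper box dimensions coincide; likewise in (i). -/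

import Mathlib

open Set Filter Topology MeasureTheory Asymptotics

noncomputable section

namespace SpiralTraj

/-! ### Minkowski contents and box dimension -/

/-- Lower `s`-dimensional Minkowski content: `liminf_{ε → 0+} |A_ε| / ε ^ (N - s)`, where
`A_ε` is the open `ε`-neighbourhood of `A ⊆ ℝ^N`. -/
def lowerMinkowskiContent {N : ℕ} (s : ℝ) (A : Set (EuclideanSpace ℝ (Fin N))) : ENNReal :=
  liminf (fun ε : ℝ => volume (Metric.thickening ε A) / ENNReal.ofReal (ε ^ ((N : ℝ) - s)))
    (𝓝[>] (0 : ℝ))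

/-- Upper `s`-dimensional Minkowski content. -/
def upperMinkowskiContent {N : ℕ} (s : ℝ) (A : Set (EuclideanSpace ℝ (Fin N))) : ENNReal :=
  limsup (fun ε : ℝ => volume (Metric.thickening ε A) / ENNReal.ofReal (ε ^ ((N : ℝ) - s)))
    (𝓝[>] (0 : ℝ))

/-- Lower box dimension. -/
def lowerBoxDim {N : ℕ} (A : Set (EuclideanSpace ℝ (Fin N))) : ℝ :=
  sInf {s : ℝ | 0 ≤ s ∧ lowerMinkowskiContent s A = 0}

/-- Upper box dimension. -/
def upperBoxDim {N : ℕ} (A : Set (EuclideanSpace ℝ (Fin N))) : ℝ :=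
  sInf {s : ℝ | 0 ≤ s ∧ upperMinkowskiContent s A = 0}

/-- The set `A` is bounded, its lower and upper box dimensions coincide, and `dim_B A = d`. -/
def HasBoxDim {N : ℕ} (A : Set (EuclideanSpace ℝ (Fin N))) (d : ℝ) : Prop :=
  Bornology.IsBounded A ∧ lowerBoxDim A = d ∧ upperBoxDim A = d

/-! ### Spirals -/

/-- `S` is a spiral: the graph `r = f(φ)`, `φ ≥ φ₁ > 0`, in polar coordinates of a positive,
radially decreasing function `f` tending to `0`, or the mirror image of such a graph with respect
to the `x`-axis. -/
def IsSpiral (S : Set (EuclideanSpace ℝ (Fin 2))) : Prop :=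
  ∃ (φ₁ : ℝ) (f : ℝ → ℝ), 0 < φ₁ ∧
    (∀ φ, φ₁ ≤ φ → 0 < f φ) ∧
    Tendsto f atTop (𝓝 0) ∧
    (∀ φ, φ₁ ≤ φ → StrictAnti (fun k : ℕ => f (φ + 2 * (k : ℝ) * Real.pi))) ∧
    (S = (fun φ : ℝ => !₂[f φ * Real.cos φ, f φ * Real.sin φ]) '' Ici φ₁ ∨
      S = (fun φ : ℝ => !₂[f φ * Real.cos φ, -(f φ * Real.sin φ)]) '' Ici φ₁)

/-! ### Functions on `[t₀, ∞)` -/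

/-- The `j`-th derivative of a function on `[t₀, ∞)` (one-sided at `t₀`). -/
def D (t₀ : ℝ) (j : ℕ) (f : ℝ → ℝ) (t : ℝ) : ℝ :=
  iteratedDerivWithin j f (Ici t₀) t

/-- `f : [t₀, ∞) → ℝ` is comparable of class `k` to `c t^{-α}` in the limit sense: `f` is of
class `C^k` and, for `j = 0, …, k`, the ratio of `f^{(j)}(t)` and the `j`-th derivative
`(-1)^j α (α + 1) ⋯ (α + j - 1) c t^{-α-j}` of `c t^{-α}` tends to `1` as `t → ∞`. -/
def ComparableInLimit (t₀ : ℝ) (k : ℕ) (c α : ℝ) (f : ℝ → ℝ) : Prop :=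
  ContDiffOn ℝ k f (Ici t₀) ∧
    ∀ j : ℕ, j ≤ k →
      Tendsto
        (fun t : ℝ => D t₀ j f t /
          ((-1) ^ j * (∏ i ∈ Finset.range j, (α + (i : ℝ))) * c * t ^ (-α - (j : ℝ))))
        atTop (𝓝 1)

/-! ### The second-order equation -/

/-- `2p'/p + q''/q'`. -/
def dampingCoeff (t₀ : ℝ) (p q : ℝ → ℝ) (t : ℝ) : ℝ :=
  2 * D t₀ 1 p t / p t + D t₀ 2 q t / D t₀ 1 q t

/-- `q'^2 + 2p'^2/p^2 - p''/p + p'q''/(pq')`. -/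
def restoringCoeff (t₀ : ℝ) (p q : ℝ → ℝ) (t : ℝ) : ℝ :=
  (D t₀ 1 q t) ^ 2 + 2 * (D t₀ 1 p t) ^ 2 / (p t) ^ 2 - D t₀ 2 p t / p t
    + D t₀ 1 p t * D t₀ 2 q t / (p t * D t₀ 1 q t)

/-- `x` solves `x'' - [2p'/p + q''/q'] x' + [q'^2 + 2p'^2/p^2 - p''/p + p'q''/(pq')] x = 0`
on `[t₀, ∞)`. -/
def IsSolution (t₀ : ℝ) (p q x : ℝ → ℝ) : Prop :=
  ContDiffOn ℝ 2 x (Ici t₀) ∧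
    ∀ t, t₀ ≤ t →
      D t₀ 2 x t - dampingCoeff t₀ p q t * D t₀ 1 x t + restoringCoeff t₀ p q t * x t = 0

/-- The phase curve `t ↦ (x(t), x'(t))`. -/
def phaseCurve (t₀ : ℝ) (x : ℝ → ℝ) (t : ℝ) : EuclideanSpace ℝ (Fin 2) :=
  !₂[x t, D t₀ 1 x t]

/-! ### The spatial system -/

/-- `U(z)`. -/
def U (t₀ γ : ℝ) (p q : ℝ → ℝ) (z : ℝ) : ℝ :=
  restoringCoeff t₀ p q (γ * z ^ (-1 / γ))

/-- `V(z)`. -/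
def V (t₀ γ : ℝ) (p q : ℝ → ℝ) (z : ℝ) : ℝ :=
  dampingCoeff t₀ p q (γ * z ^ (-1 / γ))

/-- `(x, y, z)` solves `x' = y`, `y' = -U(z) x + V(z) y`, `z' = -z^δ` on `[s₀, ∞)`, where
`δ = (γ + 1) / γ`, with `z ∈ (0, z₀]`. Here `z₀ = (γ / t₀)^γ`, so that `z ∈ (0, z₀]` says that the
argument `γ z^{-1/γ}` of `p` and `q` lies in `[t₀, ∞)`. -/
structure IsSystemSolution (t₀ γ : ℝ) (p q : ℝ → ℝ) (s₀ : ℝ) (x y z : ℝ → ℝ) : Prop where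
  z_pos : ∀ s, s₀ ≤ s → 0 < z s
  z_le : ∀ s, s₀ ≤ s → z s ≤ (γ / t₀) ^ γ
  x_deriv : ∀ s, s₀ ≤ s → HasDerivWithinAt x (y s) (Ici s₀) s
  y_deriv : ∀ s, s₀ ≤ s →
    HasDerivWithinAt y (-U t₀ γ p q (z s) * x s + V t₀ γ p q (z s) * y s) (Ici s₀) s
  z_deriv : ∀ s, s₀ ≤ s → HasDerivWithinAt z (-(z s) ^ ((γ + 1) / γ)) (Ici s₀) s

/-- The space curve `s ↦ (x(s), y(s), z(s))`. -/
def spaceCurve (x y z : ℝ → ℝ) (s : ℝ) : EuclideanSpace ℝ (Fin 3) :=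
  !₂[x s, y s, z s]

/-- The curve `c : [s₀, ∞) → ℝ^N` has finite length. -/
def IsRectifiable {N : ℕ} (c : ℝ → EuclideanSpace ℝ (Fin N)) (s₀ : ℝ) : Prop :=
  eVariationOn c (Ici s₀) < ⊤

end SpiralTraj

end

/-! Equation (1) is built so that `p sin q` and `p cos q` solve it: with `u = x / p` and `w = u' /
q'` it becomes the rotation `u' = q' w`, `w' = -q' u`. Hence every solution is `A p sin (q + θ)`
(`exists_eq_sin`). The third equation of (2) integrates to `γ z^(-1/γ) = s + σ`, so up to a time
shift a trajectory is a phase curve with the height `γ^γ t^(-γ)` attached (`exists_eq_solSpace`).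

The phase of such a curve advances at a rate tending to `K`, while its amplitude is of order
`t^(-α)`. Put `m = α` in the plane and `m = min α γ` in space; near time `T` consecutive turns lie
at distance of order `T^(-m-1)`. The `ε`-neighbourhood therefore changes character at `T =
ε^(-1/(1+m))`. Up to then it is a tube around an arc of length of order `T^(1-α)`; afterwards it is
a thickened surface of area of order `T^(-α-m)`. Both have volume of order `ε^(N-d)` with `d = 2 -
(α+m)/(1+m)`, which is `2/(1+α)` when `m = α`.

The upper bound is a box count resting on increment bounds (`CoordBounds`,
`exists_volume_thickening_le`). The lower bound needs the second regime only: a coordinate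
projection of the curve is `T^(-m-1)`-dense, up to a constant, in a rectangle of area of order
`T^(-α-m)` (`exists_dense_phase`, `exists_dense_space`), and a packing argument converts this into
volume. For `α > 1` the speed is integrable, so the length is finite, and the height alone forces
dimension at least `1`.

For the spiral property the angular velocity is bounded below (`exists_le_angular_velocity`). If the
curve meets the same ray at times `t < t'`, then `log p` has dropped by at least a multiple of `t
δ`, where `δ = 1/t - 1/t'`, whereas the changes of `p'/p` and `q'` distort the radius by a relative
amount `O(δ)` only; for large `t` the drop wins (`exists_contraction`). -/

noncomputable section

namespace SpiralTraj

/-! ### Volume of neighbourhoods -/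

/-- Two-sided power bounds on the volume of small neighbourhoods determine the box dimension. -/
theorem hasBoxDim_of_volume_bounds {N : ℕ} {A : Set (EuclideanSpace ℝ (Fin N))} {d c C : ℝ}
    (hA : Bornology.IsBounded A) (hd : 0 ≤ d) (hc : 0 < c)
    (hlow : ∀ᶠ ε : ℝ in 𝓝[>] 0,
      ENNReal.ofReal (c * ε ^ ((N : ℝ) - d)) ≤ volume (Metric.thickening ε A))
    (hup : ∀ᶠ ε : ℝ in 𝓝[>] 0,
      volume (Metric.thickening ε A) ≤ ENNReal.ofReal (C * ε ^ ((N : ℝ) - d))) :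
    HasBoxDim A d := by
  have hpos : ∀ᶠ ε : ℝ in 𝓝[>] 0, 0 < ε := eventually_mem_nhdsWithin
  have hlt1 : ∀ᶠ ε : ℝ in 𝓝[>] 0, ε < 1 :=
    nhdsWithin_le_nhds (eventually_lt_nhds zero_lt_one)
  have hupper : ∀ s, d < s → upperMinkowskiContent s A = 0 := by
    intro s hs
    have hlim : Tendsto (fun ε : ℝ => ENNReal.ofReal (C * ε ^ (s - d))) (𝓝[>] 0) (𝓝 0) := by
      have h1 : Tendsto (fun ε : ℝ => C * ε ^ (s - d)) (𝓝[>] 0) (𝓝 0) := by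
        have h2 : ContinuousAt (fun ε : ℝ => C * ε ^ (s - d)) 0 :=
          continuousAt_const.mul (Real.continuousAt_rpow_const _ _ (Or.inr (by linarith)))
        have h3 := h2.tendsto
        rw [Real.zero_rpow (by linarith), mul_zero] at h3
        exact h3.mono_left nhdsWithin_le_nhds
      simpa using ENNReal.tendsto_ofReal h1
    refine (tendsto_of_tendsto_of_tendsto_of_le_of_le' tendsto_const_nhds hlim
      (Eventually.of_forall fun _ => zero_le) ?_).limsup_eq
    filter_upwards [hup, hpos] with ε h1 h2
    have h3 : 0 < ε ^ ((N : ℝ) - s) := Real.rpow_pos_of_pos h2 _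
    refine ENNReal.div_le_of_le_mul (h1.trans ?_)
    rw [← ENNReal.ofReal_mul' h3.le, mul_assoc, ← Real.rpow_add h2]
    ring_nf
    exact le_rfl
  have hle : ∀ s, lowerMinkowskiContent s A ≤ upperMinkowskiContent s A := fun s =>
    liminf_le_limsup
  have hlower : ∀ s, lowerMinkowskiContent s A = 0 → d ≤ s := by
    intro s hs
    by_contra! hlt
    have h : ENNReal.ofReal c ≤ lowerMinkowskiContent s A := by
      refine le_liminf_of_le (by isBoundedDefault) ?_
      filter_upwards [hlow, hpos, hlt1] with ε h1 h2 h4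
      have h3 : 0 < ε ^ ((N : ℝ) - s) := Real.rpow_pos_of_pos h2 _
      rw [ENNReal.le_div_iff_mul_le (Or.inl (by simpa using h3)) (Or.inl ENNReal.ofReal_ne_top)]
      refine le_trans ?_ h1
      rw [← ENNReal.ofReal_mul hc.le]
      refine ENNReal.ofReal_le_ofReal (mul_le_mul_of_nonneg_left ?_ hc.le)
      exact Real.rpow_le_rpow_of_exponent_ge h2 h4.le (by linarith)
    rw [hs] at h
    simp only [nonpos_iff_eq_zero, ENNReal.ofReal_eq_zero] at h
    linarith
  refine ⟨hA, ?_, ?_⟩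
  · refine csInf_eq_of_forall_ge_of_forall_gt_exists_lt ⟨d + 1, by linarith, ?_⟩ ?_ ?_
    · exact le_antisymm ((hle _).trans (hupper _ (by linarith)).le) zero_le
    · exact fun s hs => hlower s hs.2
    · intro w hw
      exact ⟨(d + w) / 2, ⟨by linarith,
        le_antisymm ((hle _).trans (hupper _ (by linarith)).le) zero_le⟩, by linarith⟩
  · refine csInf_eq_of_forall_ge_of_forall_gt_exists_lt ⟨d + 1, by linarith, ?_⟩ ?_ ?_
    · exact hupper _ (by linarith)
    · exact fun s hs => hlower s (le_antisymm ((hle _).trans hs.2.le) zero_le)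
    · intro w hw
      exact ⟨(d + w) / 2, ⟨by linarith, hupper _ (by linarith)⟩, by linarith⟩

/-- The volume of the unit ball. -/
def unitBallVolume (N : ℕ) : ℝ := (volume (Metric.ball (0 : EuclideanSpace ℝ (Fin N)) 1)).toReal

theorem unitBallVolume_pos (N : ℕ) : 0 < unitBallVolume N :=
  ENNReal.toReal_pos (Metric.measure_ball_pos _ _ one_pos).ne' measure_ball_lt_top.ne

theorem volume_ball_eq {N : ℕ} (x : EuclideanSpace ℝ (Fin N)) {r : ℝ} (hr : 0 < r) :
    volume (Metric.ball x r) = ENNReal.ofReal (unitBallVolume N * r ^ N) := by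
  rw [Measure.addHaar_ball_of_pos _ _ hr, unitBallVolume, mul_comm,
    ENNReal.ofReal_mul ENNReal.toReal_nonneg, ENNReal.ofReal_toReal measure_ball_lt_top.ne]
  simp

/-- Covering bound for a set parametrized in a Lipschitz way by two real coordinates. -/
theorem volume_thickening_image_le {N : ℕ} (S : Set ℝ) (f : ℝ → EuclideanSpace ℝ (Fin N))
    (u v : ℝ → ℝ) {u₀ v₀ L₁ L₂ ε : ℝ} (hε : 0 < ε) (hL₁ : 0 ≤ L₁) (hL₂ : 0 ≤ L₂)
    (hu : ∀ s ∈ S, u s ∈ Icc u₀ (u₀ + L₁)) (hv : ∀ s ∈ S, v s ∈ Icc v₀ (v₀ + L₂))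
    (hf : ∀ s ∈ S, ∀ s' ∈ S, dist (f s) (f s') ≤ |u s - u s'| + |v s - v s'|) :
    volume (Metric.thickening ε (f '' S)) ≤
      ENNReal.ofReal (unitBallVolume N * 3 ^ N * (ε ^ N * ((L₁ / ε + 1) * (L₂ / ε + 1)))) := by
  classical
  have key : ∀ {w : ℝ → ℝ} {w₀ s s' : ℝ}, w₀ ≤ w s → w₀ ≤ w s' →
      ⌊(w s - w₀) / ε⌋₊ = ⌊(w s' - w₀) / ε⌋₊ → |w s - w s'| ≤ ε := by
    intro w w₀ s s' h1 h2 h3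
    have a1 := Nat.floor_le (div_nonneg (sub_nonneg.2 h1) hε.le)
    have a2 := Nat.lt_floor_add_one ((w s - w₀) / ε)
    have b1 := Nat.floor_le (div_nonneg (sub_nonneg.2 h2) hε.le)
    have b2 := Nat.lt_floor_add_one ((w s' - w₀) / ε)
    rw [← h3] at b1 b2
    rw [le_div_iff₀ hε] at a1 b1
    rw [div_lt_iff₀ hε] at a2 b2
    rw [abs_le]
    constructor <;> nlinarith
  -- The parameter rectangle is cut into squares of side `ε`. Parameters in one square have images
  -- at distance at most `2ε`, so a ball of radius `3ε` about one representative covers the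
  -- `ε`-neighbourhood of that piece.
  let k : ℝ → ℕ × ℕ := fun s => (⌊(u s - u₀) / ε⌋₊, ⌊(v s - v₀) / ε⌋₊)
  let I : Finset (ℕ × ℕ) := Finset.range (⌊L₁ / ε⌋₊ + 1) ×ˢ Finset.range (⌊L₂ / ε⌋₊ + 1)
  -- The default `0` only occurs for squares without a parameter; their balls are superfluous and do
  -- no harm.
  let rep : ℕ × ℕ → ℝ := fun i => if h : ∃ s ∈ S, k s = i then h.choose else 0
  have hcov : Metric.thickening ε (f '' S) ⊆ ⋃ i ∈ I, Metric.ball (f (rep i)) (3 * ε) := by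
    intro y hy
    obtain ⟨_, ⟨s, hs, rfl⟩, hys⟩ := Metric.mem_thickening_iff.1 hy
    have hex : ∃ s' ∈ S, k s' = k s := ⟨s, hs, rfl⟩
    have hrep : rep (k s) = hex.choose := dif_pos hex
    obtain ⟨h1, h2⟩ := hex.choose_spec
    rw [← hrep] at h1 h2
    refine mem_iUnion₂.2 ⟨k s, ?_, ?_⟩
    · simp only [I, k, Finset.mem_product, Finset.mem_range, Nat.lt_succ_iff]
      constructor
      · exact Nat.floor_mono (by gcongr; linarith [(hu s hs).2])
      · exact Nat.floor_mono (by gcongr; linarith [(hv s hs).2])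
    · have e1 := key (w := u) (hu s hs).1 (hu _ h1).1 (congrArg Prod.fst h2).symm
      have e2 := key (w := v) (hv s hs).1 (hv _ h1).1 (congrArg Prod.snd h2).symm
      have e3 := hf s hs _ h1
      rw [Metric.mem_ball]
      linarith [dist_triangle y (f s) (f (rep (k s)))]
  have hcard : (I.card : ℝ) ≤ (L₁ / ε + 1) * (L₂ / ε + 1) := by
    simp only [I, Finset.card_product, Finset.card_range]
    push_cast
    have a1 := Nat.floor_le (div_nonneg hL₁ hε.le)
    have a2 := Nat.floor_le (div_nonneg hL₂ hε.le)
    gcongr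
  calc volume (Metric.thickening ε (f '' S))
      ≤ ∑ i ∈ I, volume (Metric.ball (f (rep i)) (3 * ε)) :=
        (measure_mono hcov).trans (measure_biUnion_finset_le _ _)
    _ = ENNReal.ofReal (I.card * (unitBallVolume N * (3 * ε) ^ N)) := by
        rw [Finset.sum_congr rfl fun i _ => volume_ball_eq _ (by positivity : 0 < 3 * ε),
          Finset.sum_const, nsmul_eq_mul, ENNReal.ofReal_mul (Nat.cast_nonneg _),
          ENNReal.ofReal_natCast]
    _ ≤ _ := by
        refine ENNReal.ofReal_le_ofReal ?_
        have := unitBallVolume_pos N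
        calc (I.card : ℝ) * (unitBallVolume N * (3 * ε) ^ N)
            ≤ ((L₁ / ε + 1) * (L₂ / ε + 1)) * (unitBallVolume N * (3 * ε) ^ N) := by gcongr
          _ = _ := by rw [mul_pow]; ring

/-- Packing bound: the volume of a neighbourhood of a set controls that of any set which lies in
the neighbourhood of a `1`-Lipschitz image. -/
theorem volume_mul_le_volume_thickening {N k : ℕ} {F : Type*} [PseudoMetricSpace F]
    [MeasureSpace F] {π : EuclideanSpace ℝ (Fin N) → F} (hπ : LipschitzWith 1 π) {C : ℝ}
    (hC : ∀ (x : F) (r : ℝ), 0 < r → volume (Metric.ball x r) ≤ ENNReal.ofReal (C * r ^ k))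
    {A : Set (EuclideanSpace ℝ (Fin N))} {B : Set F} {ε : ℝ} (hε : 0 < ε)
    (hB : B ⊆ Metric.thickening ε (π '' A)) :
    volume B * ENNReal.ofReal (unitBallVolume N * ε ^ N) ≤
      ENNReal.ofReal (C * (3 * ε) ^ k) * volume (Metric.thickening ε A) := by
  -- `S` is a maximal subset of `A` with `2ε`-separated projections. Since `π` does not increase
  -- distances, the `ε`-balls about `S` are disjoint; by maximality the `3ε`-balls about `π '' S`
  -- cover `B`.
  obtain ⟨S, hS⟩ := zorn_subset
    {S : Set (EuclideanSpace ℝ (Fin N)) | S ⊆ A ∧ S.Pairwise fun a b => 2 * ε ≤ dist (π a) (π b)}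
    (by
      intro c hc hchain
      refine ⟨⋃₀ c, ⟨sUnion_subset fun s hs => (hc hs).1, ?_⟩, fun s hs => subset_sUnion_of_mem hs⟩
      exact (pairwise_sUnion hchain.directedOn).2 fun s hs => (hc hs).2)
  obtain ⟨⟨hSA, hsep⟩, hmax⟩ := hS
  have hdisj : S.PairwiseDisjoint fun a => Metric.ball a ε := by
    intro a ha b hb hab
    have h1 := hsep ha hb hab
    have h2 := hπ.dist_le_mul a b
    simp only [NNReal.coe_one, one_mul] at h2
    exact Metric.ball_disjoint_ball (by linarith)
  have hcount : S.Countable := hdisj.countable_of_isOpen (fun _ _ => Metric.isOpen_ball)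
    fun a _ => ⟨a, Metric.mem_ball_self hε⟩
  have hlow : ∑' _ : S, ENNReal.ofReal (unitBallVolume N * ε ^ N) ≤
      volume (Metric.thickening ε A) := by
    calc ∑' _ : S, ENNReal.ofReal (unitBallVolume N * ε ^ N)
        = ∑' a : S, volume (Metric.ball (a : EuclideanSpace ℝ (Fin N)) ε) := by
          simp_rw [volume_ball_eq _ hε]
      _ = volume (⋃ a ∈ S, Metric.ball a ε) :=
          (measure_biUnion hcount hdisj fun _ _ => Metric.isOpen_ball.measurableSet).symm
      _ ≤ _ := measure_mono (iUnion₂_subset fun a ha =>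
          Metric.ball_subset_thickening (hSA ha) ε)
  have hcov : B ⊆ ⋃ a ∈ S, Metric.ball (π a) (3 * ε) := by
    intro y hy
    obtain ⟨_, ⟨a, ha, rfl⟩, hya⟩ := Metric.mem_thickening_iff.1 (hB hy)
    by_cases h : ∃ b ∈ S, dist (π a) (π b) < 2 * ε
    · obtain ⟨b, hb, hab⟩ := h
      refine mem_iUnion₂.2 ⟨b, hb, ?_⟩
      rw [Metric.mem_ball]
      linarith [dist_triangle y (π a) (π b)]
    · push Not at h
      have hmem : insert a S ⊆ S := hmax ⟨insert_subset ha hSA, hsep.insert fun b hb _ =>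
        ⟨h b hb, by rw [dist_comm]; exact h b hb⟩⟩ (subset_insert _ _)
      have haS : a ∈ S := hmem (mem_insert _ _)
      have := h a haS
      rw [dist_self] at this
      linarith
  have hup : volume B ≤ ∑' _ : S, ENNReal.ofReal (C * (3 * ε) ^ k) := by
    have := hcount.to_subtype
    calc volume B ≤ volume (⋃ a : S, Metric.ball (π a) (3 * ε)) := by
          rw [← biUnion_eq_iUnion S fun a _ => Metric.ball (π a) (3 * ε)]
          exact measure_mono hcov
      _ ≤ ∑' a : S, volume (Metric.ball (π a) (3 * ε)) := measure_iUnion_le _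
      _ ≤ _ := ENNReal.tsum_le_tsum fun a => hC _ _ (by positivity)
  -- Both bounds are `ENat.card S` times a constant, so the finiteness of `S` never has to be
  -- discussed.
  rw [ENNReal.tsum_const] at hlow hup
  calc volume B * ENNReal.ofReal (unitBallVolume N * ε ^ N)
      ≤ (ENat.card S * ENNReal.ofReal (C * (3 * ε) ^ k)) *
          ENNReal.ofReal (unitBallVolume N * ε ^ N) := by gcongr
    _ = ENNReal.ofReal (C * (3 * ε) ^ k) *
          (ENat.card S * ENNReal.ofReal (unitBallVolume N * ε ^ N)) := by ring
    _ ≤ _ := by gcongr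

/-! ### Comparison of increments -/

/-- Both `g - f` and `g + f` have non-negative derivative, hence are monotone. This replaces
integration of derivative bounds throughout. -/
theorem abs_sub_le_of_abs_deriv_le {a s t : ℝ} {f f' g g' : ℝ → ℝ}
    (hf : ∀ t, a ≤ t → HasDerivWithinAt f (f' t) (Ici a) t)
    (hg : ∀ t, a ≤ t → HasDerivWithinAt g (g' t) (Ici a) t)
    (h : ∀ t, a ≤ t → |f' t| ≤ g' t) (hs : a ≤ s) (hst : s ≤ t) :
    |f t - f s| ≤ g t - g s := by
  have mono : ∀ {F F' : ℝ → ℝ}, (∀ t, a ≤ t → HasDerivWithinAt F (F' t) (Ici a) t) →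
      (∀ t, a ≤ t → 0 ≤ F' t) → F s ≤ F t := by
    intro F F' hF hF'
    refine monotoneOn_of_hasDerivWithinAt_nonneg (convex_Ici a)
      (fun t ht => (hF t ht).continuousWithinAt) (f' := F') ?_ ?_ hs (hs.trans hst) hst
    · exact fun t ht => (hF t (interior_subset ht)).mono interior_subset
    · exact fun t ht => hF' t (interior_subset ht)
  have h1 := mono (fun t ht => (hg t ht).sub (hf t ht))
    fun t ht => by linarith [le_abs_self (f' t), h t ht]
  have h2 := mono (fun t ht => (hg t ht).add (hf t ht))
    fun t ht => by linarith [neg_abs_le (f' t), h t ht]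
  simp only [Pi.sub_apply, Pi.add_apply] at h1 h2
  rw [abs_le]
  constructor <;> linarith

/-- The comparison function is `C / β * t ^ β`. Positive `β` is used for arc lengths that grow; for
negative `β` both factors on the right change sign and the bound is a difference of tails. -/
theorem abs_sub_le_rpow {a s t C β : ℝ} {f f' : ℝ → ℝ} (ha : 0 < a) (hβ : β ≠ 0)
    (hf : ∀ t, a ≤ t → HasDerivWithinAt f (f' t) (Ici a) t)
    (h : ∀ t, a ≤ t → |f' t| ≤ C * t ^ (β - 1)) (hs : a ≤ s) (hst : s ≤ t) :
    |f t - f s| ≤ C / β * (t ^ β - s ^ β) := by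
  have hg : ∀ t, a ≤ t →
      HasDerivWithinAt (fun t : ℝ => C / β * t ^ β) (C * t ^ (β - 1)) (Ici a) t := by
    intro t ht
    have := ((Real.hasDerivAt_rpow_const (p := β) (Or.inl (ha.trans_le ht).ne')).const_mul
      (C / β)).hasDerivWithinAt (s := Ici a)
    convert! this using 1
    field_simp
  have := abs_sub_le_of_abs_deriv_le hf hg h hs hst
  linarith

theorem abs_sub_le_mul {a s t C : ℝ} {f f' : ℝ → ℝ}
    (hf : ∀ t, a ≤ t → HasDerivWithinAt f (f' t) (Ici a) t)
    (h : ∀ t, a ≤ t → |f' t| ≤ C) (hs : a ≤ s) (hst : s ≤ t) :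
    |f t - f s| ≤ C * (t - s) := by
  have hg : ∀ t, a ≤ t → HasDerivWithinAt (fun t : ℝ => C * t) C (Ici a) t := fun t _ => by
    simpa using ((hasDerivAt_id t).const_mul C).hasDerivWithinAt (s := Ici a)
  have := abs_sub_le_of_abs_deriv_le hf hg h hs hst
  linarith

/-! ### Global bounds from asymptotics -/

/-- Compactness of the initial interval extends an eventual bound to all of `[a, ∞)`, so later
estimates hold from the start of the curve. -/
theorem exists_abs_le_of_continuousOn {a M : ℝ} {g : ℝ → ℝ} (hg : ContinuousOn g (Ici a))
    (h : ∀ᶠ t in atTop, |g t| ≤ M) : ∃ C, 0 < C ∧ ∀ t, a ≤ t → |g t| ≤ C := by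
  obtain ⟨T, hT⟩ := eventually_atTop.1 h
  obtain ⟨C, hC⟩ := isCompact_Icc.exists_bound_of_continuousOn
    (hg.mono (Icc_subset_Ici_self : Icc a T ⊆ Ici a))
  refine ⟨max 1 (max C M), by positivity, fun t ht => ?_⟩
  rcases le_total t T with h1 | h1
  · exact (hC t ⟨ht, h1⟩).trans ((le_max_left _ _).trans (le_max_right _ _))
  · exact (hT t h1).trans ((le_max_right _ _).trans (le_max_right _ _))

theorem exists_abs_le_rpow {a M β : ℝ} {f : ℝ → ℝ} (ha : 0 < a) (hf : ContinuousOn f (Ici a))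
    (h : ∀ᶠ t in atTop, |f t| ≤ M * t ^ β) :
    ∃ C, 0 < C ∧ ∀ t, a ≤ t → |f t| ≤ C * t ^ β := by
  have hc : ContinuousOn (fun t => f t / t ^ β) (Ici a) :=
    hf.div (continuousOn_id.rpow_const fun t ht => Or.inl (ha.trans_le ht).ne')
      fun t ht => (Real.rpow_pos_of_pos (ha.trans_le ht) _).ne'
  obtain ⟨C, hC, hb⟩ := exists_abs_le_of_continuousOn (M := M) hc <| by
    filter_upwards [h, eventually_gt_atTop 0] with t h1 h2
    have := Real.rpow_pos_of_pos h2 β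
    rwa [abs_div, abs_of_pos this, div_le_iff₀ this]
  refine ⟨C, hC, fun t ht => ?_⟩
  have := Real.rpow_pos_of_pos (ha.trans_le ht) β
  have h1 := hb t ht
  rwa [abs_div, abs_of_pos this, div_le_iff₀ this] at h1

theorem exists_pos_le_of_continuousOn {a ℓ : ℝ} {g : ℝ → ℝ} (hg : ContinuousOn g (Ici a))
    (hpos : ∀ t, a ≤ t → 0 < g t) (hℓ : 0 < ℓ) (h : Tendsto g atTop (𝓝 ℓ)) :
    ∃ c, 0 < c ∧ ∀ t, a ≤ t → c ≤ g t := by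
  obtain ⟨T, hT⟩ := eventually_atTop.1 (h.eventually (lt_mem_nhds (half_lt_self hℓ)))
  have hne : (Icc a (max a T)).Nonempty := nonempty_Icc.2 (le_max_left _ _)
  obtain ⟨t₁, ht₁, hmin⟩ := isCompact_Icc.exists_isMinOn hne
    (hg.mono (Icc_subset_Ici_self : Icc a (max a T) ⊆ Ici a))
  refine ⟨min (g t₁) (ℓ / 2), lt_min (hpos _ ht₁.1) (by linarith), fun t ht => ?_⟩
  rcases le_total t (max a T) with h1 | h1
  · exact (min_le_left _ _).trans (hmin ⟨ht, h1⟩)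
  · exact (min_le_right _ _).trans (hT t ((le_max_right _ _).trans h1)).le

theorem pos_of_ne_zero_of_eventually_pos {a : ℝ} {g : ℝ → ℝ} (hg : ContinuousOn g (Ici a))
    (hne : ∀ t, a ≤ t → g t ≠ 0) (h : ∀ᶠ t in atTop, 0 < g t) (t : ℝ) (ht : a ≤ t) : 0 < g t := by
  by_contra! hle
  obtain ⟨T, h1, h2⟩ := (h.and (eventually_ge_atTop a)).exists
  obtain ⟨s, hs, h0⟩ := isPreconnected_Ici.intermediate_value ht h2 hg ⟨hle, h1.le⟩
  exact hne s hs h0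

theorem eventually_abs_le_of_tendsto_div {k β : ℝ} {f : ℝ → ℝ}
    (h : Tendsto (fun t => f t / (k * t ^ β)) atTop (𝓝 1)) :
    ∀ᶠ t in atTop, |f t| ≤ 2 * |k| * t ^ β := by
  have h1 : ∀ᶠ t in atTop, f t / (k * t ^ β) ∈ Ioo (1 / 2 : ℝ) 2 :=
    h.eventually (Ioo_mem_nhds (by norm_num) (by norm_num))
  filter_upwards [h1, eventually_gt_atTop 0] with t h2 h3
  have hp := Real.rpow_pos_of_pos h3 β
  have hk : k ≠ 0 := by
    rintro rfl
    simp at h2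
    norm_num at h2
  have h4 : |f t / (k * t ^ β)| ≤ 2 := abs_le.2 ⟨by linarith [h2.1], h2.2.le⟩
  rw [abs_div, abs_mul, abs_of_pos hp, div_le_iff₀ (by positivity)] at h4
  linarith

/-! ### Amplitude and phase -/

/-- Quantitative form of the assumptions on amplitude `p` and phase `q` with derivatives
`p₁, p₂` and `q₁, q₂`. -/
structure AmplitudePhase (t₀ α K c C t₂ : ℝ) (p p₁ p₂ q q₁ q₂ : ℝ → ℝ) : Prop where
  t₀_pos : 0 < t₀
  α_pos : 0 < α
  K_pos : 0 < K
  c_pos : 0 < c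
  C_pos : 0 < C
  p_deriv : ∀ t, t₀ ≤ t → HasDerivWithinAt p (p₁ t) (Ici t₀) t
  p₁_deriv : ∀ t, t₀ ≤ t → HasDerivWithinAt p₁ (p₂ t) (Ici t₀) t
  q_deriv : ∀ t, t₀ ≤ t → HasDerivWithinAt q (q₁ t) (Ici t₀) t
  q₁_deriv : ∀ t, t₀ ≤ t → HasDerivWithinAt q₁ (q₂ t) (Ici t₀) t
  p₂_cont : ContinuousOn p₂ (Ici t₀)
  q₂_cont : ContinuousOn q₂ (Ici t₀)
  le_p : ∀ t, t₀ ≤ t → c * t ^ (-α) ≤ p t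
  p_le : ∀ t, t₀ ≤ t → p t ≤ C * t ^ (-α)
  abs_p₁_le : ∀ t, t₀ ≤ t → |p₁ t| ≤ C * t ^ (-α - 1)
  abs_p₂_le : ∀ t, t₀ ≤ t → |p₂ t| ≤ C * t ^ (-α - 2)
  le_q₁ : ∀ t, t₀ ≤ t → c ≤ q₁ t
  q₁_le : ∀ t, t₀ ≤ t → q₁ t ≤ C
  abs_q₁_sub_le : ∀ t, t₀ ≤ t → |q₁ t - K| ≤ C * t ^ (-1 : ℝ)
  abs_q₂_le : ∀ t, t₀ ≤ t → |q₂ t| ≤ C * t ^ (-2 : ℝ)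
  p₁_le : ∀ t, t₂ ≤ t → p₁ t ≤ -c * t ^ (-α - 1)

theorem hasDerivWithinAt_D {t₀ : ℝ} {n : ℕ} {f : ℝ → ℝ} (hf : ContDiffOn ℝ n f (Ici t₀)) {j : ℕ}
    (hj : j < n) (t : ℝ) (ht : t₀ ≤ t) :
    HasDerivWithinAt (D t₀ j f) (D t₀ (j + 1) f t) (Ici t₀) t := by
  have h := (hf.differentiableOn_iteratedDerivWithin (by exact_mod_cast hj)
    (uniqueDiffOn_Ici t₀) t ht).hasDerivWithinAt
  unfold D
  rw [iteratedDerivWithin_succ]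
  exact h

theorem D_zero (t₀ : ℝ) (f : ℝ → ℝ) : D t₀ 0 f = f := by
  funext t
  simp [D]

/-- Near infinity the bounds are the asymptotics, and compactness extends them to `t₀`. Since `p`
and `q'` vanish nowhere and are eventually positive, they are positive everywhere, which allows
lower bounds as well. -/
theorem exists_amplitudePhase {t₀ α K : ℝ} {p q : ℝ → ℝ}
    (ht₀ : 0 < t₀) (hα : 0 < α) (hK : 0 < K)
    (hp_smooth : ContDiffOn ℝ 3 p (Ici t₀)) (hq_smooth : ContDiffOn ℝ 3 q (Ici t₀))
    (hp_ne : ∀ t, t₀ ≤ t → p t ≠ 0) (hq_ne : ∀ t, t₀ ≤ t → D t₀ 1 q t ≠ 0)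
    (hp : ComparableInLimit t₀ 2 1 α p) (hq : ComparableInLimit t₀ 1 K (-1) q)
    (hq2 : D t₀ 2 q =o[atTop] fun t : ℝ => t ^ (-3 : ℝ)) :
    ∃ c C t₂, AmplitudePhase t₀ α K c C t₂ p (D t₀ 1 p) (D t₀ 2 p) q (D t₀ 1 q) (D t₀ 2 q) := by
  have dp0 : ∀ t, t₀ ≤ t → HasDerivWithinAt p (D t₀ 1 p t) (Ici t₀) t := by
    simpa [D_zero] using hasDerivWithinAt_D (n := 3) hp_smooth (j := 0) (by norm_num)
  have dp1 := hasDerivWithinAt_D (n := 3) hp_smooth (j := 1) (by norm_num)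
  have dp2 := hasDerivWithinAt_D (n := 3) hp_smooth (j := 2) (by norm_num)
  have dq0 : ∀ t, t₀ ≤ t → HasDerivWithinAt q (D t₀ 1 q t) (Ici t₀) t := by
    simpa [D_zero] using hasDerivWithinAt_D (n := 3) hq_smooth (j := 0) (by norm_num)
  have dq1 := hasDerivWithinAt_D (n := 3) hq_smooth (j := 1) (by norm_num)
  have dq2 := hasDerivWithinAt_D (n := 3) hq_smooth (j := 2) (by norm_num)
  have cont : ∀ {f f' : ℝ → ℝ}, (∀ t, t₀ ≤ t → HasDerivWithinAt f (f' t) (Ici t₀) t) →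
      ContinuousOn f (Ici t₀) := fun h t ht => (h t ht).continuousWithinAt
  have lp0 : Tendsto (fun t => p t / (1 * t ^ (-α))) atTop (𝓝 1) := by
    simpa [D_zero] using hp.2 0 (by norm_num)
  have lp1 : Tendsto (fun t => D t₀ 1 p t / (-α * t ^ (-α - 1))) atTop (𝓝 1) := by
    simpa using hp.2 1 (by norm_num)
  have lp2 : Tendsto (fun t => D t₀ 2 p t / (α * (α + 1) * t ^ (-α - 2))) atTop (𝓝 1) := by
    simpa [Finset.prod_range_succ] using hp.2 2 (by norm_num)
  have lq1 : Tendsto (D t₀ 1 q) atTop (𝓝 K) := by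
    have h : Tendsto (fun t => D t₀ 1 q t / K) atTop (𝓝 1) := by
      simpa using hq.2 1 (by norm_num)
    have h2 := h.mul_const K
    rw [one_mul] at h2
    exact h2.congr fun t => by field_simp
  have hp_pos : ∀ t, t₀ ≤ t → 0 < p t := by
    refine pos_of_ne_zero_of_eventually_pos (cont dp0) hp_ne ?_
    filter_upwards [lp0.eventually (lt_mem_nhds (zero_lt_one)), eventually_gt_atTop 0] with t h1 h2
    have h3 := Real.rpow_pos_of_pos h2 (-α)
    rw [one_mul] at h1
    exact (div_pos_iff_of_pos_right h3).1 h1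
  have hq_pos : ∀ t, t₀ ≤ t → 0 < D t₀ 1 q t :=
    pos_of_ne_zero_of_eventually_pos (cont dq1) hq_ne (lq1.eventually (lt_mem_nhds hK))
  obtain ⟨c₁, hc₁, le_p⟩ := exists_pos_le_of_continuousOn (g := fun t => p t / (1 * t ^ (-α)))
    ((cont dp0).div (continuousOn_const.mul (continuousOn_id.rpow_const
      fun t ht => Or.inl (ht₀.trans_le ht).ne'))
      fun t ht => by have := Real.rpow_pos_of_pos (ht₀.trans_le ht) (-α); simpa using this.ne')
    (fun t ht => by
      have := Real.rpow_pos_of_pos (ht₀.trans_le ht) (-α)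
      have := hp_pos t ht
      positivity) one_pos lp0
  obtain ⟨c₂, hc₂, le_q⟩ := exists_pos_le_of_continuousOn (cont dq1) hq_pos hK lq1
  obtain ⟨C₁, hC₁, p_le⟩ := exists_abs_le_rpow ht₀ (cont dp0) (eventually_abs_le_of_tendsto_div lp0)
  obtain ⟨C₂, hC₂, p₁_le⟩ :=
    exists_abs_le_rpow ht₀ (cont dp1) (eventually_abs_le_of_tendsto_div lp1)
  obtain ⟨C₃, hC₃, p₂_le⟩ :=
    exists_abs_le_rpow ht₀ (cont dp2) (eventually_abs_le_of_tendsto_div lp2)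
  obtain ⟨C₄, hC₄, q₁_le⟩ := exists_abs_le_of_continuousOn (M := K + 1) (cont dq1) <| by
    filter_upwards [lq1.eventually (Ioo_mem_nhds (by linarith : -(K + 1) < K)
      (by linarith : K < K + 1))] with t h1
    exact abs_le.2 ⟨h1.1.le, h1.2.le⟩
  -- The weaker order `t ^ (-2)` suffices: it is integrable and gives `q' - K = O(1/t)`.
  obtain ⟨C₅, hC₅, q₂_le⟩ := exists_abs_le_rpow (M := 1) (β := -2) ht₀ (cont dq2) <| by
    filter_upwards [hq2.bound one_pos, eventually_ge_atTop 1] with t h1 h2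
    rw [Real.norm_eq_abs, Real.norm_eq_abs, abs_of_nonneg (Real.rpow_nonneg (by linarith) _)] at h1
    exact h1.trans (mul_le_mul_of_nonneg_left
      (Real.rpow_le_rpow_of_exponent_le h2 (by norm_num)) zero_le_one)
  obtain ⟨t₂, ht₂⟩ := eventually_atTop.1
    ((lp1.eventually (lt_mem_nhds (half_lt_self one_pos))).and (eventually_gt_atTop 0))
  -- The bound on `q''` is integrated from `t` to `s`, and then `s → ∞`.
  have hqK : ∀ t, t₀ ≤ t → |D t₀ 1 q t - K| ≤ C₅ * t ^ (-1 : ℝ) := by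
    intro t ht
    have hlim : Tendsto (fun s => |D t₀ 1 q s - D t₀ 1 q t|) atTop (𝓝 |K - D t₀ 1 q t|) :=
      (lq1.sub_const _).abs
    rw [abs_sub_comm]
    refine le_of_tendsto hlim ?_
    filter_upwards [eventually_ge_atTop t] with s hs
    have h := abs_sub_le_rpow (β := -1) (C := C₅) ht₀ (by norm_num) dq1
      (fun t ht => by rw [show (-1 : ℝ) - 1 = -2 by norm_num]; exact q₂_le t ht) ht hs
    have hs0 := Real.rpow_pos_of_pos (ht₀.trans_le (ht.trans hs)) (-1)
    have : 0 ≤ C₅ * s ^ (-1 : ℝ) := by positivity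
    refine h.trans ?_
    rw [div_neg, div_one]
    linarith
  have hC : 0 < C₁ + C₂ + C₃ + C₄ + C₅ := by positivity
  -- The entry `α / 2` comes from `p'`: beyond `t₂` its ratio to `-α t ^ (-α - 1)` exceeds `1 / 2`.
  refine ⟨min (min c₁ c₂) (α / 2), C₁ + C₂ + C₃ + C₄ + C₅, t₂, ht₀, hα, hK,
    lt_min (lt_min hc₁ hc₂) (by positivity), hC, dp0, dp1, dq0, dq1, cont dp2, cont dq2,
    ?_, ?_, ?_, ?_, ?_, ?_, ?_, ?_, ?_⟩
  · intro t ht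
    have h1 := le_p t ht
    have h3 := Real.rpow_pos_of_pos (ht₀.trans_le ht) (-α)
    rw [one_mul, le_div_iff₀ h3] at h1
    exact (mul_le_mul_of_nonneg_right ((min_le_left _ _).trans (min_le_left _ _)) h3.le).trans h1
  · intro t ht
    have h3 := Real.rpow_pos_of_pos (ht₀.trans_le ht) (-α)
    exact ((le_abs_self _).trans (p_le t ht)).trans
      (mul_le_mul_of_nonneg_right (by linarith) h3.le)
  · intro t ht
    have h3 := Real.rpow_pos_of_pos (ht₀.trans_le ht) (-α - 1)
    exact (p₁_le t ht).trans (mul_le_mul_of_nonneg_right (by linarith) h3.le)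
  · intro t ht
    have h3 := Real.rpow_pos_of_pos (ht₀.trans_le ht) (-α - 2)
    exact (p₂_le t ht).trans (mul_le_mul_of_nonneg_right (by linarith) h3.le)
  · exact fun t ht => ((min_le_left _ _).trans (min_le_right _ _)).trans (le_q t ht)
  · exact fun t ht => ((le_abs_self _).trans (q₁_le t ht)).trans (by linarith)
  · intro t ht
    have h3 := Real.rpow_pos_of_pos (ht₀.trans_le ht) (-1)
    exact (hqK t ht).trans (mul_le_mul_of_nonneg_right (by linarith) h3.le)
  · intro t ht
    have h3 := Real.rpow_pos_of_pos (ht₀.trans_le ht) (-2)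
    exact (q₂_le t ht).trans (mul_le_mul_of_nonneg_right (by linarith) h3.le)
  · intro t ht
    obtain ⟨h1, h2⟩ := ht₂ t ht
    have h3 := Real.rpow_pos_of_pos h2 (-α - 1)
    rw [lt_div_iff_of_neg (by nlinarith)] at h1
    nlinarith [min_le_right (min c₁ c₂) (α / 2)]

/-- Solutions of the first-order system are `A p sin (q + c)`. -/
theorem AmplitudePhase.exists_eq_sin {t₀ α K c C t₂ : ℝ} {p p₁ p₂ q q₁ q₂ : ℝ → ℝ}
    (h : AmplitudePhase t₀ α K c C t₂ p p₁ p₂ q q₁ q₂) {t₁ : ℝ} (ht₁ : t₀ ≤ t₁) {x y : ℝ → ℝ}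
    (hx : ∀ t, t₁ ≤ t → HasDerivWithinAt x (y t) (Ici t₁) t)
    (hy : ∀ t, t₁ ≤ t → HasDerivWithinAt y
      (-(q₁ t ^ 2 + 2 * p₁ t ^ 2 / p t ^ 2 - p₂ t / p t + p₁ t * q₂ t / (p t * q₁ t)) * x t
        + (2 * p₁ t / p t + q₂ t / q₁ t) * y t) (Ici t₁) t) :
    ∃ A θ : ℝ, 0 ≤ A ∧ ∀ t, t₁ ≤ t → x t = A * p t * Real.sin (q t + θ) ∧
      y t = A * p₁ t * Real.sin (q t + θ) + A * (p t * q₁ t) * Real.cos (q t + θ) := by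
  have hp0 : ∀ t, t₁ ≤ t → p t ≠ 0 := fun t ht => by
    have h1 := h.le_p t (ht₁.trans ht)
    have h2 := Real.rpow_pos_of_pos (h.t₀_pos.trans_le (ht₁.trans ht)) (-α)
    have := h.c_pos
    have : 0 < p t := lt_of_lt_of_le (by positivity) h1
    exact this.ne'
  have hq0 : ∀ t, t₁ ≤ t → q₁ t ≠ 0 := fun t ht =>
    (h.c_pos.trans_le (h.le_q₁ t (ht₁.trans ht))).ne'
  have mono : ∀ {f : ℝ → ℝ} {f' t : ℝ}, HasDerivWithinAt f f' (Ici t₀) t →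
      HasDerivWithinAt f f' (Ici t₁) t := fun hf => hf.mono (Ici_subset_Ici.2 ht₁)
  have const : ∀ {f f' : ℝ → ℝ}, (∀ t, t₁ ≤ t → HasDerivWithinAt f (f' t) (Ici t₁) t) →
      (∀ t, t₁ ≤ t → f' t = 0) → ∀ t, t₁ ≤ t → f t = f t₁ := by
    intro f f' hf hf' t ht
    have h1 := abs_sub_le_mul (C := 0) hf (fun t ht => by rw [hf' t ht, abs_zero]) le_rfl ht
    rw [zero_mul] at h1
    exact sub_eq_zero.1 (abs_eq_zero.1 (le_antisymm h1 (abs_nonneg _)))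
  -- In the variables `u = x / p` and `w = u' / q'` the system is a rotation with angular velocity
  -- `q'`.
  let u : ℝ → ℝ := fun t => x t / p t
  let w : ℝ → ℝ := fun t => (y t * p t - x t * p₁ t) / (p t ^ 2 * q₁ t)
  have hu : ∀ t, t₁ ≤ t → HasDerivWithinAt u (q₁ t * w t) (Ici t₁) t := by
    intro t ht
    have h1 := (hx t ht).div (mono (h.p_deriv t (ht₁.trans ht))) (hp0 t ht)
    convert! h1 using 1
    have := hp0 t ht
    have := hq0 t ht
    simp only [w]
    field_simp
  have hw : ∀ t, t₁ ≤ t → HasDerivWithinAt w (-(q₁ t * u t)) (Ici t₁) t := by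
    intro t ht
    have dp := mono (h.p_deriv t (ht₁.trans ht))
    have dp1 := mono (h.p₁_deriv t (ht₁.trans ht))
    have dq1 := mono (h.q₁_deriv t (ht₁.trans ht))
    have n1 := hp0 t ht
    have n2 := hq0 t ht
    have h1 := (((hy t ht).mul dp).sub ((hx t ht).mul dp1)).div ((dp.pow 2).mul dq1)
      (mul_ne_zero (pow_ne_zero 2 n1) n2)
    convert! h1 using 1
    simp only [u, Pi.mul_apply, Pi.pow_apply, Pi.sub_apply]
    field_simp
    ring
  have dc : ∀ t, t₁ ≤ t → HasDerivWithinAt (fun t => Real.cos (q t)) (-Real.sin (q t) * q₁ t)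
      (Ici t₁) t := fun t ht => (mono (h.q_deriv t (ht₁.trans ht))).cos
  have ds : ∀ t, t₁ ≤ t → HasDerivWithinAt (fun t => Real.sin (q t)) (Real.cos (q t) * q₁ t)
      (Ici t₁) t := fun t ht => (mono (h.q_deriv t (ht₁.trans ht))).sin
  -- Undoing the rotation by the angle `q` leaves two constants. Writing `C₂ + i C₁` in polar form
  -- then produces `A` and `θ`.
  have e1 := const (fun t ht => ((hu t ht).mul (dc t ht)).sub ((hw t ht).mul (ds t ht)))
    (fun t ht => by ring)
  have e2 := const (fun t ht => ((hu t ht).mul (ds t ht)).add ((hw t ht).mul (dc t ht)))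
    (fun t ht => by ring)
  simp only [Pi.mul_apply, Pi.sub_apply, Pi.add_apply] at e1 e2
  generalize u t₁ * Real.cos (q t₁) - w t₁ * Real.sin (q t₁) = C₁ at e1
  generalize u t₁ * Real.sin (q t₁) + w t₁ * Real.cos (q t₁) = C₂ at e2
  have p1 := Complex.norm_mul_cos_arg (⟨C₂, C₁⟩ : ℂ)
  have p2 := Complex.norm_mul_sin_arg (⟨C₂, C₁⟩ : ℂ)
  refine ⟨‖(⟨C₂, C₁⟩ : ℂ)‖, Complex.arg ⟨C₂, C₁⟩, norm_nonneg _, fun t ht => ?_⟩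
  generalize ‖(⟨C₂, C₁⟩ : ℂ)‖ = A at p1 p2 ⊢
  generalize Complex.arg ⟨C₂, C₁⟩ = θ at p1 p2 ⊢
  simp only at p1 p2
  have hsc := Real.sin_sq_add_cos_sq (q t)
  have e1t := e1 t ht
  have e2t := e2 t ht
  have hut : u t = A * Real.sin (q t + θ) := by
    rw [Real.sin_add]
    linear_combination (-u t) * hsc + Real.cos (q t) * e1t + Real.sin (q t) * e2t
      - Real.sin (q t) * p1 - Real.cos (q t) * p2
  have hwt : w t = A * Real.cos (q t + θ) := by
    rw [Real.cos_add]
    linear_combination (-w t) * hsc - Real.sin (q t) * e1t + Real.cos (q t) * e2t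
      - Real.cos (q t) * p1 + Real.sin (q t) * p2
  have n1 := hp0 t ht
  have n2 := hq0 t ht
  have hxt : x t = u t * p t := by simp only [u]; field_simp
  have hyt : y t = u t * p₁ t + w t * (p t * q₁ t) := by
    simp only [u, w]; field_simp; ring
  constructor
  · rw [hxt, hut]; ring
  · rw [hyt, hut, hwt]; ring

/-! ### Box dimension of curves with power-law bounds -/

theorem dist_le_sum_abs {N : ℕ} (a b : EuclideanSpace ℝ (Fin N)) :
    dist a b ≤ ∑ i, |a i - b i| := by
  rw [EuclideanSpace.dist_eq]
  refine Real.sqrt_le_iff.2 ⟨Finset.sum_nonneg fun i _ => abs_nonneg _, ?_⟩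
  simp_rw [Real.dist_eq]
  exact Finset.sum_sq_le_sq_sum_of_nonneg fun i _ => abs_nonneg _

theorem rpow_le_mul_rpow {a t β₁ β₂ : ℝ} (ha : 0 < a) (ht : a ≤ t) (h : β₁ ≤ β₂) :
    t ^ β₁ ≤ a ^ (β₁ - β₂) * t ^ β₂ := by
  have h0 := ha.trans_le ht
  calc t ^ β₁ = t ^ (β₁ - β₂) * t ^ β₂ := by rw [← Real.rpow_add h0]; ring_nf
    _ ≤ _ := by
      have := Real.rpow_le_rpow_of_nonpos ha ht (sub_nonpos.2 h)
      have := Real.rpow_nonneg h0.le β₂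
      gcongr

/-- Bounds for the increments of a coordinate of a curve: an arc length bound, and a bound by two
coordinates, a power of the time and an angle. -/
structure CoordBounds (t₁ α m C : ℝ) (β w : ℝ → ℝ) : Prop where
  arc : ∀ s t, t₁ ≤ s → s ≤ t → |w t - w s| ≤ C * (t ^ (1 - α) - s ^ (1 - α))
  tail : ∀ T s t, t₁ ≤ T → T ≤ s → s ≤ t →
    |w t - w s| ≤ C * (s ^ (-m) - t ^ (-m)) + C * T ^ (-α) * |β t - β s|

theorem CoordBounds.mono {t₁ α m C C' : ℝ} {β w : ℝ → ℝ} (h : CoordBounds t₁ α m C β w)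
    (ht₁ : 0 < t₁) (hm : 0 ≤ m) (hα : α ≤ 1) (hC : C ≤ C') : CoordBounds t₁ α m C' β w := by
  constructor
  · intro s t hs hst
    refine (h.arc s t hs hst).trans (mul_le_mul_of_nonneg_right hC ?_)
    have := Real.rpow_le_rpow (ht₁.trans_le hs).le hst (sub_nonneg.2 hα)
    linarith
  · intro T s t hT hs hst
    refine (h.tail T s t hT hs hst).trans ?_
    have h0 := ht₁.trans_le hT
    have h1 := Real.rpow_le_rpow_of_nonpos (h0.trans_le hs) hst (neg_nonpos.2 hm)
    have h2 : 0 ≤ s ^ (-m) - t ^ (-m) := by linarith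
    have h3 := Real.rpow_nonneg h0.le (-α)
    gcongr

/-- The curve is split at the time `T` when the spacing `T ^ (-m - 1)` of its turns reaches `ε`. The
initial arc is counted by its length, the rest by the two coordinates `t ^ (-m)` and reduced angle.
-/
theorem exists_volume_thickening_le {N : ℕ} {f : ℝ → EuclideanSpace ℝ (Fin N)}
    {t₁ α m C : ℝ} {β : ℝ → ℝ} (ht₁ : 0 < t₁) (hm : 0 < m) (hmα : m ≤ α) (hα : α < 1) (hC : 0 ≤ C)
    (hβ : ∀ t, β t ∈ Icc 0 (2 * Real.pi))
    (h : ∀ i, CoordBounds t₁ α m C β fun t => f t i) :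
    ∃ C', ∀ᶠ ε : ℝ in 𝓝[>] 0, volume (Metric.thickening ε (f '' Ici t₁)) ≤
      ENNReal.ofReal (C' * ε ^ ((N : ℝ) - (2 - (α + m) / (1 + m)))) := by
  set E : ℝ := N * C with hE
  have hE0 : 0 ≤ E := by positivity
  have hm1 : 0 < 1 + m := by linarith
  have harc : ∀ s t, t₁ ≤ s → s ≤ t →
      dist (f t) (f s) ≤ E * (t ^ (1 - α) - s ^ (1 - α)) := by
    intro s t hs hst
    refine (dist_le_sum_abs _ _).trans ((Finset.sum_le_sum fun i _ =>
      (h i).arc s t hs hst).trans (le_of_eq ?_))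
    simp [hE]; ring
  have htail : ∀ T s t, t₁ ≤ T → T ≤ s → s ≤ t →
      dist (f t) (f s) ≤ E * (s ^ (-m) - t ^ (-m)) + E * T ^ (-α) * |β t - β s| := by
    intro T s t hT hs hst
    refine (dist_le_sum_abs _ _).trans ((Finset.sum_le_sum fun i _ =>
      (h i).tail T s t hT hs hst).trans (le_of_eq ?_))
    simp [hE]; ring
  have hV := unitBallVolume_pos N
  set V := unitBallVolume N * 3 ^ N with hVdef
  have hV0 : 0 < V := by positivity
  refine ⟨V * (E + 1) + V * ((E + 1) * (E * (2 * Real.pi) + 1)), ?_⟩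
  have hT : Tendsto (fun ε : ℝ => ε ^ (-(1 / (1 + m)))) (𝓝[>] 0) atTop :=
    tendsto_rpow_neg_nhdsGT_zero (by simp; linarith)
  filter_upwards [hT.eventually_ge_atTop t₁, eventually_mem_nhdsWithin,
    nhdsWithin_le_nhds (eventually_le_nhds (zero_lt_one (α := ℝ)))] with ε hεT hε hε1
  rw [mem_Ioi] at hε
  set T := ε ^ (-(1 / (1 + m))) with hTdef
  have hT0 : 0 < T := Real.rpow_pos_of_pos hε _
  have hTpow : ∀ b : ℝ, T ^ b = ε ^ (-(b / (1 + m))) := fun b => by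
    rw [hTdef, ← Real.rpow_mul hε.le]; ring_nf
  have hdiv : ∀ b : ℝ, ε ^ b / ε = ε ^ (b - 1) := fun b => by rw [Real.rpow_sub_one hε.ne']
  have hge1 : ∀ b : ℝ, b ≤ 0 → 1 ≤ ε ^ b := fun b hb =>
    Real.one_le_rpow_of_pos_of_le_one_of_nonpos hε hε1 hb
  have hsplit : f '' Ici t₁ ⊆ f '' Icc t₁ T ∪ f '' Ici T := by
    rw [← image_union]
    refine image_mono fun t ht => ?_
    rcases le_total t T with h1 | h1
    · exact Or.inl ⟨ht, h1⟩
    · exact Or.inr h1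
  -- The choice of `T` balances the two box counts: along the arc and over the tail they have the
  -- same power of `ε`.
  have hX : T ^ (1 - α) / ε = ε ^ (-(2 - (α + m) / (1 + m))) := by
    rw [hTpow, hdiv]; congr 1; field_simp; ring
  have hY : T ^ (-m) / ε * (T ^ (-α) / ε) = ε ^ (-(2 - (α + m) / (1 + m))) := by
    rw [hTpow, hTpow, hdiv, hdiv, ← Real.rpow_add hε]; congr 1; field_simp; ring
  -- These lower bounds by `1` absorb the summands `+ 1` of the box count into the constants.
  have hY1 : 1 ≤ T ^ (-m) / ε := by
    rw [hTpow, hdiv]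
    apply hge1
    rw [neg_div, neg_neg, sub_nonpos, div_le_one hm1]; linarith
  have hY2 : 1 ≤ T ^ (-α) / ε := by
    rw [hTpow, hdiv]
    apply hge1
    rw [neg_div, neg_neg, sub_nonpos, div_le_one hm1]; linarith
  have hX1 : 1 ≤ T ^ (1 - α) / ε := by
    rw [hX, ← hY]; exact one_le_mul_of_one_le_of_one_le hY1 hY2
  have hfin : ε ^ N * ε ^ (-(2 - (α + m) / (1 + m))) =
      ε ^ ((N : ℝ) - (2 - (α + m) / (1 + m))) := by
    rw [← Real.rpow_natCast, ← Real.rpow_add hε]; ring_nf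
  have b1 : volume (Metric.thickening ε (f '' Icc t₁ T)) ≤
      ENNReal.ofReal (V * (E + 1) * ε ^ ((N : ℝ) - (2 - (α + m) / (1 + m)))) := by
    -- A constant second coordinate turns the two-parameter box count into a count along the arc.
    refine (volume_thickening_image_le (Icc t₁ T) f (fun t => E * t ^ (1 - α)) (fun _ => 0)
      (u₀ := 0) (v₀ := 0) (L₁ := E * T ^ (1 - α)) (L₂ := 0) hε (by positivity) le_rfl ?_
      (by simp) ?_).trans (ENNReal.ofReal_le_ofReal ?_)
    · intro s hs
      have h0 := ht₁.trans_le hs.1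
      have h1 := Real.rpow_le_rpow h0.le hs.2 (by linarith : 0 ≤ 1 - α)
      rw [zero_add]
      exact ⟨by positivity, by gcongr⟩
    · intro s hs s' hs'
      simp only [sub_self, abs_zero, add_zero]
      rw [← mul_sub]
      rcases le_total s s' with h1 | h1
      · rw [dist_comm, ← abs_neg, ← mul_neg, neg_sub]
        exact (harc s s' hs.1 h1).trans (le_abs_self _)
      · exact (harc s' s hs'.1 h1).trans (le_abs_self _)
    · rw [← hVdef, ← hfin, ← hX, zero_div, zero_add, mul_one]
      have : E * T ^ (1 - α) / ε + 1 ≤ (E + 1) * (T ^ (1 - α) / ε) := by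
        rw [mul_div_assoc]; nlinarith
      calc V * (ε ^ N * (E * T ^ (1 - α) / ε + 1))
          ≤ V * (ε ^ N * ((E + 1) * (T ^ (1 - α) / ε))) := by gcongr
        _ = _ := by ring
  have b2 : volume (Metric.thickening ε (f '' Ici T)) ≤
      ENNReal.ofReal (V * ((E + 1) * (E * (2 * Real.pi) + 1)) *
        ε ^ ((N : ℝ) - (2 - (α + m) / (1 + m)))) := by
    have hpi := Real.pi_pos
    refine (volume_thickening_image_le (Ici T) f (fun t => E * t ^ (-m))
      (fun t => E * T ^ (-α) * β t)
      (u₀ := 0) (v₀ := 0) (L₁ := E * T ^ (-m)) (L₂ := E * T ^ (-α) * (2 * Real.pi)) hε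
      (by positivity) (by positivity) ?_ ?_ ?_).trans (ENNReal.ofReal_le_ofReal ?_)
    · intro s hs
      have h0 := hT0.trans_le hs
      have h1 := Real.rpow_le_rpow_of_nonpos hT0 hs (neg_nonpos.2 hm.le)
      rw [zero_add]
      exact ⟨by positivity, by gcongr⟩
    · intro s _
      have := hβ s
      rw [zero_add]
      exact ⟨mul_nonneg (by positivity) this.1, by gcongr; exact this.2⟩
    · have hpos : 0 ≤ E * T ^ (-α) := by positivity
      intro s hs s' hs'
      rw [← mul_sub, ← mul_sub (E * T ^ (-α)), abs_mul (E * T ^ (-α)), abs_of_nonneg hpos]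
      rcases le_total s s' with h1 | h1
      · rw [dist_comm, abs_sub_comm (β s)]
        refine (htail T s s' hεT hs h1).trans ?_
        gcongr
        exact le_abs_self _
      · refine (htail T s' s hεT hs' h1).trans ?_
        rw [← abs_neg (E * _), ← mul_neg, neg_sub]
        gcongr
        exact le_abs_self _
    · rw [← hVdef, ← hfin, ← hY]
      have e1 : E * T ^ (-m) / ε + 1 ≤ (E + 1) * (T ^ (-m) / ε) := by
        rw [mul_div_assoc]; nlinarith
      have e2 : E * T ^ (-α) * (2 * Real.pi) / ε + 1 ≤
          (E * (2 * Real.pi) + 1) * (T ^ (-α) / ε) := by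
        have : E * T ^ (-α) * (2 * Real.pi) / ε = E * (2 * Real.pi) * (T ^ (-α) / ε) := by ring
        rw [this]; nlinarith
      calc V * (ε ^ N * ((E * T ^ (-m) / ε + 1) * (E * T ^ (-α) * (2 * Real.pi) / ε + 1)))
          ≤ V * (ε ^ N * (((E + 1) * (T ^ (-m) / ε)) *
            ((E * (2 * Real.pi) + 1) * (T ^ (-α) / ε)))) := by gcongr
        _ = _ := by ring
  calc volume (Metric.thickening ε (f '' Ici t₁))
      ≤ volume (Metric.thickening ε (f '' Icc t₁ T) ∪ Metric.thickening ε (f '' Ici T)) := by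
        rw [← Metric.thickening_union]
        exact measure_mono (Metric.thickening_subset_of_subset ε hsplit)
    _ ≤ _ := (measure_union_le _ _).trans (add_le_add b1 b2)
    _ = _ := by
        have hpi := Real.pi_pos
        rw [← ENNReal.ofReal_add (by positivity) (by positivity), ← add_mul]

theorem volume_ball_prod_le (x : ℝ × ℝ) (r : ℝ) (hr : 0 < r) :
    volume (Metric.ball x r) ≤ ENNReal.ofReal (4 * r ^ 2) := by
  rw [← ball_prod_same, Measure.volume_eq_prod, Measure.prod_prod, Real.volume_ball,
    Real.volume_ball, ← ENNReal.ofReal_mul (by positivity)]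
  exact ENNReal.ofReal_le_ofReal (by nlinarith)

/-- Density at scale `ε` in a plane set of area `κ T ^ (-α - m)` forces a packing of at least order
`T ^ (-α - m) / ε ^ 2` disjoint `ε`-balls. -/
theorem exists_le_volume_thickening {N : ℕ} {A : Set (EuclideanSpace ℝ (Fin N))}
    {α m κ M T₀ : ℝ} (hm : 0 < m) (hκ : 0 < κ) (hM : 0 < M)
    {π : EuclideanSpace ℝ (Fin N) → ℝ × ℝ} (hπ : LipschitzWith 1 π)
    (hcov : ∀ T, T₀ ≤ T → ∃ B : Set (ℝ × ℝ), ENNReal.ofReal (κ * T ^ (-α - m)) ≤ volume B ∧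
      B ⊆ Metric.thickening (M * T ^ (-m - 1)) (π '' A)) :
    ∃ c, 0 < c ∧ ∀ᶠ ε : ℝ in 𝓝[>] 0,
      ENNReal.ofReal (c * ε ^ ((N : ℝ) - (2 - (α + m) / (1 + m)))) ≤
        volume (Metric.thickening ε A) := by
  have hm1 : 0 < 1 + m := by linarith
  have hV := unitBallVolume_pos N
  set V := unitBallVolume N
  set e := (α + m) / (1 + m) with he
  have hMe := Real.rpow_pos_of_pos hM (-e)
  -- The factor `36 = 4 * 3 ^ 2` is the area constant of the squares of half-side `3ε` in the
  -- packing bound.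
  refine ⟨κ * M ^ (-e) * V / 36, by positivity, ?_⟩
  -- This is the time `T` that solves `M * T ^ (-m - 1) = ε`.
  have hT : Tendsto (fun ε : ℝ => (ε / M) ^ (-(1 / (1 + m)))) (𝓝[>] 0) atTop := by
    refine (tendsto_rpow_neg_nhdsGT_zero (by simp; linarith)).comp ?_
    refine tendsto_nhdsWithin_iff.2 ⟨?_, ?_⟩
    · have : Tendsto (fun ε : ℝ => ε / M) (𝓝 0) (𝓝 (0 / M)) := tendsto_id.div_const M
      rw [zero_div] at this
      exact this.mono_left nhdsWithin_le_nhds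
    · filter_upwards [eventually_mem_nhdsWithin] with ε hε
      exact div_pos hε hM
  filter_upwards [hT.eventually_ge_atTop T₀, eventually_mem_nhdsWithin] with ε hεT hε
  rw [mem_Ioi] at hε
  obtain ⟨B, hB, hsub⟩ := hcov _ hεT
  have hεM : 0 < ε / M := by positivity
  rw [← Real.rpow_mul hεM.le] at hB hsub
  have e1 : M * (ε / M) ^ (-(1 / (1 + m)) * (-m - 1)) = ε := by
    have : -(1 / (1 + m)) * (-m - 1) = 1 := by field_simp; ring
    rw [this, Real.rpow_one]; field_simp
  have e2 : (ε / M) ^ (-(1 / (1 + m)) * (-α - m)) = M ^ (-e) * ε ^ e := by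
    have : -(1 / (1 + m)) * (-α - m) = e := by rw [he]; field_simp; ring
    rw [this, Real.div_rpow hε.le hM.le, Real.rpow_neg hM.le]; field_simp
  rw [e1] at hsub
  rw [e2] at hB
  have key := volume_mul_le_volume_thickening hπ volume_ball_prod_le hε hsub
  have h36 : (0 : ℝ) < 4 * (3 * ε) ^ 2 := by positivity
  have hne : ENNReal.ofReal (4 * (3 * ε) ^ 2) ≠ 0 := (ENNReal.ofReal_pos.2 h36).ne'
  rw [mul_comm, mul_comm _ (volume (Metric.thickening ε A)),
    ← ENNReal.div_le_iff hne ENNReal.ofReal_ne_top] at key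
  refine le_trans ?_ key
  rw [ENNReal.le_div_iff_mul_le (Or.inl hne) (Or.inl ENNReal.ofReal_ne_top)]
  have hεe := Real.rpow_pos_of_pos hε e
  calc ENNReal.ofReal (κ * M ^ (-e) * V / 36 * ε ^ ((N : ℝ) - (2 - e))) *
        ENNReal.ofReal (4 * (3 * ε) ^ 2)
      = ENNReal.ofReal (V * ε ^ N * (κ * (M ^ (-e) * ε ^ e))) := by
        rw [← ENNReal.ofReal_mul' h36.le]
        congr 1
        have : ε ^ ((N : ℝ) - (2 - e)) * ε ^ 2 = ε ^ N * ε ^ e := by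
          rw [← Real.rpow_natCast, ← Real.rpow_natCast, ← Real.rpow_add hε, ← Real.rpow_add hε]
          congr 1; push_cast; ring
        linear_combination κ * M ^ (-e) * V * this
    _ = ENNReal.ofReal (V * ε ^ N) * ENNReal.ofReal (κ * (M ^ (-e) * ε ^ e)) :=
        ENNReal.ofReal_mul (by positivity)
    _ ≤ _ := by gcongr

theorem isBounded_image_of_abs_sub_le {N : ℕ} {f : ℝ → EuclideanSpace ℝ (Fin N)} {t₁ C : ℝ}
    (h : ∀ i t, t₁ ≤ t → |f t i - f t₁ i| ≤ C) : Bornology.IsBounded (f '' Ici t₁) := by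
  refine (Metric.isBounded_closedBall (x := f t₁) (r := N * C)).subset ?_
  rintro _ ⟨t, ht, rfl⟩
  rw [Metric.mem_closedBall]
  refine (dist_le_sum_abs _ _).trans ((Finset.sum_le_sum fun i _ => h i t ht).trans ?_)
  simp

theorem hasBoxDim_of_coordBounds {N : ℕ} {f : ℝ → EuclideanSpace ℝ (Fin N)}
    {t₁ α m C κ M T₀ : ℝ} {β : ℝ → ℝ} (ht₁ : 0 < t₁) (hm : 0 < m) (hmα : m ≤ α) (hα : α < 1)
    (hC : 0 ≤ C) (hβ : ∀ t, β t ∈ Icc 0 (2 * Real.pi))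
    (h : ∀ i, CoordBounds t₁ α m C β fun t => f t i) (hκ : 0 < κ) (hM : 0 < M)
    {π : EuclideanSpace ℝ (Fin N) → ℝ × ℝ} (hπ : LipschitzWith 1 π)
    (hcov : ∀ T, T₀ ≤ T → ∃ B : Set (ℝ × ℝ), ENNReal.ofReal (κ * T ^ (-α - m)) ≤ volume B ∧
      B ⊆ Metric.thickening (M * T ^ (-m - 1)) (π '' (f '' Ici t₁))) :
    HasBoxDim (f '' Ici t₁) (2 - (α + m) / (1 + m)) := by
  obtain ⟨C', hup⟩ := exists_volume_thickening_le ht₁ hm hmα hα hC hβ h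
  obtain ⟨c, hc, hlow⟩ := exists_le_volume_thickening hm hκ hM hπ hcov
  refine hasBoxDim_of_volume_bounds ?_ ?_ hc hlow hup
  · refine isBounded_image_of_abs_sub_le
      (C := C * t₁ ^ (-m) + C * t₁ ^ (-α) * (2 * Real.pi)) fun i t ht => ?_
    refine ((h i).tail t₁ t₁ t le_rfl le_rfl ht).trans ?_
    have h1 := Real.rpow_pos_of_pos (ht₁.trans_le ht) (-m)
    have h2 : |β t - β t₁| ≤ 2 * Real.pi :=
      abs_le.2 ⟨by linarith [(hβ t).1, (hβ t₁).2], by linarith [(hβ t).2, (hβ t₁).1]⟩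
    gcongr
    linarith
  · rw [sub_nonneg, div_le_iff₀ (by linarith)]
    linarith

/-! ### Coordinates of the curves -/

/-- Meant for the height, which does not oscillate: the power of time controls its tail without help
from the angle. The arc bound follows from `-m - 1 ≤ -α`. -/
theorem coordBounds_of_deriv {t₁ α m C : ℝ} {w w' : ℝ → ℝ} (β : ℝ → ℝ) (ht₁ : 0 < t₁) (hm : 0 < m)
    (hα : α < 1) (hC : 0 < C)
    (hw : ∀ t, t₁ ≤ t → HasDerivWithinAt w (w' t) (Ici t₁) t)
    (hw' : ∀ t, t₁ ≤ t → |w' t| ≤ C * t ^ (-m - 1)) :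
    ∃ C', 0 < C' ∧ CoordBounds t₁ α m C' β w := by
  have h1α : 0 < 1 - α := by linarith
  have hp := Real.rpow_pos_of_pos ht₁ (-m - 1 - (1 - α - 1))
  set C₁ := C * t₁ ^ (-m - 1 - (1 - α - 1)) / (1 - α)
  have hC₁ : 0 < C₁ := by positivity
  have hb : CoordBounds t₁ α m (max C₁ (C / m)) β w := by
    constructor
    · intro s t hs hst
      refine (abs_sub_le_rpow ht₁ h1α.ne' (C := C * t₁ ^ (-m - 1 - (1 - α - 1))) hw ?_ hs
        hst).trans ?_
      · intro t ht
        refine (hw' t ht).trans ?_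
        rw [mul_assoc]
        gcongr
        exact rpow_le_mul_rpow ht₁ ht (by linarith)
      · have := Real.rpow_le_rpow (ht₁.trans_le hs).le hst h1α.le
        exact mul_le_mul_of_nonneg_right (le_max_left _ _) (by linarith)
    · intro T s t hT hs hst
      have h0 := ht₁.trans_le hT
      have h1 := abs_sub_le_rpow ht₁ (neg_ne_zero.2 hm.ne') hw hw' (hT.trans hs) hst
      have h2 := Real.rpow_le_rpow_of_nonpos (h0.trans_le hs) hst (neg_nonpos.2 hm.le)
      have h3 := mul_le_mul_of_nonneg_right (le_max_right C₁ (C / m)) (sub_nonneg.2 h2)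
      have h4 : 0 ≤ max C₁ (C / m) * T ^ (-α) * |β t - β s| := by positivity
      have h5 : C / -m * (t ^ (-m) - s ^ (-m)) = C / m * (s ^ (-m) - t ^ (-m)) := by
        rw [div_neg]; ring
      linarith
  exact ⟨_, lt_max_of_lt_left hC₁, hb⟩

/-- The angle `ψ` modulo `2 π`. -/
def reducedAngle (ψ : ℝ → ℝ) (t : ℝ) : ℝ := ψ t - ⌊ψ t / (2 * Real.pi)⌋ * (2 * Real.pi)

theorem reducedAngle_mem (ψ : ℝ → ℝ) (t : ℝ) : reducedAngle ψ t ∈ Icc 0 (2 * Real.pi) := by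
  have hpi : 0 < 2 * Real.pi := Real.two_pi_pos
  have h1 := Int.floor_le (ψ t / (2 * Real.pi))
  have h2 := Int.lt_floor_add_one (ψ t / (2 * Real.pi))
  rw [le_div_iff₀ hpi] at h1
  rw [div_lt_iff₀ hpi] at h2
  unfold reducedAngle
  constructor <;> linarith

theorem sin_reducedAngle (ψ : ℝ → ℝ) (t : ℝ) : Real.sin (reducedAngle ψ t) = Real.sin (ψ t) :=
  Real.sin_sub_int_mul_two_pi _ _

theorem cos_reducedAngle (ψ : ℝ → ℝ) (t : ℝ) : Real.cos (reducedAngle ψ t) = Real.cos (ψ t) :=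
  Real.cos_sub_int_mul_two_pi _ _

/-- A modulated oscillation `g sin ψ + h cos ψ` whose amplitudes decay like `t ^ (-α)`. -/
structure Oscillation (t₁ α C : ℝ) (g g' h h' ψ ψ' : ℝ → ℝ) : Prop where
  g_deriv : ∀ t, t₁ ≤ t → HasDerivWithinAt g (g' t) (Ici t₁) t
  h_deriv : ∀ t, t₁ ≤ t → HasDerivWithinAt h (h' t) (Ici t₁) t
  ψ_deriv : ∀ t, t₁ ≤ t → HasDerivWithinAt ψ (ψ' t) (Ici t₁) t
  g_le : ∀ t, t₁ ≤ t → |g t| ≤ C * t ^ (-α)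
  h_le : ∀ t, t₁ ≤ t → |h t| ≤ C * t ^ (-α)
  g'_le : ∀ t, t₁ ≤ t → |g' t| ≤ C * t ^ (-α - 1)
  h'_le : ∀ t, t₁ ≤ t → |h' t| ≤ C * t ^ (-α - 1)
  ψ'_le : ∀ t, t₁ ≤ t → |ψ' t| ≤ C

section Oscillation

variable {t₁ α C : ℝ} {g g' h h' ψ ψ' : ℝ → ℝ}

/-- The terms containing `ψ'` set the order `t ^ (-α)`; those containing `g'` or `h'` are smaller by
a factor `1 / t`. -/
theorem Oscillation.exists_deriv (H : Oscillation t₁ α C g g' h h' ψ ψ') (ht₁ : 0 < t₁)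
    (hC : 0 < C) : ∃ (w' : ℝ → ℝ) (C' : ℝ), 0 < C' ∧
      (∀ t, t₁ ≤ t → HasDerivWithinAt (fun t => g t * Real.sin (ψ t) + h t * Real.cos (ψ t))
        (w' t) (Ici t₁) t) ∧
      ∀ t, t₁ ≤ t → |w' t| ≤ C' * t ^ (-α) := by
  have hp := Real.rpow_pos_of_pos ht₁ (-α - 1 - -α)
  refine ⟨_, 2 * (C * t₁ ^ (-α - 1 - -α)) + 2 * (C * C), by positivity, fun t ht =>
    ((H.g_deriv t ht).mul (H.ψ_deriv t ht).sin).add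
      ((H.h_deriv t ht).mul (H.ψ_deriv t ht).cos), fun t ht => ?_⟩
  have hs := Real.abs_sin_le_one (ψ t)
  have hc := Real.abs_cos_le_one (ψ t)
  have h0 := Real.rpow_pos_of_pos (ht₁.trans_le ht) (-α)
  have hpow : C * t ^ (-α - 1) ≤ C * t₁ ^ (-α - 1 - -α) * t ^ (-α) := by
    rw [mul_assoc]; gcongr; exact rpow_le_mul_rpow ht₁ ht (by linarith)
  have b1 : |g' t * Real.sin (ψ t)| ≤ C * t₁ ^ (-α - 1 - -α) * t ^ (-α) := by
    rw [abs_mul]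
    have := mul_le_mul ((H.g'_le t ht).trans hpow) hs (abs_nonneg _) (by positivity)
    linarith
  have b2 : |h' t * Real.cos (ψ t)| ≤ C * t₁ ^ (-α - 1 - -α) * t ^ (-α) := by
    rw [abs_mul]
    have := mul_le_mul ((H.h'_le t ht).trans hpow) hc (abs_nonneg _) (by positivity)
    linarith
  have b3 : |g t * (Real.cos (ψ t) * ψ' t)| ≤ C * t ^ (-α) * C := by
    rw [abs_mul, abs_mul]
    have e := mul_le_mul hc (H.ψ'_le t ht) (abs_nonneg _) zero_le_one
    rw [one_mul] at e
    exact mul_le_mul (H.g_le t ht) e (by positivity) (by positivity)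
  have b4 : |h t * (-Real.sin (ψ t) * ψ' t)| ≤ C * t ^ (-α) * C := by
    rw [abs_mul, abs_mul, abs_neg]
    have e := mul_le_mul hs (H.ψ'_le t ht) (abs_nonneg _) zero_le_one
    rw [one_mul] at e
    exact mul_le_mul (H.h_le t ht) e (by positivity) (by positivity)
  refine (abs_add_le _ _).trans ((add_le_add (abs_add_le _ _) (abs_add_le _ _)).trans ?_)
  linarith

/-- The arc bound integrates the derivative. For the tail that would be too crude: amplitude and
angle are varied one after the other, and the angle may be reduced modulo `2π` because only its sine
and cosine enter. -/
theorem Oscillation.exists_coordBounds (H : Oscillation t₁ α C g g' h h' ψ ψ') {m : ℝ}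
    (ht₁ : 0 < t₁) (hC : 0 < C) (hm : 0 < m) (hmα : m ≤ α) (hα : α < 1) :
    ∃ C', 0 < C' ∧ CoordBounds t₁ α m C' (reducedAngle ψ)
      fun t => g t * Real.sin (ψ t) + h t * Real.cos (ψ t) := by
  have h1α : 0 < 1 - α := by linarith
  obtain ⟨w', C₁, hC₁, hw, hw'⟩ := H.exists_deriv ht₁ hC
  have hp := Real.rpow_pos_of_pos ht₁ (-α - 1 - (-m - 1))
  set C₂ := C * t₁ ^ (-α - 1 - (-m - 1)) with hC₂
  have hC₂0 : 0 < C₂ := by positivity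
  have inc : ∀ {f f' : ℝ → ℝ}, (∀ t, t₁ ≤ t → HasDerivWithinAt f (f' t) (Ici t₁) t) →
      (∀ t, t₁ ≤ t → |f' t| ≤ C * t ^ (-α - 1)) → ∀ {s t}, t₁ ≤ s → s ≤ t →
      |f t - f s| ≤ C₂ / m * (s ^ (-m) - t ^ (-m)) := by
    intro f f' hf hf' s t hs hst
    refine (abs_sub_le_rpow ht₁ (neg_ne_zero.2 hm.ne') (C := C₂) hf (fun t ht => ?_) hs hst).trans
      (le_of_eq ?_)
    · refine (hf' t ht).trans ?_
      rw [hC₂, mul_assoc]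
      gcongr
      exact rpow_le_mul_rpow ht₁ ht (by linarith)
    · rw [div_neg]; ring
  refine ⟨C₁ / (1 - α) + 2 * (C₂ / m) + 2 * C, by positivity, ?_, ?_⟩
  · intro s t hs hst
    refine (abs_sub_le_rpow ht₁ h1α.ne' (C := C₁) hw (fun t ht => ?_) hs hst).trans ?_
    · rw [show 1 - α - 1 = -α by ring]; exact hw' t ht
    · have := Real.rpow_le_rpow (ht₁.trans_le hs).le hst h1α.le
      refine mul_le_mul_of_nonneg_right ?_ (by linarith)
      have : 0 < 2 * (C₂ / m) + 2 * C := by positivity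
      linarith
  · intro T s t hT hs hst
    have hT0 := ht₁.trans_le hT
    have hs' := hT.trans hs
    have ig := inc H.g_deriv H.g'_le hs' hst
    have ih := inc H.h_deriv H.h'_le hs' hst
    have hsT := Real.rpow_le_rpow_of_nonpos hT0 hs (by linarith : -α ≤ 0)
    have gs : |g s| ≤ C * T ^ (-α) := (H.g_le s hs').trans (by gcongr)
    have hs2 : |h s| ≤ C * T ^ (-α) := (H.h_le s hs').trans (by gcongr)
    simp only [← sin_reducedAngle ψ, ← cos_reducedAngle ψ]
    set a := reducedAngle ψ t
    set b := reducedAngle ψ s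
    -- First the amplitudes change at the final angle `a`, then the angle changes at the initial
    -- amplitudes, which are at most `C * T ^ (-α)`.
    have e1 : g t * Real.sin a + h t * Real.cos a - (g s * Real.sin b + h s * Real.cos b) =
        (g t - g s) * Real.sin a + (h t - h s) * Real.cos a +
          (g s * (Real.sin a - Real.sin b) + h s * (Real.cos a - Real.cos b)) := by ring
    have b1 : |(g t - g s) * Real.sin a| ≤ C₂ / m * (s ^ (-m) - t ^ (-m)) := by
      rw [abs_mul]
      exact (mul_le_of_le_one_right (abs_nonneg _) (Real.abs_sin_le_one _)).trans ig
    have b2 : |(h t - h s) * Real.cos a| ≤ C₂ / m * (s ^ (-m) - t ^ (-m)) := by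
      rw [abs_mul]
      exact (mul_le_of_le_one_right (abs_nonneg _) (Real.abs_cos_le_one _)).trans ih
    have b3 : |g s * (Real.sin a - Real.sin b)| ≤ C * T ^ (-α) * |a - b| := by
      rw [abs_mul]
      exact mul_le_mul gs (Real.abs_sin_sub_sin_le _ _) (abs_nonneg _) (by positivity)
    have b4 : |h s * (Real.cos a - Real.cos b)| ≤ C * T ^ (-α) * |a - b| := by
      rw [abs_mul]
      exact mul_le_mul hs2 (Real.abs_cos_sub_cos_le _ _) (abs_nonneg _) (by positivity)
    rw [e1]
    refine (abs_add_le _ _).trans ((add_le_add (abs_add_le _ _) (abs_add_le _ _)).trans ?_)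
    have hmono := Real.rpow_le_rpow_of_nonpos (hT0.trans_le hs) hst (neg_nonpos.2 hm.le)
    have p1 : 0 ≤ (C₁ / (1 - α) + 2 * C) * (s ^ (-m) - t ^ (-m)) :=
      mul_nonneg (by positivity) (by linarith)
    have p2 : 0 ≤ (C₁ / (1 - α) + 2 * (C₂ / m)) * T ^ (-α) * |a - b| := by positivity
    linarith

end Oscillation

/-! ### Dimensions of the explicit solution curves -/

theorem lipschitzWith_coord_pair {N : ℕ} (i j : Fin N) :
    LipschitzWith 1 fun v : EuclideanSpace ℝ (Fin N) => ((v i, v j) : ℝ × ℝ) := by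
  refine LipschitzWith.of_dist_le_mul fun a b => ?_
  have h : ∀ i, dist (a i) (b i) ≤ dist a b := fun i => by
    rw [dist_eq_norm, dist_eq_norm]
    exact PiLp.norm_apply_le (a - b) i
  simpa [Prod.dist_eq] using ⟨h i, h j⟩

theorem lipschitzWith_coord {N : ℕ} (i : Fin N) :
    LipschitzWith 1 fun v : EuclideanSpace ℝ (Fin N) => v i := by
  refine LipschitzWith.of_dist_le_mul fun a b => ?_
  rw [dist_eq_norm, dist_eq_norm, NNReal.coe_one, one_mul]
  exact PiLp.norm_apply_le (a - b) i

/-- First coordinate of the solution with amplitude factor `A` and phase shift `θ`. -/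
def solX (A θ : ℝ) (p q : ℝ → ℝ) (t : ℝ) : ℝ := A * p t * Real.sin (q t + θ)

/-- Derivative of `solX`. -/
def solY (A θ : ℝ) (p p₁ q q₁ : ℝ → ℝ) (t : ℝ) : ℝ :=
  A * p₁ t * Real.sin (q t + θ) + A * (p t * q₁ t) * Real.cos (q t + θ)

namespace AmplitudePhase

variable {t₀ α K c C t₂ : ℝ} {p p₁ p₂ q q₁ q₂ : ℝ → ℝ}

theorem p_pos (h : AmplitudePhase t₀ α K c C t₂ p p₁ p₂ q q₁ q₂) {t : ℝ} (ht : t₀ ≤ t) :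
    0 < p t :=
  lt_of_lt_of_le (mul_pos h.c_pos (Real.rpow_pos_of_pos (h.t₀_pos.trans_le ht) _)) (h.le_p t ht)

/-- Since `q' ≥ c`, the phase gains a full turn within time `2π / c`, so it meets every direction.
-/
theorem exists_phase_eq (h : AmplitudePhase t₀ α K c C t₂ p p₁ p₂ q q₁ q₂) (θ β : ℝ) {τ : ℝ}
    (hτ : t₀ ≤ τ) : ∃ t, τ ≤ t ∧ t ≤ τ + 2 * Real.pi / c ∧
      Real.sin (q t + θ) = Real.sin β ∧ Real.cos (q t + θ) = Real.cos β := by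
  have hpi : 0 < 2 * Real.pi := Real.two_pi_pos
  have hc := h.c_pos
  have hd : 0 < 2 * Real.pi / c := by positivity
  set n : ℤ := ⌈(q τ + θ - β) / (2 * Real.pi)⌉ with hn
  have n1 : (q τ + θ - β) / (2 * Real.pi) ≤ n := Int.le_ceil _
  have n2 : (n : ℝ) < (q τ + θ - β) / (2 * Real.pi) + 1 := Int.ceil_lt_add_one _
  rw [div_le_iff₀ hpi] at n1
  rw [← sub_lt_iff_lt_add, lt_div_iff₀ hpi] at n2
  have hinc : 2 * Real.pi ≤ q (τ + 2 * Real.pi / c) - q τ := by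
    have h1 := abs_sub_le_of_abs_deriv_le (a := t₀) (f := fun t => c * t) (f' := fun _ => c)
      (fun t _ => by simpa using ((hasDerivAt_id t).const_mul c).hasDerivWithinAt (s := Ici t₀))
      h.q_deriv (fun t ht => by rw [abs_of_pos hc]; exact h.le_q₁ t ht) hτ
      (by linarith : τ ≤ τ + 2 * Real.pi / c)
    have h2 := (le_abs_self _).trans h1
    have h3 : c * (τ + 2 * Real.pi / c) - c * τ = 2 * Real.pi := by field_simp; ring
    linarith
  have hcont : ContinuousOn q (Icc τ (τ + 2 * Real.pi / c)) := fun t ht =>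
    (h.q_deriv t (hτ.trans ht.1)).continuousWithinAt.mono
      fun s hs => hτ.trans hs.1
  obtain ⟨t, ht, hqt⟩ := intermediate_value_Icc (by linarith) hcont
    (show β + n * (2 * Real.pi) - θ ∈ Icc (q τ) (q (τ + 2 * Real.pi / c)) from
      ⟨by linarith, by linarith⟩)
  have e : q t + θ = β + n * (2 * Real.pi) := by rw [hqt]; ring
  exact ⟨t, ht.1, ht.2, by rw [e, Real.sin_add_int_mul_two_pi], by
    rw [e, Real.cos_add_int_mul_two_pi]⟩

theorem abs_p_sub_le (h : AmplitudePhase t₀ α K c C t₂ p p₁ p₂ q q₁ q₂) {T τ t : ℝ} (hT : t₀ ≤ T)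
    (hτ : T ≤ τ) (ht : τ ≤ t) (ht' : t ≤ τ + 2 * Real.pi / c) :
    |p t - p τ| ≤ C * (2 * Real.pi / c) * T ^ (-α - 1) := by
  have hT0 := h.t₀_pos.trans_le hT
  have hC := h.C_pos
  have hα := h.α_pos
  have h1 := abs_sub_le_mul (a := T) (C := C * T ^ (-α - 1))
    (fun t ht => (h.p_deriv t (hT.trans ht)).mono (Ici_subset_Ici.2 hT))
    (fun t ht => (h.abs_p₁_le t (hT.trans ht)).trans (mul_le_mul_of_nonneg_left
      (Real.rpow_le_rpow_of_nonpos hT0 ht (by linarith)) hC.le)) hτ ht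
  calc |p t - p τ| ≤ C * T ^ (-α - 1) * (t - τ) := h1
    _ ≤ C * T ^ (-α - 1) * (2 * Real.pi / c) := by gcongr; linarith
    _ = _ := by ring

theorem tendsto_p (h : AmplitudePhase t₀ α K c C t₂ p p₁ p₂ q q₁ q₂) :
    Tendsto p atTop (𝓝 0) := by
  have h1 : Tendsto (fun t : ℝ => C * t ^ (-α)) atTop (𝓝 0) := by
    simpa using (tendsto_rpow_neg_atTop h.α_pos).const_mul C
  refine tendsto_of_tendsto_of_tendsto_of_le_of_le' tendsto_const_nhds h1 ?_ ?_
  · filter_upwards [eventually_ge_atTop t₀] with t ht using (h.p_pos ht).le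
  · filter_upwards [eventually_ge_atTop t₀] with t ht using h.p_le t ht

/-- The phase portrait is `T ^ (-α - 1)`-dense in a square of side comparable to `T ^ (-α)`. -/
theorem exists_dense_phase (h : AmplitudePhase t₀ α K c C t₂ p p₁ p₂ q q₁ q₂) {A t₁ : ℝ} (θ : ℝ)
    (hA : 0 < A) (ht₁ : t₀ ≤ t₁) : ∃ κ M T₀ : ℝ, 0 < κ ∧ 0 < M ∧ ∀ T, T₀ ≤ T →
      ∃ B : Set (ℝ × ℝ), ENNReal.ofReal (κ * T ^ (-α - α)) ≤ volume B ∧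
        ∀ b ∈ B, ∃ t, t₁ ≤ t ∧ |solX A θ p q t - b.1| < M * T ^ (-α - 1) ∧
          |solY A θ p p₁ q q₁ t - b.2| < M * T ^ (-α - 1) := by
  have hc := h.c_pos
  have hC := h.C_pos
  have hK := h.K_pos
  have hα := h.α_pos
  have hpi := Real.pi_pos
  -- With this `k` every target in the square has elliptic radius `ρ ≤ A * c * T ^ (-α) ≤ A * p T`.
  set k := A * c / (1 / K + 1) with hk
  have hk0 : 0 < k := by positivity
  set G := A * (C * (2 * Real.pi / c)) with hG
  have hG0 : 0 < G := by positivity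
  -- The summands of `M` bound, in units of `T ^ (-α - 1)`, the drift of the amplitude during one
  -- turn (`G` and `G * K`), the `p'` term and the effect of `q' - K`; the final `1` makes the
  -- inequalities strict.
  refine ⟨k ^ 2 / 4, G + A * C + A * C * C + G * K + 1, t₁, by positivity, by positivity,
    fun T hT => ?_⟩
  have hT0 : 0 < T := h.t₀_pos.trans_le (ht₁.trans hT)
  have hTt := ht₁.trans hT
  have hTα := Real.rpow_pos_of_pos hT0 (-α)
  have hTα1 := Real.rpow_pos_of_pos hT0 (-α - 1)
  refine ⟨Icc (k / 2 * T ^ (-α)) (k * T ^ (-α)) ×ˢ Icc (k / 2 * T ^ (-α)) (k * T ^ (-α)), ?_, ?_⟩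
  · rw [Measure.volume_eq_prod, Measure.prod_prod, Real.volume_Icc,
      ← ENNReal.ofReal_mul (by nlinarith)]
    refine ENNReal.ofReal_le_ofReal (le_of_eq ?_)
    rw [show -α - α = -α + -α by ring, Real.rpow_add hT0]
    ring
  · rintro ⟨v, w⟩ ⟨⟨hv1, hv2⟩, ⟨hw1, hw2⟩⟩
    simp only at hv1 hv2 hw1 hw2 ⊢
    have hv0 : 0 < v := lt_of_lt_of_le (by positivity) hv1
    have hw0 : 0 < w := lt_of_lt_of_le (by positivity) hw1
    -- The curve is close to `A p (sin, K cos)` of its phase, so the target is written as `(ρ sin β,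
    -- K ρ cos β)`.
    have p1 := Complex.norm_mul_cos_arg (⟨w / K, v⟩ : ℂ)
    have p2 := Complex.norm_mul_sin_arg (⟨w / K, v⟩ : ℂ)
    have p3 := Complex.norm_le_abs_re_add_abs_im (⟨w / K, v⟩ : ℂ)
    have p4 : 0 < ‖(⟨w / K, v⟩ : ℂ)‖ := by
      rw [norm_pos_iff]
      intro h0
      exact hv0.ne' (congrArg Complex.im h0)
    generalize ‖(⟨w / K, v⟩ : ℂ)‖ = ρ at p1 p2 p3 p4
    generalize Complex.arg ⟨w / K, v⟩ = β at p1 p2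
    simp only at p1 p2 p3
    rw [abs_of_pos hv0, abs_of_pos (by positivity)] at p3
    have hρ : ρ ≤ A * c * T ^ (-α) := by
      have e1 : w / K ≤ k * T ^ (-α) / K := by gcongr
      have e2 : k * T ^ (-α) / K + k * T ^ (-α) = A * c * T ^ (-α) := by
        rw [hk]; field_simp
      linarith
    -- The amplitude equals `ρ` at some `τ ≥ T`, as it decreases to `0` in the limit; within one
    -- further turn the phase takes the value `β`.
    obtain ⟨τ, hτ, hAτ⟩ : ∃ τ, T ≤ τ ∧ A * p τ = ρ := by
      obtain ⟨T', hT'1, hT'2⟩ := (((h.tendsto_p.const_mul A).eventually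
        (gt_mem_nhds (by simpa using p4 : A * 0 < ρ))).and (eventually_ge_atTop T)).exists
      have hcont : ContinuousOn (fun t => A * p t) (Ici T) := fun t ht =>
        (((h.p_deriv t (hTt.trans ht)).continuousWithinAt).mono (Ici_subset_Ici.2 hTt)).const_mul A
      obtain ⟨τ, hτ, e⟩ := isPreconnected_Ici.intermediate_value hT'2 (self_mem_Ici (a := T)) hcont
        ⟨hT'1.le, by have := h.le_p T hTt; nlinarith⟩
      exact ⟨τ, hτ, e⟩
    obtain ⟨t, ht1, ht2, hsin, hcos⟩ := h.exists_phase_eq θ β (hTt.trans hτ)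
    have hTt' : T ≤ t := hτ.trans ht1
    have ht0 : t₀ ≤ t := hTt.trans hTt'
    have htp : 0 < t := h.t₀_pos.trans_le ht0
    have hinc : |A * p t - ρ| ≤ G * T ^ (-α - 1) := by
      rw [← hAτ, ← mul_sub, abs_mul, abs_of_pos hA, hG, mul_assoc]
      exact mul_le_mul_of_nonneg_left (h.abs_p_sub_le hTt hτ ht1 ht2) hA.le
    have hp₁ : |A * p₁ t| ≤ A * C * T ^ (-α - 1) := by
      rw [abs_mul, abs_of_pos hA, mul_assoc]
      gcongr
      exact (h.abs_p₁_le t ht0).trans (mul_le_mul_of_nonneg_left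
        (Real.rpow_le_rpow_of_nonpos hT0 hTt' (by linarith)) hC.le)
    have hq : |A * p t * (q₁ t - K)| ≤ A * C * C * T ^ (-α - 1) := by
      have e1 := h.p_le t ht0
      have e2 := h.abs_q₁_sub_le t ht0
      have e3 : t ^ (-α - 1) = t ^ (-α) * t ^ (-1 : ℝ) := by
        rw [← Real.rpow_add htp]; ring_nf
      have e4 := Real.rpow_le_rpow_of_nonpos hT0 hTt' (by linarith : -α - 1 ≤ 0)
      have e5 := h.p_pos ht0
      have e6 := Real.rpow_pos_of_pos htp (-α)
      rw [abs_mul, abs_of_pos (by positivity)]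
      calc A * p t * |q₁ t - K| ≤ A * (C * t ^ (-α)) * (C * t ^ (-1 : ℝ)) := by gcongr
        _ = A * C * C * t ^ (-α - 1) := by rw [e3]; ring
        _ ≤ _ := by gcongr
    have small : ∀ {a b r : ℝ}, |a| ≤ r → |b| ≤ 1 → |a * b| ≤ r := fun ha hb => by
      rw [abs_mul]
      exact (mul_le_of_le_one_right (abs_nonneg _) hb).trans ha
    refine ⟨t, hT.trans hTt', ?_, ?_⟩
    · have e : solX A θ p q t - v = (A * p t - ρ) * Real.sin β := by
        rw [solX, hsin, ← p2]; ring
      rw [e]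
      refine (small hinc (Real.abs_sin_le_one β)).trans_lt ?_
      have : 0 < (A * C + A * C * C + G * K + 1) * T ^ (-α - 1) := by positivity
      linarith
    · have e : solY A θ p p₁ q q₁ t - w = A * p₁ t * Real.sin β +
          (A * p t * (q₁ t - K) * Real.cos β + (A * p t - ρ) * K * Real.cos β) := by
        have : w = ρ * Real.cos β * K := by rw [p1]; field_simp
        rw [solY, hsin, hcos, this]; ring
      have hinc' : |(A * p t - ρ) * K| ≤ G * K * T ^ (-α - 1) := by
        rw [abs_mul, abs_of_pos hK]; nlinarith
      rw [e]
      refine ((abs_add_le _ _).trans (add_le_add (small hp₁ (Real.abs_sin_le_one β))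
        ((abs_add_le _ _).trans (add_le_add (small hq (Real.abs_cos_le_one β))
          (small hinc' (Real.abs_cos_le_one β)))))).trans_lt ?_
      have : 0 < (G + 1) * T ^ (-α - 1) := by positivity
      linarith

/-- The projection of the space curve to the first and third coordinates is
`T ^ (-γ - 1)`-dense in a rectangle with sides comparable to `T ^ (-α)` and `T ^ (-γ)`. -/
theorem exists_dense_space (h : AmplitudePhase t₀ α K c C t₂ p p₁ p₂ q q₁ q₂) {A t₁ Z γ : ℝ}
    (θ : ℝ) (hA : 0 < A) (ht₁ : t₀ ≤ t₁) (hZ : 0 < Z) (hγ : 0 < γ) (hγα : γ ≤ α) :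
    ∃ κ M T₀ : ℝ, 0 < κ ∧ 0 < M ∧ ∀ T, T₀ ≤ T →
      ∃ B : Set (ℝ × ℝ), ENNReal.ofReal (κ * T ^ (-α - γ)) ≤ volume B ∧
        ∀ b ∈ B, ∃ t, t₁ ≤ t ∧ |solX A θ p q t - b.1| < M * T ^ (-γ - 1) ∧
          |Z * t ^ (-γ) - b.2| < M * T ^ (-γ - 1) := by
  have hc := h.c_pos
  have hC := h.C_pos
  have hα := h.α_pos
  have hpi := Real.pi_pos
  have h2α := Real.rpow_pos_of_pos (zero_lt_two (α := ℝ)) (-α)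
  set k := A * c * 2 ^ (-α) with hk
  have hk0 : 0 < k := by positivity
  set G := A * (C * (2 * Real.pi / c)) with hG
  have hG0 : 0 < G := by positivity
  have h2γ : (2 : ℝ) ^ (-γ) < 1 := Real.rpow_lt_one_of_one_lt_of_neg one_lt_two (by linarith)
  have hκ : 0 < k * (Z * (1 - (2 : ℝ) ^ (-γ))) := mul_pos hk0 (mul_pos hZ (by linarith))
  -- Requiring `T ≥ 1` lets `T ^ (-α - 1)` be absorbed into `T ^ (-γ - 1)`.
  refine ⟨_, G + Z * γ * (2 * Real.pi / c) + 1, max t₁ 1, hκ, by positivity, fun T hT => ?_⟩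
  have hT1 : 1 ≤ T := (le_max_right _ _).trans hT
  replace hT : t₁ ≤ T := (le_max_left _ _).trans hT
  have hT0 : 0 < T := by linarith
  have hTt := ht₁.trans hT
  have hTα := Real.rpow_pos_of_pos hT0 (-α)
  have hTγ := Real.rpow_pos_of_pos hT0 (-γ)
  have hTγ1 := Real.rpow_pos_of_pos hT0 (-γ - 1)
  have e2T : (2 * T) ^ (-γ) = 2 ^ (-γ) * T ^ (-γ) := Real.mul_rpow zero_le_two hT0.le
  -- The heights are those reached between `T` and `2T`; throughout that time the amplitude is at
  -- least `k * T ^ (-α)`.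
  refine ⟨Icc 0 (k * T ^ (-α)) ×ˢ Icc (Z * (2 * T) ^ (-γ)) (Z * T ^ (-γ)), ?_, ?_⟩
  · rw [Measure.volume_eq_prod, Measure.prod_prod, Real.volume_Icc, Real.volume_Icc,
      ← ENNReal.ofReal_mul (by rw [sub_zero]; positivity)]
    refine ENNReal.ofReal_le_ofReal (le_of_eq ?_)
    rw [show -α - γ = -α + -γ by ring, Real.rpow_add hT0, e2T]
    ring
  · rintro ⟨v, w⟩ ⟨⟨hv1, hv2⟩, ⟨hw1, hw2⟩⟩
    simp only at hv1 hv2 hw1 hw2 ⊢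
    have hzcont : ContinuousOn (fun t : ℝ => Z * t ^ (-γ)) (Icc T (2 * T)) :=
      continuousOn_const.mul (continuousOn_id.rpow_const
        fun t ht => Or.inl (hT0.trans_le ht.1).ne')
    obtain ⟨τ, ⟨hτ, hτ2⟩, hzτ⟩ := intermediate_value_Icc' (by linarith : T ≤ 2 * T) hzcont
      ⟨hw1, hw2⟩
    simp only at hzτ
    have hAp : v ≤ A * p τ := by
      have e1 := h.le_p τ (hTt.trans hτ)
      have e2 := Real.rpow_le_rpow_of_nonpos (hT0.trans_le hτ) hτ2 (by linarith : -α ≤ 0)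
      rw [Real.mul_rpow zero_le_two hT0.le] at e2
      calc v ≤ A * (c * (2 ^ (-α) * T ^ (-α))) := by rw [hk] at hv2; linarith
        _ ≤ A * (c * τ ^ (-α)) := by gcongr
        _ ≤ _ := by gcongr
    have hApτ : 0 < A * p τ := mul_pos hA (h.p_pos (hTt.trans hτ))
    -- The height `w` fixes `τ`; the arcsine gives the phase at which the oscillation of amplitude
    -- `A * p τ` takes the value `v`.
    have hβ : Real.sin (Real.arcsin (v / (A * p τ))) = v / (A * p τ) :=
      Real.sin_arcsin (by linarith [div_nonneg hv1 hApτ.le]) ((div_le_one hApτ).2 hAp)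
    set β := Real.arcsin (v / (A * p τ))
    obtain ⟨t, ht1, ht2, hsin, -⟩ := h.exists_phase_eq θ β (hTt.trans hτ)
    refine ⟨t, hT.trans (hτ.trans ht1), ?_, ?_⟩
    · have e : solX A θ p q t - v = A * (p t - p τ) * Real.sin β := by
        have : v = A * p τ * Real.sin β := by rw [hβ, mul_div_cancel₀ _ hApτ.ne']
        rw [solX, hsin]
        linear_combination -this
      have e1 : |A * (p t - p τ)| ≤ G * T ^ (-α - 1) := by
        rw [abs_mul, abs_of_pos hA, hG, mul_assoc]
        exact mul_le_mul_of_nonneg_left (h.abs_p_sub_le hTt hτ ht1 ht2) hA.le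
      have e2 : T ^ (-α - 1) ≤ T ^ (-γ - 1) :=
        Real.rpow_le_rpow_of_exponent_le hT1 (by linarith)
      rw [e, abs_mul]
      refine ((mul_le_of_le_one_right (abs_nonneg _) (Real.abs_sin_le_one β)).trans
        (e1.trans (mul_le_mul_of_nonneg_left e2 hG0.le))).trans_lt ?_
      have : 0 < (Z * γ * (2 * Real.pi / c) + 1) * T ^ (-γ - 1) := by positivity
      linarith
    · rw [← hzτ]
      have e1 := abs_sub_le_mul (a := T) (C := Z * γ * T ^ (-γ - 1)) (f := fun t => Z * t ^ (-γ))
        (fun t ht => ((Real.hasDerivAt_rpow_const (p := -γ)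
          (Or.inl (hT0.trans_le ht).ne')).const_mul Z).hasDerivWithinAt)
        (fun t ht => by
          have := Real.rpow_pos_of_pos (hT0.trans_le ht) (-γ - 1)
          rw [abs_mul, abs_mul, abs_neg, abs_of_pos hZ, abs_of_pos hγ, abs_of_pos this, ← mul_assoc]
          exact mul_le_mul_of_nonneg_left
            (Real.rpow_le_rpow_of_nonpos hT0 ht (by linarith)) (by positivity)) hτ ht1
      refine e1.trans_lt ?_
      have e2 : Z * γ * T ^ (-γ - 1) * (t - τ) ≤ Z * γ * T ^ (-γ - 1) * (2 * Real.pi / c) := by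
        gcongr; linarith
      have : 0 < (G + 1) * T ^ (-γ - 1) := by positivity
      linarith

/-- The coordinates of the phase curve are modulated oscillations. -/
theorem exists_oscillation (h : AmplitudePhase t₀ α K c C t₂ p p₁ p₂ q q₁ q₂) {A t₁ : ℝ} (θ : ℝ)
    (hA : 0 ≤ A) (ht₁ : t₀ ≤ t₁) : ∃ C', 0 < C' ∧
      Oscillation t₁ α C' (fun t => A * p t) (fun t => A * p₁ t) (fun _ => 0) (fun _ => 0)
        (fun t => q t + θ) q₁ ∧
      Oscillation t₁ α C' (fun t => A * p₁ t) (fun t => A * p₂ t) (fun t => A * (p t * q₁ t))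
        (fun t => A * (p₁ t * q₁ t + p t * q₂ t)) (fun t => q t + θ) q₁ := by
  have hC := h.C_pos
  have ht₀ := h.t₀_pos
  set b := t₀ ^ (-1 : ℝ) with hb
  have hb0 : 0 < b := Real.rpow_pos_of_pos ht₀ _
  set E := A * C + A * C * b + A * (C * C) + A * (C * C + C * C * b) + C with hE
  have hE0 : 0 < E := by positivity
  have mono : ∀ {f : ℝ → ℝ} {f' t : ℝ}, HasDerivWithinAt f f' (Ici t₀) t →
      HasDerivWithinAt f f' (Ici t₁) t := fun hf => hf.mono (Ici_subset_Ici.2 ht₁)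
  have pow : ∀ (β : ℝ) {t : ℝ}, t₁ ≤ t → t ^ (β - 1) ≤ b * t ^ β := fun β t ht => by
    have := rpow_le_mul_rpow ht₀ (ht₁.trans ht) (by linarith : β - 1 ≤ β)
    rwa [show β - 1 - β = -1 by ring] at this
  have pow2 : ∀ {t : ℝ}, t₁ ≤ t → t ^ (-α - 2) ≤ b * t ^ (-α - 1) := fun {t} ht => by
    have := pow (-α - 1) ht
    rwa [show -α - 1 - 1 = -α - 2 by ring] at this
  have habs : ∀ a : ℝ, |A * a| = A * |a| := fun a => by rw [abs_mul, abs_of_nonneg hA]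
  have fin : ∀ {a r β t : ℝ}, t₁ ≤ t → a ≤ r * t ^ β → r ≤ E → a ≤ E * t ^ β :=
    fun ht h1 h2 => h1.trans (mul_le_mul_of_nonneg_right h2
      (Real.rpow_nonneg (ht₀.trans_le (ht₁.trans ht)).le _))
  have n1 : 0 ≤ A * C := by positivity
  have n2 : 0 ≤ A * C * b := by positivity
  have n3 : 0 ≤ A * (C * C) := by positivity
  have n4 : 0 ≤ A * (C * C + C * C * b) := by positivity
  have hp : ∀ t, t₁ ≤ t → |A * p t| ≤ A * C * t ^ (-α) := fun t ht => by
    rw [habs, abs_of_pos (h.p_pos (ht₁.trans ht)), mul_assoc]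
    exact mul_le_mul_of_nonneg_left (h.p_le t (ht₁.trans ht)) hA
  have hp₁ : ∀ t, t₁ ≤ t → |A * p₁ t| ≤ A * C * t ^ (-α - 1) := fun t ht => by
    rw [habs, mul_assoc]
    exact mul_le_mul_of_nonneg_left (h.abs_p₁_le t (ht₁.trans ht)) hA
  have hq₁ : ∀ t, t₁ ≤ t → |q₁ t| ≤ C := fun t ht => by
    rw [abs_of_pos (h.c_pos.trans_le (h.le_q₁ t (ht₁.trans ht)))]
    exact h.q₁_le t (ht₁.trans ht)
  have dψ : ∀ t, t₁ ≤ t → HasDerivWithinAt (fun t => q t + θ) (q₁ t) (Ici t₁) t := fun t ht =>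
    (mono (h.q_deriv t (ht₁.trans ht))).add_const θ
  have hψ : ∀ t, t₁ ≤ t → |q₁ t| ≤ E := fun t ht => (hq₁ t ht).trans (by linarith)
  have zero : ∀ {β t : ℝ}, t₁ ≤ t → |(0 : ℝ)| ≤ E * t ^ β := fun {β t} ht => by
    have := Real.rpow_pos_of_pos (ht₀.trans_le (ht₁.trans ht)) β
    rw [abs_zero]; positivity
  refine ⟨E, hE0, ⟨?_, ?_, dψ, ?_, ?_, ?_, ?_, hψ⟩, ⟨?_, ?_, dψ, ?_, ?_, ?_, ?_, hψ⟩⟩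
  · exact fun t ht => (mono (h.p_deriv t (ht₁.trans ht))).const_mul A
  · exact fun t _ => hasDerivWithinAt_const t _ 0
  · exact fun t ht => fin ht (hp t ht) (by linarith)
  · exact fun t ht => zero ht
  · exact fun t ht => fin ht (hp₁ t ht) (by linarith)
  · exact fun t ht => zero ht
  · exact fun t ht => (mono (h.p₁_deriv t (ht₁.trans ht))).const_mul A
  · exact fun t ht => ((mono (h.p_deriv t (ht₁.trans ht))).mul
      (mono (h.q₁_deriv t (ht₁.trans ht)))).const_mul A
  · intro t ht
    refine fin (r := A * C * b) ht ((hp₁ t ht).trans ?_) (by linarith)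
    rw [mul_assoc _ b]
    exact mul_le_mul_of_nonneg_left (pow (-α) ht) n1
  · intro t ht
    refine fin (r := A * (C * C)) ht ?_ (by linarith)
    have e := mul_le_mul (hp t ht) (hq₁ t ht) (abs_nonneg _) ((abs_nonneg _).trans (hp t ht))
    rw [← mul_assoc, abs_mul]
    linarith
  · intro t ht
    refine fin (r := A * C * b) ht ?_ (by linarith)
    rw [habs, mul_assoc, mul_assoc]
    refine mul_le_mul_of_nonneg_left ((h.abs_p₂_le t (ht₁.trans ht)).trans ?_) hA
    exact mul_le_mul_of_nonneg_left (pow2 ht) hC.le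
  · intro t ht
    refine fin (r := A * (C * C + C * C * b)) ht ?_ (by linarith)
    have ht0 := ht₁.trans ht
    have htp := ht₀.trans_le ht0
    rw [habs, mul_assoc]
    refine mul_le_mul_of_nonneg_left ((abs_add_le _ _).trans ?_) hA
    rw [abs_mul, abs_mul, abs_of_pos (h.p_pos ht0)]
    have e1 := mul_le_mul (h.abs_p₁_le t ht0) (hq₁ t ht) (abs_nonneg _)
      ((abs_nonneg _).trans (h.abs_p₁_le t ht0))
    have e2 := mul_le_mul (h.p_le t ht0) (h.abs_q₂_le t ht0) (abs_nonneg _)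
      ((h.p_pos ht0).le.trans (h.p_le t ht0))
    have e3 : C * t ^ (-α) * (C * t ^ (-2 : ℝ)) = C * C * t ^ (-α - 2) := by
      rw [show -α - 2 = -α + -2 by ring, Real.rpow_add htp]; ring
    have e4 := mul_le_mul_of_nonneg_left (pow2 ht) (by positivity : 0 ≤ C * C)
    linarith

end AmplitudePhase

theorem subset_thickening_of_forall_exists {N : ℕ} {f : ℝ → EuclideanSpace ℝ (Fin N)} {i j : Fin N}
    {t₁ r : ℝ} {B : Set (ℝ × ℝ)}
    (hB : ∀ b ∈ B, ∃ t, t₁ ≤ t ∧ |f t i - b.1| < r ∧ |f t j - b.2| < r) :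
    B ⊆ Metric.thickening r ((fun v : EuclideanSpace ℝ (Fin N) => ((v i, v j) : ℝ × ℝ)) ''
      (f '' Ici t₁)) := by
  intro b hb
  obtain ⟨t, ht, h1, h2⟩ := hB b hb
  refine Metric.mem_thickening_iff.2 ⟨_, mem_image_of_mem _ (mem_image_of_mem f ht), ?_⟩
  rw [Prod.dist_eq, max_lt_iff, Real.dist_eq, Real.dist_eq, abs_sub_comm, abs_sub_comm b.2]
  exact ⟨h1, h2⟩

theorem hasDerivWithinAt_const_mul_rpow {t₁ Z γ : ℝ} (ht₁ : 0 < t₁) (t : ℝ) (ht : t₁ ≤ t) :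
    HasDerivWithinAt (fun t : ℝ => Z * t ^ (-γ)) (Z * (-γ * t ^ (-γ - 1))) (Ici t₁) t :=
  ((Real.hasDerivAt_rpow_const (p := -γ) (Or.inl (ht₁.trans_le ht).ne')).const_mul
    Z).hasDerivWithinAt

theorem abs_deriv_const_mul_rpow_le {t₁ Z γ m : ℝ} (ht₁ : 0 < t₁) (hZ : 0 < Z) (hγ : 0 < γ)
    (hm : m ≤ γ) (t : ℝ) (ht : t₁ ≤ t) :
    |Z * (-γ * t ^ (-γ - 1))| ≤ Z * γ * t₁ ^ (-γ - 1 - (-m - 1)) * t ^ (-m - 1) := by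
  have := Real.rpow_pos_of_pos (ht₁.trans_le ht) (-γ - 1)
  rw [abs_mul, abs_mul, abs_neg, abs_of_pos hZ, abs_of_pos hγ, abs_of_pos this, ← mul_assoc,
    mul_assoc (Z * γ) _ (t ^ (-m - 1))]
  exact mul_le_mul_of_nonneg_left (rpow_le_mul_rpow ht₁ ht (by linarith)) (by positivity)

/-- The curve traced by a solution in the phase plane. -/
def solPlane (A θ : ℝ) (p p₁ q q₁ : ℝ → ℝ) (t : ℝ) : EuclideanSpace ℝ (Fin 2) :=
  !₂[solX A θ p q t, solY A θ p p₁ q q₁ t]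

/-- The curve traced by a solution of the spatial system. -/
def solSpace (A θ Z γ : ℝ) (p p₁ q q₁ : ℝ → ℝ) (t : ℝ) : EuclideanSpace ℝ (Fin 3) :=
  !₂[solX A θ p q t, solY A θ p p₁ q q₁ t, Z * t ^ (-γ)]

namespace AmplitudePhase

variable {t₀ α K c C t₂ : ℝ} {p p₁ p₂ q q₁ q₂ : ℝ → ℝ}

theorem exists_coordBounds (h : AmplitudePhase t₀ α K c C t₂ p p₁ p₂ q q₁ q₂) {A t₁ m : ℝ} (θ : ℝ)
    (hA : 0 ≤ A) (ht₁ : t₀ ≤ t₁) (hm : 0 < m) (hmα : m ≤ α) (hα : α < 1) :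
    ∃ C', 0 < C' ∧ CoordBounds t₁ α m C' (reducedAngle fun t => q t + θ) (solX A θ p q) ∧
      CoordBounds t₁ α m C' (reducedAngle fun t => q t + θ) (solY A θ p p₁ q q₁) := by
  have ht₁0 := h.t₀_pos.trans_le ht₁
  obtain ⟨E, hE, hX, hY⟩ := h.exists_oscillation θ hA ht₁
  obtain ⟨C₁, hC₁, b1⟩ := hX.exists_coordBounds ht₁0 hE hm hmα hα
  obtain ⟨C₂, hC₂, b2⟩ := hY.exists_coordBounds ht₁0 hE hm hmα hα
  refine ⟨max C₁ C₂, lt_max_of_lt_left hC₁, ?_, ?_⟩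
  · have : solX A θ p q = fun t => A * p t * Real.sin (q t + θ) + 0 * Real.cos (q t + θ) := by
      funext t; rw [solX]; ring
    rw [this]
    exact b1.mono ht₁0 hm.le hα.le (le_max_left _ _)
  · exact b2.mono ht₁0 hm.le hα.le (le_max_right _ _)

theorem hasBoxDim_solPlane (h : AmplitudePhase t₀ α K c C t₂ p p₁ p₂ q q₁ q₂) {A t₁ : ℝ} (θ : ℝ)
    (hA : 0 < A) (ht₁ : t₀ ≤ t₁) (hα : α < 1) :
    HasBoxDim (solPlane A θ p p₁ q q₁ '' Ici t₁) (2 / (1 + α)) := by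
  have hα0 := h.α_pos
  obtain ⟨C', hC', b1, b2⟩ := h.exists_coordBounds θ hA.le ht₁ hα0 le_rfl hα
  obtain ⟨κ, M, T₀, hκ, hM, hd⟩ := h.exists_dense_phase θ hA ht₁
  have e : 2 / (1 + α) = 2 - (α + α) / (1 + α) := by field_simp; ring
  rw [e]
  refine hasBoxDim_of_coordBounds (T₀ := T₀) (h.t₀_pos.trans_le ht₁) hα0 le_rfl hα hC'.le
    (reducedAngle_mem fun t => q t + θ) ?_ hκ hM (lipschitzWith_coord_pair 0 1) fun T hT => ?_
  · intro i
    fin_cases i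
    · exact b1
    · exact b2
  · obtain ⟨B, hB, hd'⟩ := hd T hT
    exact ⟨B, hB, subset_thickening_of_forall_exists (f := solPlane A θ p p₁ q q₁)
      (i := 0) (j := 1) hd'⟩

theorem exists_coordBounds_solSpace (h : AmplitudePhase t₀ α K c C t₂ p p₁ p₂ q q₁ q₂)
    {A t₁ m Z γ : ℝ} (θ : ℝ) (hA : 0 ≤ A) (ht₁ : t₀ ≤ t₁) (hm : 0 < m) (hmα : m ≤ α) (hα : α < 1)
    (hZ : 0 < Z) (hmγ : m ≤ γ) :
    ∃ C', 0 < C' ∧ ∀ i, CoordBounds t₁ α m C' (reducedAngle fun t => q t + θ)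
      fun t => solSpace A θ Z γ p p₁ q q₁ t i := by
  have ht₁0 := h.t₀_pos.trans_le ht₁
  have hγ := hm.trans_le hmγ
  have hpow := Real.rpow_pos_of_pos ht₁0 (-γ - 1 - (-m - 1))
  obtain ⟨C₁, hC₁, b1, b2⟩ := h.exists_coordBounds θ hA ht₁ hm hmα hα
  obtain ⟨C₂, hC₂, b3⟩ := coordBounds_of_deriv (reducedAngle fun t => q t + θ) ht₁0 hm hα
    (by positivity) (hasDerivWithinAt_const_mul_rpow ht₁0)
    (abs_deriv_const_mul_rpow_le ht₁0 hZ hγ hmγ)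
  refine ⟨max C₁ C₂, lt_max_of_lt_left hC₁, fun i => ?_⟩
  fin_cases i
  · exact b1.mono ht₁0 hm.le hα.le (le_max_left _ _)
  · exact b2.mono ht₁0 hm.le hα.le (le_max_left _ _)
  · exact b3.mono ht₁0 hm.le hα.le (le_max_right _ _)

/-- The height decays at least as fast as the radius, so `m = α` governs the tail, and the
projection to the phase plane already carries the lower bound. -/
theorem hasBoxDim_solSpace_of_le (h : AmplitudePhase t₀ α K c C t₂ p p₁ p₂ q q₁ q₂)
    {A t₁ Z γ : ℝ} (θ : ℝ) (hA : 0 < A) (ht₁ : t₀ ≤ t₁) (hα : α < 1) (hZ : 0 < Z) (hαγ : α ≤ γ) :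
    HasBoxDim (solSpace A θ Z γ p p₁ q q₁ '' Ici t₁) (2 / (1 + α)) := by
  have hα0 := h.α_pos
  obtain ⟨C', hC', b⟩ := h.exists_coordBounds_solSpace θ hA.le ht₁ hα0 le_rfl hα hZ hαγ
  obtain ⟨κ, M, T₀, hκ, hM, hd⟩ := h.exists_dense_phase θ hA ht₁
  have e : 2 / (1 + α) = 2 - (α + α) / (1 + α) := by field_simp; ring
  rw [e]
  refine hasBoxDim_of_coordBounds (T₀ := T₀) (h.t₀_pos.trans_le ht₁) hα0 le_rfl hα hC'.le
    (reducedAngle_mem _) b hκ hM (lipschitzWith_coord_pair 0 1) fun T hT => ?_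
  obtain ⟨B, hB, hd'⟩ := hd T hT
  exact ⟨B, hB, subset_thickening_of_forall_exists (f := solSpace A θ Z γ p p₁ q q₁)
    (i := 0) (j := 1) hd'⟩

/-- Now the turns are separated mainly by height, so `m = γ`. The lower bound uses the projection to
the first and third coordinates. -/
theorem hasBoxDim_solSpace_of_lt (h : AmplitudePhase t₀ α K c C t₂ p p₁ p₂ q q₁ q₂)
    {A t₁ Z γ : ℝ} (θ : ℝ) (hA : 0 < A) (ht₁ : t₀ ≤ t₁) (hα : α < 1) (hZ : 0 < Z) (hγ : 0 < γ)
    (hγα : γ < α) :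
    HasBoxDim (solSpace A θ Z γ p p₁ q q₁ '' Ici t₁) (2 - (α + γ) / (1 + γ)) := by
  obtain ⟨C', hC', b⟩ := h.exists_coordBounds_solSpace θ hA.le ht₁ hγ hγα.le hα hZ le_rfl
  obtain ⟨κ, M, T₀, hκ, hM, hd⟩ := h.exists_dense_space θ hA ht₁ hZ hγ hγα.le
  refine hasBoxDim_of_coordBounds (T₀ := T₀) (h.t₀_pos.trans_le ht₁) hγ hγα.le hα hC'.le
    (reducedAngle_mem _) b hκ hM (lipschitzWith_coord_pair 0 2) fun T hT => ?_
  obtain ⟨B, hB, hd'⟩ := hd T hT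
  exact ⟨B, hB, subset_thickening_of_forall_exists (f := solSpace A θ Z γ p p₁ q q₁)
    (i := 0) (j := 2) hd'⟩

end AmplitudePhase

/-! ### The rectifiable case -/

theorem isRectifiable_of_dist_le {N : ℕ} {f : ℝ → EuclideanSpace ℝ (Fin N)} {ℓ : ℝ → ℝ}
    {s₀ L₀ L₁ : ℝ} (hf : ∀ s t, s₀ ≤ s → s ≤ t → dist (f s) (f t) ≤ ℓ t - ℓ s)
    (hℓ : ∀ t, s₀ ≤ t → ℓ t ∈ Icc L₀ L₁) : IsRectifiable f s₀ := by
  refine lt_of_le_of_lt (b := ENNReal.ofReal (L₁ - L₀)) ?_ ENNReal.ofReal_lt_top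
  refine iSup_le ?_
  rintro ⟨n, u, hu, hmem⟩
  calc ∑ i ∈ Finset.range n, edist (f (u (i + 1))) (f (u i))
      ≤ ∑ i ∈ Finset.range n, ENNReal.ofReal (ℓ (u (i + 1)) - ℓ (u i)) := by
        refine Finset.sum_le_sum fun i _ => ?_
        rw [edist_dist, dist_comm]
        exact ENNReal.ofReal_le_ofReal (hf _ _ (hmem i) (hu (Nat.le_succ i)))
    _ = ENNReal.ofReal (∑ i ∈ Finset.range n, (ℓ (u (i + 1)) - ℓ (u i))) :=
        (ENNReal.ofReal_sum_of_nonneg fun i _ =>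
          dist_nonneg.trans (hf _ _ (hmem i) (hu (Nat.le_succ i)))).symm
    _ ≤ _ := by
        rw [Finset.sum_range_sub fun i => ℓ (u i)]
        exact ENNReal.ofReal_le_ofReal (by linarith [(hℓ _ (hmem n)).2, (hℓ _ (hmem 0)).1])

/-- The bounded function `ℓ` serves as a length parameter and gives the upper bound `1`; one
coordinate covering an interval gives the lower bound. -/
theorem hasBoxDim_one_of_dist_le {N : ℕ} {f : ℝ → EuclideanSpace ℝ (Fin N)} {ℓ : ℝ → ℝ}
    {t₁ L₀ L₁ η : ℝ} {i : Fin N} (hf : ∀ s t, t₁ ≤ s → s ≤ t → dist (f s) (f t) ≤ ℓ t - ℓ s)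
    (hℓ : ∀ t, t₁ ≤ t → ℓ t ∈ Icc L₀ L₁) (hη : 0 < η)
    (hi : ∀ z ∈ Ioc 0 η, ∃ t, t₁ ≤ t ∧ f t i = z) :
    HasBoxDim (f '' Ici t₁) 1 := by
  have hL : 0 ≤ L₁ - L₀ := by linarith [(hℓ t₁ le_rfl).1, (hℓ t₁ le_rfl).2]
  have hV := unitBallVolume_pos N
  have hpow : ∀ ε : ℝ, 0 < ε → ε ^ ((N : ℝ) - 1) * ε = ε ^ N := fun ε hε => by
    rw [← Real.rpow_add_one hε.ne', sub_add_cancel, Real.rpow_natCast]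
  refine hasBoxDim_of_volume_bounds (c := η * unitBallVolume N / 6)
    (C := unitBallVolume N * 3 ^ N * (L₁ - L₀ + 1)) ?_ zero_le_one (by positivity) ?_ ?_
  · refine (Metric.isBounded_closedBall (x := f t₁) (r := L₁ - L₀)).subset ?_
    rintro _ ⟨t, ht, rfl⟩
    rw [Metric.mem_closedBall, dist_comm]
    exact (hf t₁ t le_rfl ht).trans (by linarith [(hℓ t ht).2, (hℓ t₁ le_rfl).1])
  · filter_upwards [eventually_mem_nhdsWithin] with ε hε
    rw [mem_Ioi] at hε
    have hsub : Ioc 0 η ⊆ Metric.thickening ε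
        ((fun v : EuclideanSpace ℝ (Fin N) => v i) '' (f '' Ici t₁)) := by
      intro z hz
      obtain ⟨t, ht, rfl⟩ := hi z hz
      exact Metric.self_subset_thickening hε _ (mem_image_of_mem _ (mem_image_of_mem f ht))
    have key := volume_mul_le_volume_thickening (k := 1) (C := 2) (lipschitzWith_coord i)
      (fun x r _ => by rw [Real.volume_ball, pow_one]) hε hsub
    rw [Real.volume_Ioc, sub_zero, ← ENNReal.ofReal_mul hη.le] at key
    have h6 : (0 : ℝ) < 2 * (3 * ε) ^ 1 := by positivity
    rw [mul_comm (ENNReal.ofReal (2 * (3 * ε) ^ 1)), ← ENNReal.div_le_iff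
      (ENNReal.ofReal_pos.2 h6).ne' ENNReal.ofReal_ne_top, ← ENNReal.ofReal_div_of_pos h6] at key
    refine le_trans (ENNReal.ofReal_le_ofReal (le_of_eq ?_)) key
    rw [← hpow ε hε]
    field_simp
    ring
  · filter_upwards [eventually_mem_nhdsWithin,
      nhdsWithin_le_nhds (eventually_le_nhds (zero_lt_one (α := ℝ)))] with ε hε hε1
    rw [mem_Ioi] at hε
    refine (volume_thickening_image_le (Ici t₁) f ℓ (fun _ => 0) (u₀ := L₀) (v₀ := 0)
      (L₁ := L₁ - L₀) (L₂ := 0) hε hL le_rfl ?_ (by simp) ?_).trans (ENNReal.ofReal_le_ofReal ?_)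
    · intro s hs
      rw [add_sub_cancel]
      exact hℓ s hs
    · intro s hs s' hs'
      simp only [sub_self, abs_zero, add_zero]
      rcases le_total s s' with h1 | h1
      · rw [abs_sub_comm]
        exact (hf s s' hs h1).trans (le_abs_self _)
      · rw [dist_comm]
        exact (hf s' s hs' h1).trans (le_abs_self _)
    · rw [zero_div, zero_add, mul_one, ← hpow ε hε]
      have hp := Real.rpow_pos_of_pos hε ((N : ℝ) - 1)
      have e : ε ^ ((N : ℝ) - 1) * ε * ((L₁ - L₀) / ε + 1) =
          ε ^ ((N : ℝ) - 1) * (L₁ - L₀ + ε) := by field_simp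
      rw [e, mul_assoc _ (L₁ - L₀ + 1), mul_comm (L₁ - L₀ + 1)]
      gcongr

namespace AmplitudePhase

variable {t₀ α K c C t₂ : ℝ} {p p₁ p₂ q q₁ q₂ : ℝ → ℝ}

/-- All three derivatives are `O(t ^ (-μ - 1))` with `μ = min (α - 1) γ > 0`, so a negative multiple
of `t ^ (-μ)` works as a bounded `ℓ`. -/
theorem exists_arc_bound_solSpace (h : AmplitudePhase t₀ α K c C t₂ p p₁ p₂ q q₁ q₂)
    {A t₁ Z γ : ℝ} (θ : ℝ) (hA : 0 ≤ A) (ht₁ : t₀ ≤ t₁) (hα : 1 < α) (hZ : 0 < Z) (hγ : 0 < γ) :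
    ∃ (ℓ : ℝ → ℝ) (L₀ L₁ : ℝ), (∀ t, t₁ ≤ t → ℓ t ∈ Icc L₀ L₁) ∧
      ∀ s t, t₁ ≤ s → s ≤ t →
        dist (solSpace A θ Z γ p p₁ q q₁ s) (solSpace A θ Z γ p p₁ q q₁ t) ≤ ℓ t - ℓ s := by
  have ht₁0 := h.t₀_pos.trans_le ht₁
  set μ := min (α - 1) γ
  have hμ : 0 < μ := lt_min (by linarith) hγ
  have hμα : μ ≤ α - 1 := min_le_left _ _
  have hμγ : μ ≤ γ := min_le_right _ _
  obtain ⟨E, hE, hX, hY⟩ := h.exists_oscillation θ hA ht₁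
  obtain ⟨x', C₁, hC₁, dx, bx⟩ := hX.exists_deriv ht₁0 hE
  obtain ⟨y', C₂, hC₂, dy, bdy⟩ := hY.exists_deriv ht₁0 hE
  have hpow := Real.rpow_pos_of_pos ht₁0 (-α - (-μ - 1))
  have hpow' := Real.rpow_pos_of_pos ht₁0 (-γ - 1 - (-μ - 1))
  have inc : ∀ {w w' : ℝ → ℝ} {E : ℝ}, (∀ t, t₁ ≤ t → HasDerivWithinAt w (w' t) (Ici t₁) t) →
      (∀ t, t₁ ≤ t → |w' t| ≤ E * t ^ (-μ - 1)) → ∀ {s t}, t₁ ≤ s → s ≤ t →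
      |w s - w t| ≤ E / μ * (s ^ (-μ) - t ^ (-μ)) := by
    intro w w' E hw hw' s t hs hst
    rw [abs_sub_comm]
    refine (abs_sub_le_rpow ht₁0 (neg_ne_zero.2 hμ.ne') hw hw' hs hst).trans (le_of_eq ?_)
    rw [div_neg]; ring
  have conv : ∀ {w' : ℝ → ℝ} {E : ℝ}, 0 < E → (∀ t, t₁ ≤ t → |w' t| ≤ E * t ^ (-α)) →
      ∀ t, t₁ ≤ t → |w' t| ≤ E * t₁ ^ (-α - (-μ - 1)) * t ^ (-μ - 1) := by
    intro w' E hE hw' t ht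
    rw [mul_assoc]
    exact (hw' t ht).trans (mul_le_mul_of_nonneg_left
      (rpow_le_mul_rpow ht₁0 ht (by linarith)) hE.le)
  set E₁ := C₁ * t₁ ^ (-α - (-μ - 1))
  set E₂ := C₂ * t₁ ^ (-α - (-μ - 1))
  set E₃ := Z * γ * t₁ ^ (-γ - 1 - (-μ - 1))
  have hE' : 0 ≤ E₁ / μ + E₂ / μ + E₃ / μ := by positivity
  refine ⟨fun t => -((E₁ / μ + E₂ / μ + E₃ / μ) * t ^ (-μ)),
    -((E₁ / μ + E₂ / μ + E₃ / μ) * t₁ ^ (-μ)), 0, ?_, ?_⟩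
  · intro t ht
    have h0 := Real.rpow_pos_of_pos (ht₁0.trans_le ht) (-μ)
    have h1 := Real.rpow_le_rpow_of_nonpos ht₁0 ht (neg_nonpos.2 hμ.le)
    exact ⟨neg_le_neg (mul_le_mul_of_nonneg_left h1 hE'),
      neg_nonpos.2 (mul_nonneg hE' h0.le)⟩
  · intro s t hs hst
    have i1 := inc dx (conv hC₁ bx) hs hst
    have i2 := inc dy (conv hC₂ bdy) hs hst
    have i3 := inc (hasDerivWithinAt_const_mul_rpow ht₁0)
      (abs_deriv_const_mul_rpow_le ht₁0 hZ hγ hμγ) hs hst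
    simp only [zero_mul, add_zero] at i1
    refine (dist_le_sum_abs _ _).trans ?_
    rw [Fin.sum_univ_three]
    change |solX A θ p q s - solX A θ p q t| + |solY A θ p p₁ q q₁ s - solY A θ p p₁ q q₁ t| +
      |Z * s ^ (-γ) - Z * t ^ (-γ)| ≤ _
    refine (add_le_add (add_le_add i1 i2) i3).trans (le_of_eq ?_)
    ring

theorem exists_solSpace_eq {A t₁ Z γ θ : ℝ} (ht₁ : 0 < t₁) (hγ : 0 < γ) :
    ∀ z ∈ Ioc 0 (Z * t₁ ^ (-γ)), ∃ t, t₁ ≤ t ∧ solSpace A θ Z γ p p₁ q q₁ t 2 = z := by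
  intro z hz
  have hcont : ContinuousOn (fun t : ℝ => Z * t ^ (-γ)) (Ici t₁) := fun t ht =>
    (hasDerivWithinAt_const_mul_rpow ht₁ t ht).continuousWithinAt
  have hlim : Tendsto (fun t : ℝ => Z * t ^ (-γ)) atTop (𝓝 0) := by
    simpa using (tendsto_rpow_neg_atTop hγ).const_mul Z
  obtain ⟨T, h1, h2⟩ := ((hlim.eventually (gt_mem_nhds hz.1)).and (eventually_ge_atTop t₁)).exists
  obtain ⟨t, ht, e⟩ := isPreconnected_Ici.intermediate_value h2 (self_mem_Ici (a := t₁)) hcont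
    ⟨h1.le, hz.2⟩
  exact ⟨t, ht, e⟩

theorem hasBoxDim_one_solSpace (h : AmplitudePhase t₀ α K c C t₂ p p₁ p₂ q q₁ q₂)
    {A t₁ Z γ : ℝ} (θ : ℝ) (hA : 0 ≤ A) (ht₁ : t₀ ≤ t₁) (hα : 1 < α) (hZ : 0 < Z) (hγ : 0 < γ) :
    HasBoxDim (solSpace A θ Z γ p p₁ q q₁ '' Ici t₁) 1 := by
  have ht₁0 := h.t₀_pos.trans_le ht₁
  obtain ⟨ℓ, L₀, L₁, hℓ, hf⟩ := h.exists_arc_bound_solSpace θ hA ht₁ hα hZ hγ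
  exact hasBoxDim_one_of_dist_le hf hℓ (mul_pos hZ (Real.rpow_pos_of_pos ht₁0 _))
    (exists_solSpace_eq ht₁0 hγ)

end AmplitudePhase

/-! ### Phase portraits are spirals -/

theorem exists_antideriv {a : ℝ} {g : ℝ → ℝ} (hg : ContinuousOn g (Ici a)) (y₀ : ℝ) :
    ∃ F : ℝ → ℝ, F a = y₀ ∧ ∀ t, a ≤ t → HasDerivWithinAt F (g t) (Ici a) t := by
  -- Extending `g` by its value at `a` makes it continuous on the whole line, and the antiderivative
  -- is then an integral.
  have hc : Continuous fun s => g (max a s) :=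
    hg.comp_continuous (continuous_const.max continuous_id) fun s => le_max_left a s
  refine ⟨fun t => y₀ + ∫ s in a..t, g (max a s), by simp, fun t ht => ?_⟩
  have h := ((hc.integral_hasStrictDerivAt a t).hasDerivAt.const_add y₀).hasDerivWithinAt
    (s := Ici a)
  rwa [max_eq_right ht] at h

/-- A continuously differentiable plane curve that avoids the origin has a differentiable angle;
`φ` is measured clockwise. -/
theorem exists_clockwise_angle {a : ℝ} {X Y X' Y' : ℝ → ℝ}
    (hX : ∀ t, a ≤ t → HasDerivWithinAt X (X' t) (Ici a) t)
    (hY : ∀ t, a ≤ t → HasDerivWithinAt Y (Y' t) (Ici a) t)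
    (hX' : ContinuousOn X' (Ici a)) (hY' : ContinuousOn Y' (Ici a))
    (h0 : ∀ t, a ≤ t → 0 < X t ^ 2 + Y t ^ 2) :
    ∃ φ : ℝ → ℝ, 0 < φ a ∧
      (∀ t, a ≤ t → HasDerivWithinAt φ ((Y t * X' t - X t * Y' t) / (X t ^ 2 + Y t ^ 2))
        (Ici a) t) ∧
      ∀ t, a ≤ t → X t = Real.sqrt (X t ^ 2 + Y t ^ 2) * Real.cos (φ t) ∧
        Y t = -(Real.sqrt (X t ^ 2 + Y t ^ 2) * Real.sin (φ t)) := by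
  have cX : ContinuousOn X (Ici a) := fun t ht => (hX t ht).continuousWithinAt
  have cY : ContinuousOn Y (Ici a) := fun t ht => (hY t ht).continuousWithinAt
  -- Adding `2π` to the clockwise initial angle keeps it positive, because `Complex.arg` is at most
  -- `π`.
  obtain ⟨φ, hφa, hφ⟩ := exists_antideriv
    (g := fun t => (Y t * X' t - X t * Y' t) / (X t ^ 2 + Y t ^ 2))
    (((cY.mul hX').sub (cX.mul hY')).div ((cX.pow 2).add (cY.pow 2)) fun t ht => (h0 t ht).ne')
    (2 * Real.pi - Complex.arg ⟨X a, Y a⟩)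
  refine ⟨φ, ?_, hφ, ?_⟩
  · rw [hφa]
    linarith [Complex.arg_le_pi ⟨X a, Y a⟩, Real.pi_pos]
  set R : ℝ → ℝ := fun t => Real.sqrt (X t ^ 2 + Y t ^ 2) with hR
  have hR0 : ∀ t, a ≤ t → 0 < R t := fun t ht => Real.sqrt_pos.2 (h0 t ht)
  have hR2 : ∀ t, a ≤ t → R t ^ 2 = X t ^ 2 + Y t ^ 2 := fun t ht => Real.sq_sqrt (h0 t ht).le
  have dR : ∀ t, a ≤ t → HasDerivWithinAt R ((X t * X' t + Y t * Y' t) / R t) (Ici a) t := by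
    intro t ht
    have h1 := (((hX t ht).pow 2).add ((hY t ht).pow 2)).sqrt (h0 t ht).ne'
    convert! h1 using 1
    have := hR0 t ht
    simp only [hR, Pi.add_apply, Pi.pow_apply] at this ⊢
    field_simp
    simp
    ring
  have const : ∀ {f f' : ℝ → ℝ}, (∀ t, a ≤ t → HasDerivWithinAt f (f' t) (Ici a) t) →
      (∀ t, a ≤ t → f' t = 0) → ∀ t, a ≤ t → f t = f a := by
    intro f f' hf hf' t ht
    have h1 := abs_sub_le_mul (C := 0) hf (fun t ht => by rw [hf' t ht, abs_zero]) le_rfl ht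
    rw [zero_mul] at h1
    exact sub_eq_zero.1 (abs_eq_zero.1 (le_antisymm h1 (abs_nonneg _)))
  -- The normalised curve, rotated back by `φ`, has zero derivative; its constant value is `(1, 0)`,
  -- as computed at `a`.
  have eU := const (fun t ht => ((((hX t ht).mul (hφ t ht).cos).sub
      ((hY t ht).mul (hφ t ht).sin))).div (dR t ht) (hR0 t ht).ne') (fun t ht => by
    have h1 := (hR0 t ht).ne'
    simp only [Pi.mul_apply, Pi.sub_apply]
    rw [div_eq_zero_iff]
    left
    rw [← hR2 t ht]
    field_simp
    rw [hR2 t ht]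
    ring)
  have eV := const (fun t ht => ((((hX t ht).mul (hφ t ht).sin).add
      ((hY t ht).mul (hφ t ht).cos))).div (dR t ht) (hR0 t ht).ne') (fun t ht => by
    have h1 := (hR0 t ht).ne'
    simp only [Pi.mul_apply, Pi.add_apply]
    rw [div_eq_zero_iff]
    left
    rw [← hR2 t ht]
    field_simp
    rw [hR2 t ht]
    ring)
  simp only [Pi.mul_apply, Pi.add_apply, Pi.sub_apply, Pi.div_apply] at eU eV
  have hnorm : ‖(⟨X a, Y a⟩ : ℂ)‖ = R a := by
    simp only [hR, Complex.norm_def, Complex.normSq_mk]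
    congr 1; ring
  have p1 := Complex.norm_mul_cos_arg (⟨X a, Y a⟩ : ℂ)
  have p2 := Complex.norm_mul_sin_arg (⟨X a, Y a⟩ : ℂ)
  rw [hnorm] at p1 p2
  simp only at p1 p2
  have hca : Real.cos (φ a) = Real.cos (Complex.arg ⟨X a, Y a⟩) := by
    rw [hφa, Real.cos_two_pi_sub]
  have hsa : Real.sin (φ a) = -Real.sin (Complex.arg ⟨X a, Y a⟩) := by
    rw [hφa, Real.sin_two_pi_sub]
  generalize Complex.arg ⟨X a, Y a⟩ = ω at p1 p2 hca hsa
  have hRa := (hR0 a le_rfl).ne'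
  have hsc := Real.sin_sq_add_cos_sq ω
  have uA : (X a * Real.cos (φ a) - Y a * Real.sin (φ a)) / R a = 1 := by
    rw [hca, hsa, ← p1, ← p2, div_eq_one_iff_eq hRa]
    linear_combination R a * hsc
  have vA : (X a * Real.sin (φ a) + Y a * Real.cos (φ a)) / R a = 0 := by
    rw [hca, hsa, ← p1, ← p2, div_eq_zero_iff]
    left; ring
  intro t ht
  have u := (eU t ht).trans uA
  have v := (eV t ht).trans vA
  have hRt := (hR0 t ht).ne'
  rw [div_eq_one_iff_eq hRt] at u
  rw [div_eq_zero_iff, or_iff_left hRt] at v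
  have hsct := Real.sin_sq_add_cos_sq (φ t)
  change X t = R t * _ ∧ Y t = -(R t * _)
  constructor
  · linear_combination (-X t) * hsct + Real.cos (φ t) * u + Real.sin (φ t) * v
  · linear_combination (-Y t) * hsct - Real.sin (φ t) * u + Real.cos (φ t) * v

/-- A curve whose clockwise angle increases to infinity and which contracts along each ray traces
a spiral. -/
theorem isSpiral_of_clockwise_angle {a : ℝ} {X Y R φ : ℝ → ℝ}
    (hφa : 0 < φ a) (hcont : ContinuousOn φ (Ici a)) (hmono : StrictMonoOn φ (Ici a))
    (htop : Tendsto φ atTop atTop) (hR : ∀ t, a ≤ t → 0 < R t) (hR0 : Tendsto R atTop (𝓝 0))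
    (hX : ∀ t, a ≤ t → X t = R t * Real.cos (φ t))
    (hY : ∀ t, a ≤ t → Y t = -(R t * Real.sin (φ t)))
    (hturn : ∀ t t', a ≤ t → t < t' → φ t' = φ t + 2 * Real.pi → R t' < R t) :
    IsSpiral ((fun t => !₂[X t, Y t]) '' Ici a) := by
  have hinv : ∀ ϕ, φ a ≤ ϕ → ∃ t, a ≤ t ∧ φ t = ϕ := by
    intro ϕ hϕ
    obtain ⟨T, h1, h2⟩ := ((htop.eventually_ge_atTop ϕ).and (eventually_ge_atTop a)).exists
    obtain ⟨t, ht, e⟩ := isPreconnected_Ici.intermediate_value (self_mem_Ici (a := a)) h2 hcont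
      ⟨hϕ, h1⟩
    exact ⟨t, ht, e⟩
  choose! τ hτa hτ using hinv
  have hτφ : ∀ t, a ≤ t → τ (φ t) = t := fun t ht => by
    have h1 : φ a ≤ φ t := hmono.monotoneOn (self_mem_Ici (a := a)) ht ht
    exact hmono.injOn (hτa _ h1) ht (hτ _ h1)
  have hpi := Real.pi_pos
  -- With `τ` the inverse of `φ`, the polar function is `R ∘ τ`. The clockwise orientation selects
  -- the mirror-image alternative.
  refine ⟨φ a, fun ϕ => R (τ ϕ), hφa, fun ϕ hϕ => hR _ (hτa ϕ hϕ), ?_, ?_, Or.inr ?_⟩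
  · refine hR0.comp (tendsto_atTop.2 fun b => ?_)
    filter_upwards [eventually_ge_atTop (φ (max a b)), eventually_ge_atTop (φ a)] with ϕ h1 h2
    by_contra! hlt
    have h3 := hmono (hτa ϕ h2) (le_max_left a b : max a b ∈ Ici a)
      (hlt.trans_le (le_max_right a b))
    rw [hτ ϕ h2] at h3
    linarith
  · intro ϕ hϕ
    refine strictAnti_nat_of_succ_lt fun k => ?_
    have h1 : φ a ≤ ϕ + 2 * (k : ℝ) * Real.pi := by
      have : 0 ≤ 2 * (k : ℝ) * Real.pi := by positivity
      linarith
    have h2 : φ a ≤ ϕ + 2 * ((k + 1 : ℕ) : ℝ) * Real.pi := by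
      push_cast; linarith
    have e : φ (τ (ϕ + 2 * ((k + 1 : ℕ) : ℝ) * Real.pi)) =
        φ (τ (ϕ + 2 * (k : ℝ) * Real.pi)) + 2 * Real.pi := by
      rw [hτ _ h1, hτ _ h2]; push_cast; ring
    refine hturn _ _ (hτa _ h1) ?_ e
    refine (hmono.lt_iff_lt (hτa _ h1) (hτa _ h2)).1 ?_
    rw [e]; linarith
  · ext v
    constructor
    · rintro ⟨t, ht, rfl⟩
      refine ⟨φ t, hmono.monotoneOn (self_mem_Ici (a := a)) ht ht, ?_⟩
      simp only [hτφ t ht, ← hX t ht, ← hY t ht]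
    · rintro ⟨ϕ, hϕ, rfl⟩
      refine ⟨τ ϕ, hτa ϕ hϕ, ?_⟩
      simp only [hX _ (hτa ϕ hϕ), hY _ (hτa ϕ hϕ), hτ ϕ hϕ]

theorem sq_add_sq_pos_of_ne_zero {u b S W : ℝ} (hb : b ≠ 0) (h : S ^ 2 + W ^ 2 = 1) :
    0 < S ^ 2 + (u * S + b * W) ^ 2 := by
  rcases eq_or_ne S 0 with rfl | hS
  · have hW : W ≠ 0 := by rintro rfl; norm_num at h
    rw [mul_zero, zero_add]
    positivity
  · positivity

theorem one_sub_le_sq_add_sq {S W ζ d : ℝ} (h : S ^ 2 + W ^ 2 = 1) (hζ : |W * ζ| ≤ d) :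
    1 - 2 * d ≤ S ^ 2 + (W + ζ) ^ 2 := by
  nlinarith [neg_abs_le (W * ζ), sq_nonneg ζ]

/-- From `exp (2e) ≥ 1 + 2e` and `(1 - e/2) * (1 + 2e) ≥ 1` for `e` in `[0, 1]`. -/
theorem exp_neg_sq_le {e : ℝ} (h0 : 0 ≤ e) (h1 : e ≤ 1) : Real.exp (-e) ^ 2 ≤ 1 - e / 2 := by
  have h4 := Real.add_one_le_exp (2 * e)
  have h5 : Real.exp (-e) ^ 2 = (Real.exp (2 * e))⁻¹ := by
    rw [← Real.exp_nat_mul, ← Real.exp_neg]; push_cast; ring_nf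
  rw [h5]
  refine (inv_anti₀ (by linarith) h4).trans ?_
  rw [inv_le_iff_one_le_mul₀ (by linarith)]
  nlinarith

namespace AmplitudePhase

variable {t₀ α K c C t₂ : ℝ} {p p₁ p₂ q q₁ q₂ : ℝ → ℝ}

theorem abs_p₁_div_le (h : AmplitudePhase t₀ α K c C t₂ p p₁ p₂ q q₁ q₂) {t : ℝ} (ht : t₀ ≤ t) :
    |p₁ t / p t| ≤ C / c * t ^ (-1 : ℝ) := by
  have htp := h.t₀_pos.trans_le ht
  have hc := h.c_pos
  have hp := h.p_pos ht
  have ht1 := Real.rpow_pos_of_pos htp (-1)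
  rw [abs_div, abs_of_pos hp, div_le_iff₀ hp]
  refine (h.abs_p₁_le t ht).trans ?_
  calc C * t ^ (-α - 1) = C / c * t ^ (-1 : ℝ) * (c * t ^ (-α)) := by
        rw [show -α - 1 = -1 + -α by ring, Real.rpow_add htp]; field_simp
    _ ≤ _ := mul_le_mul_of_nonneg_left (h.le_p t ht)
        (mul_nonneg (div_nonneg h.C_pos.le hc.le) ht1.le)

theorem abs_p₂_div_le (h : AmplitudePhase t₀ α K c C t₂ p p₁ p₂ q q₁ q₂) {t : ℝ} (ht : t₀ ≤ t) :
    |p₂ t / p t| ≤ C / c * t ^ (-2 : ℝ) := by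
  have htp := h.t₀_pos.trans_le ht
  have hc := h.c_pos
  have hp := h.p_pos ht
  have ht1 := Real.rpow_pos_of_pos htp (-2)
  rw [abs_div, abs_of_pos hp, div_le_iff₀ hp]
  refine (h.abs_p₂_le t ht).trans ?_
  calc C * t ^ (-α - 2) = C / c * t ^ (-2 : ℝ) * (c * t ^ (-α)) := by
        rw [show -α - 2 = -2 + -α by ring, Real.rpow_add htp]; field_simp
    _ ≤ _ := mul_le_mul_of_nonneg_left (h.le_p t ht)
        (mul_nonneg (div_nonneg h.C_pos.le hc.le) ht1.le)

theorem hasDerivWithinAt_solX (h : AmplitudePhase t₀ α K c C t₂ p p₁ p₂ q q₁ q₂) (A θ : ℝ) {t : ℝ}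
    (ht : t₀ ≤ t) :
    HasDerivWithinAt (solX A θ p q) (solY A θ p p₁ q q₁ t) (Ici t₀) t := by
  have h1 := ((h.p_deriv t ht).const_mul A).mul ((h.q_deriv t ht).add_const θ).sin
  convert! h1 using 1
  rw [solY]; ring

theorem hasDerivWithinAt_solY (h : AmplitudePhase t₀ α K c C t₂ p p₁ p₂ q q₁ q₂) (A θ : ℝ) {t : ℝ}
    (ht : t₀ ≤ t) :
    HasDerivWithinAt (solY A θ p p₁ q q₁)
      (A * (p₂ t - p t * q₁ t ^ 2) * Real.sin (q t + θ) +
        A * (2 * p₁ t * q₁ t + p t * q₂ t) * Real.cos (q t + θ)) (Ici t₀) t := by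
  have hψ := (h.q_deriv t ht).add_const θ
  have h1 := (((h.p₁_deriv t ht).const_mul A).mul hψ.sin).add
    ((((h.p_deriv t ht).mul (h.q₁_deriv t ht)).const_mul A).mul hψ.cos)
  convert! h1 using 1
  simp only [Pi.mul_apply]
  ring

/-- The angular velocity of the phase curve is bounded below. -/
theorem exists_le_angular_velocity (h : AmplitudePhase t₀ α K c C t₂ p p₁ p₂ q q₁ q₂) {A : ℝ}
    (θ : ℝ) (hA : 0 < A) : ∃ m T₁ : ℝ, 0 < m ∧ t₀ ≤ T₁ ∧ ∀ t, T₁ ≤ t →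
      0 < solX A θ p q t ^ 2 + solY A θ p p₁ q q₁ t ^ 2 ∧
      m ≤ (solY A θ p p₁ q q₁ t * solY A θ p p₁ q q₁ t - solX A θ p q t *
        (A * (p₂ t - p t * q₁ t ^ 2) * Real.sin (q t + θ) +
          A * (2 * p₁ t * q₁ t + p t * q₂ t) * Real.cos (q t + θ))) /
          (solX A θ p q t ^ 2 + solY A θ p p₁ q q₁ t ^ 2) := by
  have hc := h.c_pos
  have hC := h.C_pos
  have hlim : Tendsto (fun t : ℝ => (C + C / c) * t ^ (-2 : ℝ)) atTop (𝓝 0) := by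
    simpa using (tendsto_rpow_neg_atTop (y := 2) (by norm_num)).const_mul (C + C / c)
  obtain ⟨T, hT⟩ := eventually_atTop.1
    (hlim.eventually (gt_mem_nhds (by positivity : 0 < c ^ 2 / 2)))
  refine ⟨c ^ 2 / 2 / (1 + (C / c + C) ^ 2), max (max t₀ 1) T, by positivity,
    (le_max_left _ _).trans (le_max_left _ _), fun t ht => ?_⟩
  have ht0 : t₀ ≤ t := ((le_max_left _ _).trans (le_max_left _ _)).trans ht
  have ht1 : 1 ≤ t := ((le_max_right _ _).trans (le_max_left _ _)).trans ht
  have hsmall := hT t ((le_max_right _ _).trans ht)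
  have htp : 0 < t := by linarith
  have hp := h.p_pos ht0
  have b1 := h.abs_p₁_div_le ht0
  have b2 := h.abs_p₂_div_le ht0
  have b3 := h.abs_q₂_le t ht0
  have hq := h.le_q₁ t ht0
  have hq' := h.q₁_le t ht0
  have ht1' : t ^ (-1 : ℝ) ≤ 1 := Real.rpow_le_one_of_one_le_of_nonpos ht1 (by norm_num)
  have ea : p₁ t = p t * (p₁ t / p t) := by field_simp
  have eb : p₂ t = p t * (p₂ t / p t) := by field_simp
  set u := p₁ t / p t
  set v := p₂ t / p t
  have hu : |u| ≤ C / c := b1.trans (mul_le_of_le_one_right (by positivity) ht1')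
  set S := Real.sin (q t + θ) with hS
  set W := Real.cos (q t + θ) with hW
  have hsc : S ^ 2 + W ^ 2 = 1 := Real.sin_sq_add_cos_sq _
  have hS1 : |S| ≤ 1 := Real.abs_sin_le_one _
  have hW1 : |W| ≤ 1 := Real.abs_cos_le_one _
  have hSW : |S * W| ≤ 1 := by
    rw [abs_mul]; exact mul_le_one₀ hS1 (abs_nonneg _) hW1
  have hS2 : S ^ 2 ≤ 1 := by linarith [sq_nonneg W]
  have eX : solX A θ p q t = A * p t * S := rfl
  have eY : solY A θ p p₁ q q₁ t = A * p t * (u * S + q₁ t * W) := by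
    rw [solY, ea]; ring
  have hAp : 0 < A * p t := by positivity
  have hden : solX A θ p q t ^ 2 + solY A θ p p₁ q q₁ t ^ 2 =
      (A * p t) ^ 2 * (S ^ 2 + (u * S + q₁ t * W) ^ 2) := by rw [eX, eY]; ring
  -- After division by `(A p)^2` the main term is `q'^2 ≥ c^2`; the terms with `q''` and `p''/p` are
  -- `O(t ^ (-2))`, and the last one is a square.
  have hnum : solY A θ p p₁ q q₁ t * solY A θ p p₁ q q₁ t - solX A θ p q t *
        (A * (p₂ t - p t * q₁ t ^ 2) * S + A * (2 * p₁ t * q₁ t + p t * q₂ t) * W) =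
      (A * p t) ^ 2 * (q₁ t ^ 2 - q₂ t * (S * W) - v * S ^ 2 + (u * S) ^ 2) := by
    rw [eX, eY, ea, eb]
    linear_combination (A * p t) ^ 2 * q₁ t ^ 2 * hsc
  have hQ : 0 < S ^ 2 + (u * S + q₁ t * W) ^ 2 :=
    sq_add_sq_pos_of_ne_zero (hc.trans_le hq).ne' hsc
  rw [hden, hnum, mul_div_mul_left _ _ (by positivity)]
  refine ⟨by positivity, ?_⟩
  have hY1 : (u * S + q₁ t * W) ^ 2 ≤ (C / c + C) ^ 2 := by
    have e1 : |u * S| ≤ C / c := by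
      rw [abs_mul]; exact (mul_le_of_le_one_right (abs_nonneg _) hS1).trans hu
    have e2 : |q₁ t * W| ≤ C := by
      rw [abs_mul, abs_of_pos (hc.trans_le hq)]
      exact (mul_le_of_le_one_right (hc.trans_le hq).le hW1).trans hq'
    rw [← sq_abs]
    exact pow_le_pow_left₀ (abs_nonneg _) ((abs_add_le _ _).trans (add_le_add e1 e2)) 2
  have hN : c ^ 2 / 2 ≤ q₁ t ^ 2 - q₂ t * (S * W) - v * S ^ 2 + (u * S) ^ 2 := by
    have e1 : q₂ t * (S * W) ≤ C * t ^ (-2 : ℝ) := by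
      refine (le_abs_self _).trans ?_
      rw [abs_mul]
      exact (mul_le_of_le_one_right (abs_nonneg _) hSW).trans b3
    have e2 : v * S ^ 2 ≤ C / c * t ^ (-2 : ℝ) := by
      refine (le_abs_self _).trans ?_
      rw [abs_mul, abs_of_nonneg (sq_nonneg S)]
      exact (mul_le_of_le_one_right (abs_nonneg _) hS2).trans b2
    have e3 : c ^ 2 ≤ q₁ t ^ 2 := by gcongr
    linarith [sq_nonneg (u * S)]
  calc c ^ 2 / 2 / (1 + (C / c + C) ^ 2)
      ≤ c ^ 2 / 2 / (S ^ 2 + (u * S + q₁ t * W) ^ 2) :=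
        div_le_div_of_nonneg_left (by positivity) hQ (by linarith)
    _ ≤ _ := by gcongr

/-- For large times, the phase curve contracts between two passages through the same ray. -/
theorem exists_contraction (h : AmplitudePhase t₀ α K c C t₂ p p₁ p₂ q q₁ q₂) {A : ℝ}
    (θ : ℝ) (hA : 0 < A) : ∃ T₁ : ℝ, t₀ ≤ T₁ ∧ ∀ t t' l, T₁ ≤ t → t < t' → 0 < l →
      solX A θ p q t' = l * solX A θ p q t →
      solY A θ p p₁ q q₁ t' = l * solY A θ p p₁ q q₁ t → l < 1 := by
  have hc := h.c_pos
  have hC := h.C_pos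
  have ht₀ := h.t₀_pos
  set k := c / C with hk
  have hk0 : 0 < k := by positivity
  have hk1 : k ≤ 1 := by
    rw [hk, div_le_one hC]
    exact le_of_mul_le_mul_right ((h.le_p t₀ le_rfl).trans (h.p_le t₀ le_rfl))
      (Real.rpow_pos_of_pos ht₀ _)
  set E := (C / c + (C / c) ^ 2 + C) / c with hE
  have hE0 : 0 < E := by positivity
  -- If `l ≥ 1`, the estimates below give `k * t * δ ≤ 4 * E * δ`, which `t > 8 * E / k`
  -- contradicts.
  refine ⟨max (max t₀ t₂) (8 * E / k + 1), (le_max_left _ _).trans (le_max_left _ _), ?_⟩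
  intro t t' l hTt htt' hl hx hy
  have ht0 : t₀ ≤ t := ((le_max_left _ _).trans (le_max_left _ _)).trans hTt
  have ht2 : t₂ ≤ t := ((le_max_right _ _).trans (le_max_left _ _)).trans hTt
  have htE : 8 * E / k < t := by linarith [(le_max_right (max t₀ t₂) (8 * E / k + 1)).trans hTt]
  have ht0' : t₀ ≤ t' := ht0.trans htt'.le
  have htp : 0 < t := ht₀.trans_le ht0
  have htp' : 0 < t' := htp.trans htt'
  have hp := h.p_pos ht0
  have hp' := h.p_pos ht0'
  set δ := t ^ (-1 : ℝ) - t' ^ (-1 : ℝ) with hδ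
  have hδ0 : 0 < δ := by
    rw [hδ, Real.rpow_neg_one, Real.rpow_neg_one, sub_pos]
    exact inv_strictAnti₀ htp htt'
  have inc : ∀ {w w' : ℝ → ℝ} {G : ℝ}, (∀ t, t₀ ≤ t → HasDerivWithinAt w (w' t) (Ici t₀) t) →
      (∀ t, t₀ ≤ t → |w' t| ≤ G * t ^ (-2 : ℝ)) → |w t - w t'| ≤ G * δ := by
    intro w w' G hw hw'
    rw [abs_sub_comm]
    refine (abs_sub_le_rpow (β := -1) (C := G) ht₀ (by norm_num) hw (fun s hs => ?_) ht0
      htt'.le).trans (le_of_eq ?_)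
    · rw [show (-1 : ℝ) - 1 = -2 by norm_num]; exact hw' s hs
    · rw [hδ, div_neg, div_one]; ring
  have hb := inc h.q₁_deriv h.abs_q₂_le
  have ha : |p₁ t / p t - p₁ t' / p t'| ≤ (C / c + (C / c) ^ 2) * δ := by
    refine inc (fun s hs => (h.p₁_deriv s hs).div (h.p_deriv s hs) (h.p_pos hs).ne') fun s hs => ?_
    have hps := h.p_pos hs
    have e : (p₂ s * p s - p₁ s * p₁ s) / p s ^ 2 = p₂ s / p s - (p₁ s / p s) ^ 2 := by
      field_simp
    have e1 := h.abs_p₁_div_le hs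
    have e2 : s ^ (-2 : ℝ) = (s ^ (-1 : ℝ)) ^ 2 := by
      rw [← Real.rpow_natCast, ← Real.rpow_mul (ht₀.trans_le hs).le]; norm_num
    have e3 : |(p₁ s / p s) ^ 2| ≤ (C / c) ^ 2 * s ^ (-2 : ℝ) := by
      rw [abs_pow, e2, ← mul_pow]
      exact pow_le_pow_left₀ (abs_nonneg _) e1 2
    rw [e, add_mul]
    exact (abs_sub _ _).trans (add_le_add (h.abs_p₂_div_le hs) e3)
  -- Here `-p'/p ≥ k / s ≥ k t / s^2` for `s ≥ t`; integrating the last expression gives a multiple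
  -- of `δ`, the unit in which the distortions are measured.
  have hlog : k * (t * δ) ≤ Real.log (p t) - Real.log (p t') := by
    have mono : ∀ {f : ℝ → ℝ} {f' s : ℝ}, HasDerivWithinAt f f' (Ici t₀) s →
      HasDerivWithinAt f f' (Ici t) s := fun hf => hf.mono (Ici_subset_Ici.2 ht0)
    have h1 := abs_sub_le_of_abs_deriv_le (a := t) (f := fun s : ℝ => k * t * s ^ (-1 : ℝ))
      (f' := fun s => k * t * (-1 * s ^ (-1 - 1 : ℝ)))
      (g := fun s => -Real.log (p s)) (g' := fun s => -(p₁ s / p s))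
      (fun s hs => ((Real.hasDerivAt_rpow_const (p := -1)
        (Or.inl (htp.trans_le hs).ne')).const_mul (k * t)).hasDerivWithinAt)
      (fun s hs => (mono ((h.p_deriv s (ht0.trans hs)).log (h.p_pos (ht0.trans hs)).ne')).neg)
      (fun s hs => ?_) le_rfl htt'.le
    · have h3 := (neg_le_abs _).trans h1
      rw [hδ]
      linarith
    · have hsp : 0 < s := htp.trans_le hs
      have hps := h.p_pos (ht0.trans hs)
      have hspow := Real.rpow_pos_of_pos hsp (-1 - 1)
      have hspow1 := Real.rpow_pos_of_pos hsp (-1)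
      have e1 : |k * t * (-1 * s ^ (-1 - 1 : ℝ))| = k * t * s ^ (-1 - 1 : ℝ) := by
        rw [abs_mul, abs_of_pos (mul_pos hk0 htp), abs_mul, abs_neg, abs_one, one_mul,
          abs_of_pos hspow]
      have e2 : t * s ^ (-1 - 1 : ℝ) ≤ s ^ (-1 : ℝ) := by
        rw [Real.rpow_sub_one hsp.ne', ← mul_div_assoc, div_le_iff₀ hsp]
        rw [mul_comm]
        exact mul_le_mul_of_nonneg_left hs hspow1.le
      have e3 : k * s ^ (-1 : ℝ) ≤ -(p₁ s / p s) := by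
        rw [← neg_div, le_div_iff₀ hps]
        have := h.p₁_le s (ht2.trans hs)
        have e4 := h.p_le s (ht0.trans hs)
        calc k * s ^ (-1 : ℝ) * p s ≤ k * s ^ (-1 : ℝ) * (C * s ^ (-α)) := by gcongr
          _ = c * s ^ (-α - 1) := by
            rw [show -α - 1 = -1 + -α by ring, Real.rpow_add hsp, hk]; field_simp
          _ ≤ _ := by linarith
      rw [e1, mul_assoc]
      exact (mul_le_mul_of_nonneg_left e2 hk0.le).trans e3
  have htδ : t * δ ≤ 1 := by
    have : t * t ^ (-1 : ℝ) = 1 := by rw [Real.rpow_neg_one]; field_simp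
    have h1 : 0 < t * t' ^ (-1 : ℝ) := mul_pos htp (Real.rpow_pos_of_pos htp' _)
    rw [hδ, mul_sub]; linarith
  set e := k * (t * δ) with he
  have he0 : 0 < e := by positivity
  have he1 : e ≤ 1 := by
    exact mul_le_one₀ hk1 (by positivity) htδ
  have hratio : p t' ^ 2 ≤ p t ^ 2 * (1 - e / 2) := by
    have h1 : Real.log (p t') ≤ Real.log (p t) - e := by linarith
    have h2 : p t' ≤ p t * Real.exp (-e) := by
      rw [← Real.log_le_log_iff hp' (by positivity), Real.log_mul hp.ne' (Real.exp_pos _).ne',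
        Real.log_exp]
      linarith
    calc p t' ^ 2 ≤ (p t * Real.exp (-e)) ^ 2 := by gcongr
      _ = p t ^ 2 * Real.exp (-e) ^ 2 := by ring
      _ ≤ _ := mul_le_mul_of_nonneg_left (exp_neg_sq_le he0.le he1) (sq_nonneg _)
  by_contra! hl1
  have hq' := h.le_q₁ t' ht0'
  have hq'0 : 0 < q₁ t' := hc.trans_le hq'
  have eu : p₁ t = p t * (p₁ t / p t) := by field_simp
  have eu' : p₁ t' = p t' * (p₁ t' / p t') := by field_simp
  unfold solX at hx
  unfold solY at hy
  rw [eu, eu'] at hy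
  set u := p₁ t / p t
  set u' := p₁ t' / p t'
  set S := Real.sin (q t + θ)
  set W := Real.cos (q t + θ)
  have hsc : S ^ 2 + W ^ 2 = 1 := Real.sin_sq_add_cos_sq _
  have hsc' := Real.sin_sq_add_cos_sq (q t' + θ)
  have hS1 : |S| ≤ 1 := Real.abs_sin_le_one _
  have hW1 : |W| ≤ 1 := Real.abs_cos_le_one _
  set S' := Real.sin (q t' + θ)
  set W' := Real.cos (q t' + θ)
  have hx2 : p t' * S' = l * (p t * S) := by
    apply mul_left_cancel₀ hA.ne'; linear_combination hx
  -- Subtracting `u'` times the first coordinate from the second leaves `q'` times the cosine. The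
  -- mismatch `ζ` comes from the changes of `p'/p` and `q'` alone.
  set ζ := ((u - u') * S + (q₁ t - q₁ t') * W) / q₁ t' with hζ
  have hy2 : p t' * W' = l * (p t * (W + ζ)) := by
    have h1 : q₁ t' * ζ = (u - u') * S + (q₁ t - q₁ t') * W := by rw [hζ]; field_simp
    apply mul_left_cancel₀ (mul_pos hA hq'0).ne'
    linear_combination hy - A * u' * hx2 - A * l * p t * h1
  have hζ1 : |ζ| ≤ E * δ := by
    rw [hζ, abs_div, abs_of_pos hq'0, div_le_iff₀ hq'0]
    have e1 : |(u - u') * S| ≤ (C / c + (C / c) ^ 2) * δ := by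
      rw [abs_mul]; exact (mul_le_of_le_one_right (abs_nonneg _) hS1).trans ha
    have e2 : |(q₁ t - q₁ t') * W| ≤ C * δ := by
      rw [abs_mul]; exact (mul_le_of_le_one_right (abs_nonneg _) hW1).trans hb
    calc |(u - u') * S + (q₁ t - q₁ t') * W| ≤ (C / c + (C / c) ^ 2) * δ + C * δ :=
          (abs_add_le _ _).trans (add_le_add e1 e2)
      _ = E * δ * c := by rw [hE]; field_simp
      _ ≤ _ := by gcongr
  -- Squaring and adding eliminates the phase at `t'`.
  have hkey : p t' ^ 2 = l ^ 2 * (p t ^ 2 * (S ^ 2 + (W + ζ) ^ 2)) := by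
    linear_combination (-(p t') ^ 2) * hsc' + (p t' * S' + l * (p t * S)) * hx2 +
      (p t' * W' + l * (p t * (W + ζ))) * hy2
  have hQ : 1 - 2 * (E * δ) ≤ S ^ 2 + (W + ζ) ^ 2 := by
    refine one_sub_le_sq_add_sq hsc ?_
    rw [abs_mul]; exact (mul_le_of_le_one_left (abs_nonneg _) hW1).trans hζ1
  have hQ0 : 0 ≤ p t ^ 2 * (S ^ 2 + (W + ζ) ^ 2) := by positivity
  have h1 : p t ^ 2 * (S ^ 2 + (W + ζ) ^ 2) ≤ p t ^ 2 * (1 - e / 2) := by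
    exact ((le_mul_of_one_le_left hQ0 (one_le_pow₀ hl1)).trans_eq hkey.symm).trans hratio
  have h2 := le_of_mul_le_mul_left h1 (by positivity)
  have h3 : e ≤ 4 * (E * δ) := by linarith
  rw [he] at h3
  rw [div_lt_iff₀ hk0] at htE
  have h4 := mul_lt_mul_of_pos_right htE hδ0
  have h5 := mul_pos hE0 hδ0
  linarith

/-- The lower bound on the angular velocity makes the clockwise angle strictly increasing and
unbounded; `exists_contraction`, applied with the ratio of two radii on one ray, makes the radius
decrease from turn to turn. -/
theorem exists_isSpiral (h : AmplitudePhase t₀ α K c C t₂ p p₁ p₂ q q₁ q₂) {A : ℝ} (θ : ℝ)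
    (hA : 0 < A) : ∃ t₁, t₀ ≤ t₁ ∧ IsSpiral (solPlane A θ p p₁ q q₁ '' Ici t₁) := by
  obtain ⟨m, T₁, hm, hT₁, hvel⟩ := h.exists_le_angular_velocity θ hA
  obtain ⟨T₂, -, hcon⟩ := h.exists_contraction θ hA
  set a := max T₁ T₂
  have ha : t₀ ≤ a := hT₁.trans (le_max_left _ _)
  have hle1 : ∀ {t}, a ≤ t → T₁ ≤ t := fun ht => (le_max_left _ _).trans ht
  have hle2 : ∀ {t}, a ≤ t → T₂ ≤ t := fun ht => (le_max_right _ _).trans ht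
  have cont : ∀ {f f' : ℝ → ℝ}, (∀ t, t₀ ≤ t → HasDerivWithinAt f (f' t) (Ici t₀) t) →
      ContinuousOn f (Ici a) := fun h t ht =>
    ((h t (ha.trans ht)).continuousWithinAt).mono (Ici_subset_Ici.2 ha)
  have dX : ∀ t, a ≤ t → HasDerivWithinAt (solX A θ p q) (solY A θ p p₁ q q₁ t) (Ici a) t :=
    fun t ht => (h.hasDerivWithinAt_solX A θ (ha.trans ht)).mono (Ici_subset_Ici.2 ha)
  have dY := fun t (ht : a ≤ t) =>
    (h.hasDerivWithinAt_solY A θ (ha.trans ht)).mono (Ici_subset_Ici.2 ha)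
  have cp := cont h.p_deriv
  have cp₁ := cont h.p₁_deriv
  have cq := cont h.q_deriv
  have cq₁ := cont h.q₁_deriv
  have cp₂ := h.p₂_cont.mono (Ici_subset_Ici.2 ha)
  have cq₂ := h.q₂_cont.mono (Ici_subset_Ici.2 ha)
  have cY : ContinuousOn (solY A θ p p₁ q q₁) (Ici a) := fun t ht => (dY t ht).continuousWithinAt
  obtain ⟨φ, hφa, dφ, hpol⟩ := exists_clockwise_angle dX dY cY (by fun_prop)
    fun t ht => (hvel t (hle1 ht)).1
  have cφ : ContinuousOn φ (Ici a) := fun t ht => (dφ t ht).continuousWithinAt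
  have hgrow : ∀ s t, a ≤ s → s ≤ t → m * (t - s) ≤ φ t - φ s := by
    intro s t hs hst
    have h1 := abs_sub_le_of_abs_deriv_le (a := a) (f := fun t => m * t) (f' := fun _ => m)
      (fun t _ => by simpa using ((hasDerivAt_id t).const_mul m).hasDerivWithinAt (s := Ici a))
      dφ (fun t ht => by rw [abs_of_pos hm]; exact (hvel t (hle1 ht)).2) hs hst
    have h2 := (le_abs_self _).trans h1
    linarith
  refine ⟨a, ha, isSpiral_of_clockwise_angle
    (R := fun t => Real.sqrt (solX A θ p q t ^ 2 + solY A θ p p₁ q q₁ t ^ 2)) hφa cφ ?_ ?_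
    (fun t ht => Real.sqrt_pos.2 (hvel t (hle1 ht)).1) ?_ (fun t ht => (hpol t ht).1)
    (fun t ht => (hpol t ht).2) ?_⟩
  · intro s hs t ht hst
    have := hgrow s t hs hst.le
    nlinarith
  · have h1 : Tendsto (fun t => m * (t - a) + φ a) atTop atTop :=
      tendsto_atTop_add_const_right _ _
        ((tendsto_atTop_add_const_right _ (-a) tendsto_id).const_mul_atTop hm)
    refine tendsto_atTop_mono' _ ?_ h1
    filter_upwards [eventually_ge_atTop a] with t ht
    linarith [hgrow a t le_rfl ht]
  · obtain ⟨E, hE, oX, oY⟩ := h.exists_oscillation θ hA.le ha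
    have hz : Tendsto (fun t : ℝ => E * t ^ (-α)) atTop (𝓝 0) := by
      simpa using (tendsto_rpow_neg_atTop h.α_pos).const_mul E
    have zero : ∀ {g : ℝ → ℝ}, (∀ t, a ≤ t → |g t| ≤ E * t ^ (-α)) → Tendsto g atTop (𝓝 0) := by
      intro g hg
      refine squeeze_zero_norm' ?_ hz
      filter_upwards [eventually_ge_atTop a] with t ht using hg t ht
    have bdd : ∀ {g w : ℝ → ℝ}, Tendsto g atTop (𝓝 0) → (∀ t, |w t| ≤ 1) →
        Tendsto (fun t => g t * w t) atTop (𝓝 0) := by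
      intro g w hg hw
      refine squeeze_zero_norm (fun t => ?_) (by simpa using hg.abs)
      rw [Real.norm_eq_abs, abs_mul]
      exact mul_le_of_le_one_right (abs_nonneg _) (hw t)
    have lX : Tendsto (solX A θ p q) atTop (𝓝 0) :=
      bdd (zero oX.g_le) fun t => Real.abs_sin_le_one _
    have lY : Tendsto (solY A θ p p₁ q q₁) atTop (𝓝 0) := by
      have := (bdd (w := fun t => Real.sin (q t + θ)) (zero oY.g_le)
        fun t => Real.abs_sin_le_one _).add
        (bdd (w := fun t => Real.cos (q t + θ)) (zero oY.h_le) fun t => Real.abs_cos_le_one _)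
      rwa [add_zero] at this
    simpa using ((lX.pow 2).add (lY.pow 2)).sqrt
  · intro t t' ht htt' hφ
    have ht' : a ≤ t' := ht.trans htt'.le
    obtain ⟨x1, y1⟩ := hpol t ht
    obtain ⟨x2, y2⟩ := hpol t' ht'
    have r1 := Real.sqrt_pos.2 (hvel t (hle1 ht)).1
    have r2 := Real.sqrt_pos.2 (hvel t' (hle1 ht')).1
    rw [hφ, Real.cos_add_two_pi] at x2
    rw [hφ, Real.sin_add_two_pi] at y2
    set R := Real.sqrt (solX A θ p q t ^ 2 + solY A θ p p₁ q q₁ t ^ 2)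
    set R' := Real.sqrt (solX A θ p q t' ^ 2 + solY A θ p p₁ q q₁ t' ^ 2)
    have := hcon t t' (R' / R) (hle2 ht) htt' (div_pos r2 r1)
      (by rw [x2, x1]; field_simp) (by rw [y2, y1]; field_simp)
    rwa [div_lt_one r1] at this

end AmplitudePhase

/-! ### Solutions of the equation and of the system -/

theorem AmplitudePhase.exists_eq_sol {t₀ α K c C t₂ : ℝ} {p q : ℝ → ℝ}
    (h : AmplitudePhase t₀ α K c C t₂ p (D t₀ 1 p) (D t₀ 2 p) q (D t₀ 1 q) (D t₀ 2 q)) {t₁ : ℝ}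
    (ht₁ : t₀ ≤ t₁) {x y : ℝ → ℝ} (hx : ∀ t, t₁ ≤ t → HasDerivWithinAt x (y t) (Ici t₁) t)
    (hy : ∀ t, t₁ ≤ t → HasDerivWithinAt y
      (-restoringCoeff t₀ p q t * x t + dampingCoeff t₀ p q t * y t) (Ici t₁) t) :
    ∃ A θ : ℝ, 0 ≤ A ∧ (∀ t, t₁ ≤ t → x t = solX A θ p q t ∧
      y t = solY A θ p (D t₀ 1 p) q (D t₀ 1 q) t) ∧
      ((∃ t, t₁ ≤ t ∧ (x t ≠ 0 ∨ y t ≠ 0)) → 0 < A) := by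
  obtain ⟨A, θ, hA, hsol⟩ := h.exists_eq_sin ht₁ hx hy
  refine ⟨A, θ, hA, hsol, ?_⟩
  rintro ⟨t, ht, hne⟩
  refine lt_of_le_of_ne hA ?_
  rintro rfl
  have := hsol t ht
  simp at this
  tauto

theorem IsSolution.hasDerivWithinAt {t₀ : ℝ} {p q x : ℝ → ℝ} (hx : IsSolution t₀ p q x) :
    (∀ t, t₀ ≤ t → HasDerivWithinAt x (D t₀ 1 x t) (Ici t₀) t) ∧
      ∀ t, t₀ ≤ t → HasDerivWithinAt (D t₀ 1 x)
        (-restoringCoeff t₀ p q t * x t + dampingCoeff t₀ p q t * D t₀ 1 x t) (Ici t₀) t := by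
  constructor
  · simpa [D_zero] using hasDerivWithinAt_D (n := 2) hx.1 (j := 0) (by norm_num)
  · intro t ht
    have h1 := hasDerivWithinAt_D (n := 2) hx.1 (j := 1) (by norm_num) t ht
    have h2 := hx.2 t ht
    convert! h1 using 1
    change _ = D t₀ 2 x t
    linarith

/-- The function `γ * z ^ (-1 / γ)` has derivative `1`. The constraint `z ≤ (γ / t₀) ^ γ` places the
shifted starting time in `[t₀, ∞)`. -/
theorem IsSystemSolution.exists_shift {t₀ γ s₀ : ℝ} {p q x y z : ℝ → ℝ} (ht₀ : 0 < t₀) (hγ : 0 < γ)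
    (h : IsSystemSolution t₀ γ p q s₀ x y z) :
    ∃ σ, t₀ ≤ s₀ + σ ∧ ∀ s, s₀ ≤ s →
      γ * z s ^ (-1 / γ) = s + σ ∧ z s = γ ^ γ * (s + σ) ^ (-γ) := by
  have hd : ∀ s, s₀ ≤ s → HasDerivWithinAt (fun s => γ * z s ^ (-1 / γ) - s) 0 (Ici s₀) s := by
    intro s hs
    have hz := h.z_pos s hs
    have h1 := (((h.z_deriv s hs).rpow_const (p := -1 / γ) (Or.inl hz.ne')).const_mul γ).sub
      (hasDerivWithinAt_id s (Ici s₀))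
    convert! h1 using 1
    have e : z s ^ ((γ + 1) / γ) * z s ^ (-1 / γ - 1) = 1 := by
      rw [← Real.rpow_add hz]
      have : (γ + 1) / γ + (-1 / γ - 1) = 0 := by field_simp; ring
      rw [this, Real.rpow_zero]
    field_simp
    field_simp at e
    linarith
  have hconst : ∀ s, s₀ ≤ s → γ * z s ^ (-1 / γ) = s + (γ * z s₀ ^ (-1 / γ) - s₀) := by
    intro s hs
    have h1 := abs_sub_le_mul (C := 0) hd (fun t ht => by simp) le_rfl hs
    rw [zero_mul] at h1
    have h2 := abs_eq_zero.1 (le_antisymm h1 (abs_nonneg _))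
    linarith
  refine ⟨γ * z s₀ ^ (-1 / γ) - s₀, ?_, fun s hs => ⟨hconst s hs, ?_⟩⟩
  · have hz := h.z_pos s₀ le_rfl
    have h1 := Real.rpow_le_rpow_of_nonpos hz (h.z_le s₀ le_rfl)
      (div_nonpos_of_nonpos_of_nonneg (by norm_num) hγ.le : -1 / γ ≤ 0)
    have hγt : 0 < γ / t₀ := by positivity
    have e : ((γ / t₀) ^ γ) ^ (-1 / γ) = t₀ / γ := by
      rw [← Real.rpow_mul hγt.le, mul_div_cancel₀ _ hγ.ne', Real.rpow_neg_one, inv_div]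
    rw [e, div_le_iff₀ hγ] at h1
    linarith
  · have hz := h.z_pos s hs
    have hzp := Real.rpow_pos_of_pos hz (-1 / γ)
    have e : (z s ^ (-1 / γ)) ^ (-γ) = z s := by
      rw [← Real.rpow_mul hz.le]
      have : -1 / γ * -γ = 1 := by field_simp
      rw [this, Real.rpow_one]
    rw [← hconst s hs, Real.mul_rpow hγ.le hzp.le, e, ← mul_assoc, ← Real.rpow_add hγ]
    simp

/-- In the shifted time `s + σ` the first two equations of the system are the second-order equation,
on a half-line that may begin later than `t₀`. -/
theorem IsSystemSolution.exists_eq_solSpace {t₀ α K c C t₂ γ s₀ : ℝ} {p q x y z : ℝ → ℝ}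
    (H : AmplitudePhase t₀ α K c C t₂ p (D t₀ 1 p) (D t₀ 2 p) q (D t₀ 1 q) (D t₀ 2 q))
    (hγ : 0 < γ) (h : IsSystemSolution t₀ γ p q s₀ x y z) :
    ∃ A θ σ : ℝ, 0 ≤ A ∧ t₀ ≤ s₀ + σ ∧
      (∀ s, s₀ ≤ s → spaceCurve x y z s =
        solSpace A θ (γ ^ γ) γ p (D t₀ 1 p) q (D t₀ 1 q) (s + σ)) ∧
      ((∃ s, s₀ ≤ s ∧ (x s ≠ 0 ∨ y s ≠ 0)) → 0 < A) := by
  obtain ⟨σ, hσ, hz⟩ := h.exists_shift H.t₀_pos hγ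
  have shift : ∀ {f : ℝ → ℝ} {f' t : ℝ}, HasDerivWithinAt f f' (Ici s₀) (t - σ) →
      HasDerivWithinAt (fun t => f (t - σ)) f' (Ici (s₀ + σ)) t := by
    intro f f' t hf
    have h1 := hf.scomp t ((hasDerivWithinAt_id t (Ici (s₀ + σ))).sub_const σ)
      (fun u hu => by simp only [mem_Ici, id] at hu ⊢; linarith)
    rw [one_smul] at h1
    exact h1
  obtain ⟨A, θ, hA, hsol, hne⟩ := H.exists_eq_sol (x := fun t => x (t - σ))
    (y := fun t => y (t - σ)) hσ (fun t ht => shift (h.x_deriv _ (by linarith))) fun t ht => by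
      have ht' : s₀ ≤ t - σ := by linarith
      have h1 := h.y_deriv _ ht'
      rw [U, V, (hz _ ht').1, sub_add_cancel] at h1
      exact shift h1
  refine ⟨A, θ, σ, hA, hσ, fun s hs => ?_, ?_⟩
  · obtain ⟨e1, e2⟩ := hsol (s + σ) (by linarith)
    simp only [add_sub_cancel_right] at e1 e2
    rw [spaceCurve, solSpace, e1, e2, (hz s hs).2]
  · rintro ⟨s, hs, hn⟩
    exact hne ⟨s + σ, by linarith, by simpa using hn⟩

theorem image_Ici_eq_of_shift {E : Type*} {f g : ℝ → E} {s₀ σ : ℝ}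
    (h : ∀ s, s₀ ≤ s → f s = g (s + σ)) : f '' Ici s₀ = g '' Ici (s₀ + σ) := by
  ext v
  constructor
  · rintro ⟨s, hs, rfl⟩
    exact ⟨s + σ, add_le_add_left hs σ, (h s hs).symm⟩
  · rintro ⟨t, ht, rfl⟩
    have ht' : s₀ ≤ t - σ := le_sub_iff_add_le.2 ht
    exact ⟨t - σ, ht', by rw [h _ ht', sub_add_cancel]⟩

end SpiralTraj

end

/-! ### Conclusion: phase portraits, non-rectifiable and rectifiable trajectories. -/

theorem theorem1 (t₀ α K : ℝ) (p q : ℝ → ℝ)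
    (ht₀ : 0 < t₀) (hα : 0 < α) (hK : 0 < K)
    (hp_smooth : ContDiffOn ℝ 3 p (Set.Ici t₀))
    (hq_smooth : ContDiffOn ℝ 3 q (Set.Ici t₀))
    (hp_ne : ∀ t, t₀ ≤ t → p t ≠ 0)
    (hq_ne : ∀ t, t₀ ≤ t → SpiralTraj.D t₀ 1 q t ≠ 0)
    (hp : SpiralTraj.ComparableInLimit t₀ 2 1 α p)
    (hp3 : SpiralTraj.D t₀ 3 p =O[Filter.atTop] fun t : ℝ => t ^ (-α - 3))
    (hq : SpiralTraj.ComparableInLimit t₀ 1 K (-1) q)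
    (hq2 : SpiralTraj.D t₀ 2 q =o[Filter.atTop] fun t : ℝ => t ^ (-3 : ℝ))
    (hq3 : SpiralTraj.D t₀ 3 q =o[Filter.atTop] fun t : ℝ => t ^ (-2 : ℝ)) :
    -- phase portraits and phase dimension
    (∀ x : ℝ → ℝ, SpiralTraj.IsSolution t₀ p q x → (∃ t, t₀ ≤ t ∧ x t ≠ 0) →
      (∃ t₁, t₀ ≤ t₁ ∧ SpiralTraj.IsSpiral (SpiralTraj.phaseCurve t₀ x '' Set.Ici t₁)) ∧
      (α < 1 →
        SpiralTraj.HasBoxDim (SpiralTraj.phaseCurve t₀ x '' Set.Ici t₀) (2 / (1 + α)))) ∧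
    -- trajectories of the spatial system, nonrectifiable cases
    (∀ (γ : ℝ), 0 < γ → ∀ (s₀ : ℝ) (x y z : ℝ → ℝ),
      SpiralTraj.IsSystemSolution t₀ γ p q s₀ x y z →
      (∃ s, s₀ ≤ s ∧ (x s ≠ 0 ∨ y s ≠ 0)) →
      (α < 1 → α ≤ γ →
        SpiralTraj.HasBoxDim (SpiralTraj.spaceCurve x y z '' Set.Ici s₀) (2 / (1 + α))) ∧
      (α < 1 → γ < α →
        SpiralTraj.HasBoxDim (SpiralTraj.spaceCurve x y z '' Set.Ici s₀)
          (2 - (α + γ) / (1 + γ)))) ∧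
    -- trajectories of the spatial system, rectifiable case
    (∀ (γ : ℝ), 0 < γ → ∀ (s₀ : ℝ) (x y z : ℝ → ℝ),
      SpiralTraj.IsSystemSolution t₀ γ p q s₀ x y z → 1 < α →
      SpiralTraj.IsRectifiable (SpiralTraj.spaceCurve x y z) s₀ ∧
      SpiralTraj.HasBoxDim (SpiralTraj.spaceCurve x y z '' Set.Ici s₀) 1) := by
  obtain ⟨c, C, t₂, H⟩ := SpiralTraj.exists_amplitudePhase ht₀ hα hK hp_smooth hq_smooth hp_ne
    hq_ne hp hq hq2
  refine ⟨fun x hx hne => ?_, fun γ hγ s₀ x y z hsys hne => ?_, fun γ hγ s₀ x y z hsys hα1 => ?_⟩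
  · obtain ⟨dx, dy⟩ := hx.hasDerivWithinAt
    obtain ⟨A, θ, -, hsol, hpos⟩ := H.exists_eq_sol le_rfl dx dy
    obtain ⟨t, ht, hxt⟩ := hne
    have hA := hpos ⟨t, ht, Or.inl hxt⟩
    have heq : ∀ t₁, t₀ ≤ t₁ → SpiralTraj.phaseCurve t₀ x '' Ici t₁ =
        SpiralTraj.solPlane A θ p (SpiralTraj.D t₀ 1 p) q (SpiralTraj.D t₀ 1 q) '' Ici t₁ := by
      intro t₁ ht₁
      refine image_congr fun t ht => ?_
      obtain ⟨e1, e2⟩ := hsol t (ht₁.trans ht)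
      rw [SpiralTraj.phaseCurve, SpiralTraj.solPlane, e1, e2]
    refine ⟨?_, fun hα1 => ?_⟩
    · obtain ⟨t₁, ht₁, hs⟩ := H.exists_isSpiral θ hA
      exact ⟨t₁, ht₁, by rwa [heq t₁ ht₁]⟩
    · rw [heq t₀ le_rfl]
      exact H.hasBoxDim_solPlane θ hA le_rfl hα1
  · obtain ⟨A, θ, σ, -, hσ, hcurve, hpos⟩ := hsys.exists_eq_solSpace H hγ
    rw [SpiralTraj.image_Ici_eq_of_shift hcurve]
    have hZ := Real.rpow_pos_of_pos hγ γ
    exact ⟨fun hα1 hαγ => H.hasBoxDim_solSpace_of_le θ (hpos hne) hσ hα1 hZ hαγ,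
      fun hα1 hγα => H.hasBoxDim_solSpace_of_lt θ (hpos hne) hσ hα1 hZ hγ hγα⟩
  -- Trivial trajectories are allowed here: `A = 0` leaves a segment of the `z`-axis, and the arc
  -- bound only needs `0 ≤ A`.
  · obtain ⟨A, θ, σ, hA, hσ, hcurve, -⟩ := hsys.exists_eq_solSpace H hγ
    have hZ := Real.rpow_pos_of_pos hγ γ
    refine ⟨?_, ?_⟩
    · obtain ⟨ℓ, L₀, L₁, hℓ, hf⟩ := H.exists_arc_bound_solSpace θ hA hσ hα1 hZ hγ
      refine SpiralTraj.isRectifiable_of_dist_le (ℓ := fun s => ℓ (s + σ)) (fun s t hs hst => ?_)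
        fun t ht => hℓ _ (by linarith)
      rw [hcurve s hs, hcurve t (hs.trans hst)]
      exact hf _ _ (by linarith) (by linarith)
    · rw [SpiralTraj.image_Ici_eq_of_shift hcurve]
      exact H.hasBoxDim_one_solSpace θ hA hσ hα1 hZ hγ
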